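/- Let $\mathbb{F}_q$ be a finite field of characteristic greater than $3$. A plane conic over $\mathbb{F}_q$ is the curve $x^{T}Ax=0$ in $\mathbb{P}^2$ given by a nonzero symmetric $3\times 3$ matrix $A$ over $\mathbb{F}_q$, up to scaling. Let $\Psi$ be the set of ordered pairs $(\mathcal{A},\mathcal{B})$ of smooth conics over $\mathbb{F}_q$ that intersect transversally (over $\overline{\mathbb{F}}_q$). For $(\mathcal{A},\mathcal{B})\in\Psi$ let $E$ be the set of pairs $(P,\xi)$, defined over $\overline{\mathbb{F}}_q$, where $P$ is a point of $\mathcal{A}$ and $\xi$ is a tangent line to $\mathcal{B}$ with $P\in\xi$. Define $j\colon E\to E$ by $j(P,\xi)=(P',\xi')$, where $P'$ is the second intersection point of $\xi$ with $\mathcal{A}$ and $\xi'$ is the second tangent line to $\mathcal{B}$ through $P'$ (with $P'=P$ if $\xi$ is tangent to $\mathcal{A}$, and $\xi'=\xi$ if $P'\in\mathcal{B}$). The pair satisfies the Poncelet tetragon condition if $j^4(e)=e$ for some $e\in E$; let $\Gamma_4\subseteq\Psi$ be the set of pairs satisfying it. For $(\mathcal{A},\mathcal{B})\in\Psi$ the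 $q$-power Frobenius permutes the four points of $\mathcal{A}\cap\mathcal{B}$ over $\overline{\mathbb{F}}_q$; the cycle type of this permutation, a partition of $4$, is the intersection type of the pair and of the pencil $\{\eta\mathcal{A}+\theta\mathcal{B}:(\eta:\theta)\in\mathbb{P}^1(\mathbb{F}_q)\}$ that it generates. Then $$\frac{|\Gamma_4|}{|\Psi|}=\frac1q+O(q^{-3/2}).$$ Moreover, for each intersection type, the proportion of the pencils of that type among all the pencils generated by pairs in $\Psi$, and the proportion of pairs satisfying the Poncelet tetragon condition, both among all the pairs in $\Psi$ of that type and among the pairs in $\Psi$ contained in any single pencil of that type, are as follows: $$\begin{array}{c|c|c} \text{type} & \text{proportion of pencils} & \text{proportion of pairs satisfying the condition}\\ \hline (1,1,1,1) & 1/24 & 3/q+O(q^{-3/2})\\ (2,1,1) & 1/4 & 1/q+O(q^{-3/2})\\ (2,2) & 1/8 & 3/q+O(q^{-3/2})\\ (3,1) & 1/3 & 0\\ (4) & 1/4 & 1/q+O(q^{-3/2}) \end{array}$$ The constants implied by $O$ are absolute, and the entry $0$ is exact: no pair in $\Psi$ of type $(3,1)$ satisfies the condition. -/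

import Mathlib

open scoped LinearAlgebra.Projectivization

namespace Poncelet

/-- The space of symmetric `3 × 3` matrices over `k`. In characteristic different from `2` a
symmetric matrix `A` is the same thing as the ternary quadratic form `xᵀ A x`. -/
def symMatrices (k : Type*) [Field k] : Submodule k (Matrix (Fin 3) (Fin 3) k) where
  carrier := {A | A.IsSymm}
  add_mem' := fun {_ _} ha hb => Matrix.IsSymm.add ha hb
  zero_mem' := Matrix.isSymm_zero
  smul_mem' := fun c {_} h => Matrix.IsSymm.smul h c

/-- A projective plane conic `xᵀ A x = 0` over `k`: a nonzero symmetric matrix up to a scalar. -/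
abbrev Conic (k : Type*) [Field k] := ℙ k (symMatrices k)

noncomputable section

variable {F : Type*} [Field F]

/-- The geometric points of the projective plane over `F`. -/
abbrev GeomPoint (F : Type*) [Field F] := ℙ (AlgebraicClosure F) (Fin 3 → AlgebraicClosure F)

/-- The geometric lines `ξ₀ x + ξ₁ y + ξ₂ z = 0`, given by their coordinates; the point `P` lies
on the line `ξ` exactly when `P.orthogonal ξ`. -/
abbrev GeomLine (F : Type*) [Field F] := ℙ (AlgebraicClosure F) (Fin 3 → AlgebraicClosure F)

namespace Conic

/-- A matrix of the conic (well defined up to a nonzero scalar), over the algebraic closure. -/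
def geomMatrix (A : Conic F) : Matrix (Fin 3) (Fin 3) (AlgebraicClosure F) :=
  (A.rep : Matrix (Fin 3) (Fin 3) F).map (algebraMap F (AlgebraicClosure F))

/-- Half the gradient at `P` of the equation `xᵀ A x` of the conic; if `P` is a smooth point of
the conic, these are the coordinates of the tangent line at `P`. -/
def polar (A : Conic F) (P : GeomPoint F) : Fin 3 → AlgebraicClosure F :=
  Matrix.mulVec A.geomMatrix P.rep

/-- The geometric point `P` lies on the conic `A`. -/
def Contains (A : Conic F) (P : GeomPoint F) : Prop :=
  P.rep ⬝ᵥ A.polar P = 0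

/-- The conic has no geometric singular point. -/
def IsSmooth (A : Conic F) : Prop :=
  ∀ P : GeomPoint F, A.Contains P → A.polar P ≠ 0

/-- `ξ` is the tangent line to `B` at one of its geometric points; for smooth `B` these lines are
the points of the dual conic of `B`. -/
def IsTangentLine (B : Conic F) (ξ : GeomLine F) : Prop :=
  ∃ Q : GeomPoint F, B.Contains Q ∧
    ∃ h : B.polar Q ≠ 0, ξ = Projectivization.mk (AlgebraicClosure F) (B.polar Q) h

/-- The two conics have distinct tangent lines at each common geometric point. -/
def Transversal (A B : Conic F) : Prop :=
  ∀ P : GeomPoint F, A.Contains P → B.Contains P →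
    LinearIndependent (AlgebraicClosure F) ![A.polar P, B.polar P]

/-- The pencil generated by `A` and `B`: all the conics `η A + θ B` with `(η : θ) ∈ ℙ¹(F)`. -/
def pencil (A B : Conic F) : Set (Conic F) :=
  {C | C.submodule ≤ A.submodule ⊔ B.submodule}

end Conic

/-- The curve `E ⊆ 𝒜 × ℬ*` of all `(P, ξ)` with `P ∈ 𝒜`, `ξ` tangent to `ℬ` and `P ∈ ξ`. -/
def incidenceCurve (A B : Conic F) : Set (GeomPoint F × GeomLine F) :=
  {e | A.Contains e.1 ∧ B.IsTangentLine e.2 ∧ e.1.orthogonal e.2}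

/-- The graph of the operation `j : (P, ξ) ↦ (P', ξ')` on the curve `E`: `P'` is the other point of
intersection of `ξ` and `𝒜` (so that `ξ ∩ 𝒜 = {P, P'}`, with `P' = P` if `ξ` is tangent to `𝒜`),
and `ξ'` is the other tangent line to `ℬ` through `P'` (so that the tangent lines to `ℬ` through
`P'` are `ξ` and `ξ'`, with `ξ' = ξ` if there is only one). -/
def IsStep (A B : Conic F) (e e' : GeomPoint F × GeomLine F) : Prop :=
  (∀ X : GeomPoint F, (A.Contains X ∧ X.orthogonal e.2) ↔ (X = e.1 ∨ X = e'.1)) ∧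
  (∀ ℓ : GeomLine F, (B.IsTangentLine ℓ ∧ e'.1.orthogonal ℓ) ↔ (ℓ = e.2 ∨ ℓ = e'.2))

/-- The Poncelet `n`-gon condition: there is `e ∈ E` with `j^n(e) = e`. -/
def NGonCondition (n : ℕ) (A B : Conic F) : Prop :=
  ∃ e : ℕ → GeomPoint F × GeomLine F,
    e 0 ∈ incidenceCurve A B ∧ (∀ i < n, IsStep A B (e i) (e (i + 1))) ∧ e n = e 0

/-- The `q`-power Frobenius map on geometric points, where `q` is the number of elements of
the finite field `F`. -/
def geomFrobenius [Fintype F] (P : GeomPoint F) : GeomPoint F :=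
  Projectivization.mk (AlgebraicClosure F) (fun i => P.rep i ^ Fintype.card F) (by
    intro h
    apply P.rep_nonzero
    funext i
    exact eq_zero_of_pow_eq_zero (congrFun h i))

/-- `A` and `B` meet in exactly four geometric points, and `τ` is the multiset of the lengths of
the cycles (fixed points included) of the permutation of these points by Frobenius. -/
def HasIntersectionType [Fintype F] (A B : Conic F) (τ : Multiset ℕ) : Prop :=
  ∃ (p : Fin 4 → GeomPoint F) (σ : Equiv.Perm (Fin 4)),
    Function.Injective p ∧
    (∀ X : GeomPoint F, (A.Contains X ∧ B.Contains X) ↔ X ∈ Set.range p) ∧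
    (∀ i, geomFrobenius (p i) = p (σ i)) ∧
    σ.partition.parts = τ

/-- The set `Ψ` of ordered pairs of smooth conics over `F` with transversal intersection. -/
def smoothPairs (F : Type*) [Field F] : Set (Conic F × Conic F) :=
  {x | x.1.IsSmooth ∧ x.2.IsSmooth ∧ x.1.Transversal x.2}

/-- The set `Γₙ` of the pairs in `Ψ` satisfying the Poncelet `n`-gon condition. -/
def ponceletPairs (F : Type*) [Field F] (n : ℕ) : Set (Conic F × Conic F) :=
  {x | x ∈ smoothPairs F ∧ NGonCondition n x.1 x.2}

/-- The pairs in `Ψ` of intersection type `τ`. -/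
def smoothPairsOfType (F : Type*) [Field F] [Fintype F] (τ : Multiset ℕ) :
    Set (Conic F × Conic F) :=
  {x | x ∈ smoothPairs F ∧ HasIntersectionType x.1 x.2 τ}

/-- The pairs in `Ψ` both of whose members belong to the pencil `W`. -/
def smoothPairsIn (W : Set (Conic F)) : Set (Conic F × Conic F) :=
  {x | x ∈ smoothPairs F ∧ x.1 ∈ W ∧ x.2 ∈ W}

/-- The pencils generated by the pairs in `Ψ`. -/
def pencils (F : Type*) [Field F] : Set (Set (Conic F)) :=
  {W | ∃ x ∈ smoothPairs F, W = x.1.pencil x.2}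

/-- The pencils generated by the pairs in `Ψ` of intersection type `τ`. -/
def pencilsOfType (F : Type*) [Field F] [Fintype F] (τ : Multiset ℕ) : Set (Set (Conic F)) :=
  {W | ∃ x ∈ smoothPairsOfType F τ, W = x.1.pencil x.2}

/-- The proportion `|S ∩ T| / |T|` of the elements of the finite set `T` that lie in `S`. -/
def proportion {α : Type*} (S T : Set α) : ℝ :=
  ((S ∩ T).ncard : ℝ) / (T.ncard : ℝ)

/-- Up to an error of at most `C q^(-3/2)`, where `q = |F|`, a proportion `c / q` of the pairs
in `Ψ` of intersection type `τ`, and also of the pairs in `Ψ` inside each single pencil of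
type `τ`, satisfies the Poncelet tetragon condition. -/
def TetragonDensity (F : Type*) [Field F] [Fintype F] (C : ℝ) (τ : Multiset ℕ) (c : ℝ) : Prop :=
  |proportion (ponceletPairs F 4) (smoothPairsOfType F τ) - c / (Fintype.card F : ℝ)|
      ≤ C * (Fintype.card F : ℝ) ^ (-(3 / 2) : ℝ) ∧
  ∀ W ∈ pencilsOfType F τ,
    |proportion (ponceletPairs F 4) (smoothPairsIn W) - c / (Fintype.card F : ℝ)|
      ≤ C * (Fintype.card F : ℝ) ^ (-(3 / 2) : ℝ)

end

end Poncelet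

open Matrix

namespace Poncelet

/-! ### Quadrilaterals between the conic `x ⬝ᵥ x = 0` and a diagonal conic -/

section NormalForm

variable {k : Type*} [Field k]

/-! Over the algebraic closure the four common points of a pair in `Ψ` are given by vectors `u i`,
scaled so that they add up to zero (`exists_frame`). In the basis `u 0 + u 1`, `u 0 + u 2`, `u 0 + u
3`, the diagonal triangle of the quadrangle, they become `(±1, ±1, ±1)`, and the conics through them
become the diagonal forms whose coefficients have sum `0`.

For simultaneously diagonal conics with coefficients `a` and `b`, Cayley's criterion for
quadrilaterals (`tetragon_iff`) says that with `β = a / b` some index satisfies `2 * β i = ∑ j, β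
j`. To see this, rescale `𝒜` to `x ⬝ᵥ x = 0`. The chord joining points `P`, `R` of `𝒜` touches `ℬ`
exactly when `P` and `R` are conjugate for the diagonal form `L` with entries `2 * β i - ∑ j, β j`
(`diagForm_cross`). In a closed quadrilateral, `L P₁` and `L P₃` are both orthogonal to `P₀` and
`P₂`, hence proportional, so `L` is singular. Polygons with coinciding opposite vertices need
separate care. If `L` is singular, a quadrilateral can be written down.

Fix a smooth `B` in a pencil. The other conics over `F` in it are `C + x B` with `x` in `F`. With `r
j` the ratios of the diagonal coordinates of `C` and `B`, such a conic is singular exactly for `x =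
-r j`, and, when smooth, satisfies the tetragon condition with `B` exactly for `x = 2 * r j - ∑ i, r
i`. Frobenius permutes the `r j` as it permutes the three pairs of opposite sides of the quadrangle,
so each list contains exactly `s` elements of `F`, where `s` is the number of pairs it fixes: `3, 1,
3, 0, 1` for the five types. The lists can meet only if `B` has two equal diagonal coordinates,
which happens for at most three conics of the pencil. A pencil therefore contains `(q + 1 - s) (q -
s)` pairs of `Ψ`, and between `s (q - 2 - s)` and `s (q + 1 - s)` of them satisfy the condition
(`ncard_smoothPairsIn`, `ncard_tetragonPairsIn`). The resulting error is in fact `O(q ^ (-2))`.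

To count pencils, scale the frame so that Frobenius permutes its vectors exactly
(`exists_twisted_frame`). For each permutation `σ` the group `GL₃(F)` acts simply transitively on
the frames twisted by `σ`, and each pencil comes from `24 (q - 1)` twisted frames. Hence pencils are
distributed among the types as permutations are among the conjugacy classes of `S₄`
(`ncard_pencilsOf`). Averaging over the types yields the total density `1 / q`. -/

theorem exists_smul_of_cross_eq_zero {x y : Fin 3 → k} (hx : x ≠ 0)
    (h : crossProduct x y = 0) : ∃ c : k, c • x = y := by
  obtain ⟨i, hi⟩ := Function.ne_iff.mp hx
  have h0 := congrFun h 0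
  have h1 := congrFun h 1
  have h2 := congrFun h 2
  simp only [cross_apply, cons_val_zero, cons_val_one, cons_val, Pi.zero_apply] at h0 h1 h2 hi
  refine ⟨y i / x i, ?_⟩
  ext j
  rw [Pi.smul_apply, smul_eq_mul, div_mul_eq_mul_div, div_eq_iff hi]
  fin_cases i <;> fin_cases j <;> simp only [Fin.zero_eta, Fin.mk_one, Fin.reduceFinMk] <;> grind

/-- The diagonal bilinear form with coefficients `d`. -/
def diagForm (d x y : Fin 3 → k) : k := ∑ i, d i * x i * y i

theorem diagForm_comm (d x y : Fin 3 → k) : diagForm d x y = diagForm d y x := by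
  simp only [diagForm, Fin.sum_univ_three]; ring

theorem diagForm_one (x y : Fin 3 → k) : diagForm 1 x y = x ⬝ᵥ y := by
  simp [diagForm, dotProduct]

theorem diagForm_smul_left (d x y : Fin 3 → k) (c : k) :
    diagForm d (c • x) y = c * diagForm d x y := by
  simp only [diagForm, Fin.sum_univ_three, Pi.smul_apply, smul_eq_mul]; ring

theorem diagForm_smul_right (d x y : Fin 3 → k) (c : k) :
    diagForm d x (c • y) = c * diagForm d x y := by
  simp only [diagForm, Fin.sum_univ_three, Pi.smul_apply, smul_eq_mul]; ring

/-- A line meeting a diagonal conic in a single point `P` is the polar of `P`. -/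
theorem cross_eq_zero_of_unique (h2 : (2 : k) ≠ 0) {d P ξ : Fin 3 → k}
    (hP : diagForm d P P = 0) (hPξ : P ⬝ᵥ ξ = 0)
    (h : ∀ X : Fin 3 → k, X ≠ 0 → diagForm d X X = 0 → X ⬝ᵥ ξ = 0 → ∃ c : k, c • P = X) :
    crossProduct ξ (d * P) = 0 := by
  by_contra hne
  obtain ⟨i, hi⟩ := Function.ne_iff.mp hne
  set z : Fin 3 → k := Pi.single i 1 with hz
  set Y := crossProduct z ξ with hY
  have hYP : diagForm d Y P ≠ 0 := by
    have : diagForm d Y P = crossProduct ξ (d * P) i := by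
      fin_cases i <;> simp [diagForm, Fin.sum_univ_three, hY, hz, cross_apply] <;> ring
    rw [this]; exact hi
  have hYξ : Y ⬝ᵥ ξ = 0 := by
    rw [hY, dotProduct_comm, dot_cross_self]
  -- `Y` is a point of the line `ξ`, and `X` is the second intersection of the conic with the line
  -- through `P` and `Y`. If `Y` is not conjugate to `P`, then `X` differs from `P`.
  set X := (2 * diagForm d Y P) • Y - diagForm d Y Y • P with hX
  have hXP : diagForm d X P = 2 * diagForm d Y P * diagForm d Y P := by
    have : diagForm d X P = 2 * diagForm d Y P * diagForm d Y P
        - diagForm d Y Y * diagForm d P P := by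
      simp only [diagForm, Fin.sum_univ_three, hX, Pi.sub_apply, Pi.smul_apply, smul_eq_mul]; ring
    rw [this, hP]; ring
  have hXX : diagForm d X X = 0 := by
    have : diagForm d X X = diagForm d Y Y ^ 2 * diagForm d P P := by
      simp only [diagForm, Fin.sum_univ_three, hX, Pi.sub_apply, Pi.smul_apply, smul_eq_mul]; ring
    rw [this, hP]; ring
  have hXP0 : diagForm d X P ≠ 0 := by
    rw [hXP]; exact mul_ne_zero (mul_ne_zero h2 hYP) hYP
  have hX0 : X ≠ 0 := by
    intro h0
    exact hXP0 (by rw [h0]; simp [diagForm])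
  obtain ⟨c, hc⟩ := h X hX0 hXX (by simp [hX, sub_dotProduct, smul_dotProduct, hYξ, hPξ])
  apply hXP0
  rw [← hc, diagForm_smul_left, hP, mul_zero]

/-- For isotropic `P` and `R` the chord `P × R` is tangent to the conic with dual `β` exactly when
`R` lies on the line `(2 β - tr β) P`, provided `P` and `R` are not orthogonal. -/
theorem diagForm_cross {β P R : Fin 3 → k} (hP : P ⬝ᵥ P = 0) (hR : R ⬝ᵥ R = 0) :
    diagForm β (crossProduct P R) (crossProduct P R) =
      (P ⬝ᵥ R) * diagForm (fun i => 2 * β i - ∑ j, β j) P R := by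
  simp only [vec3_dotProduct] at *
  simp only [diagForm, Fin.sum_univ_three, cross_apply, cons_val_zero, cons_val_one, cons_val]
  linear_combination (-(β 0 * R 0 * R 0 + β 1 * R 1 * R 1 + β 2 * R 2 * R 2)
    + (β 0 + β 1 + β 2) * (R 0 * R 0 + R 1 * R 1 + R 2 * R 2)) * hP
    - (β 0 * P 0 * P 0 + β 1 * P 1 * P 1 + β 2 * P 2 * P 2) * hR

/-- The nondegenerate conic `x ⬝ᵥ x = 0` contains no line: otherwise `P` and `R` would both be
multiples of `P × R`, which would force `P × R = 0`. -/
theorem exists_smul_of_isotropic {P R : Fin 3 → k} (hP0 : P ≠ 0) (hP : P ⬝ᵥ P = 0)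
    (hR : R ⬝ᵥ R = 0) (hPR : P ⬝ᵥ R = 0) : ∃ c : k, c • P = R := by
  by_cases hR0 : R = 0
  · exact ⟨0, by simp [hR0]⟩
  by_contra hne
  have hc : crossProduct P R ≠ 0 := fun h => hne (exists_smul_of_cross_eq_zero hP0 h)
  have h1 : crossProduct (crossProduct P R) P = 0 := by
    rw [cross_cross_eq_smul_sub_smul]; simp [hP, hPR, dotProduct_comm R P]
  have h2 : crossProduct (crossProduct P R) R = 0 := by
    rw [cross_cross_eq_smul_sub_smul]; simp [hR, hPR]
  obtain ⟨a, ha⟩ := exists_smul_of_cross_eq_zero hc h1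
  obtain ⟨b, hb⟩ := exists_smul_of_cross_eq_zero hc h2
  have h3 : crossProduct (a • crossProduct P R) (b • crossProduct P R) = 0 := by simp
  rw [ha, hb] at h3
  exact hc h3

theorem cross_ne_zero_of_not_smul {P R : Fin 3 → k} (hP0 : P ≠ 0)
    (h : ¬ ∃ c : k, c • P = R) : crossProduct P R ≠ 0 :=
  fun h' => h (exists_smul_of_cross_eq_zero hP0 h')

/-- A vector orthogonal to two non-proportional vectors is a multiple of their cross product. -/
theorem exists_smul_cross {P R ξ : Fin 3 → k} (hP0 : P ≠ 0) (h : ¬ ∃ c : k, c • P = R)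
    (h1 : P ⬝ᵥ ξ = 0) (h2 : R ⬝ᵥ ξ = 0) : ∃ c : k, c • crossProduct P R = ξ := by
  apply exists_smul_of_cross_eq_zero (cross_ne_zero_of_not_smul hP0 h)
  rw [cross_cross_eq_smul_sub_smul]; simp [h1, h2]

/-- The sides of a Poncelet polygon in normal form: consecutive vertices are conjugate with respect
to `2 β - tr β`. -/
theorem conjugate_of_side (h2 : (2 : k) ≠ 0) {β P R ξ : Fin 3 → k} (hP0 : P ≠ 0)
    (hR0 : R ≠ 0) (hξ0 : ξ ≠ 0) (hβ : diagForm β ξ ξ = 0)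
    (h : ∀ X : Fin 3 → k, X ≠ 0 →
      ((X ⬝ᵥ X = 0 ∧ X ⬝ᵥ ξ = 0) ↔ (∃ c : k, c • P = X) ∨ ∃ c : k, c • R = X)) :
    diagForm (fun i => 2 * β i - ∑ j, β j) P R = 0 := by
  obtain ⟨hP, hPξ⟩ := (h P hP0).mpr (.inl ⟨1, one_smul _ _⟩)
  obtain ⟨hR, hRξ⟩ := (h R hR0).mpr (.inr ⟨1, one_smul _ _⟩)
  by_cases hPR : ∃ c : k, c • P = R
  · obtain ⟨c, rfl⟩ := hPR
    have h0 := cross_eq_zero_of_unique (d := 1) h2 (by rwa [diagForm_one]) hPξ (fun X hX hXX hXξ => by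
      rw [diagForm_one] at hXX
      rcases (h X hX).mp ⟨hXX, hXξ⟩ with h | ⟨b, rfl⟩
      · exact h
      · exact ⟨b * c, by rw [mul_smul]⟩)
    rw [one_mul] at h0
    obtain ⟨b, rfl⟩ := exists_smul_of_cross_eq_zero hξ0 h0
    have : diagForm (fun i => 2 * β i - ∑ j, β j) (b • ξ) (c • b • ξ)
        = c * (b * b * 2 * diagForm β ξ ξ - (∑ j, β j) * (b • ξ ⬝ᵥ b • ξ)) := by
      simp only [diagForm, Fin.sum_univ_three, vec3_dotProduct, Pi.smul_apply, smul_eq_mul]; ring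
    rw [this, hβ, hP]; ring
  · obtain ⟨c, hc⟩ := exists_smul_cross hP0 hPR hPξ hRξ
    have hne : P ⬝ᵥ R ≠ 0 := fun h0 => hPR (exists_smul_of_isotropic hP0 hP hR h0)
    have hc0 : c ≠ 0 := by rintro rfl; exact hξ0 (by rw [← hc, zero_smul])
    have := diagForm_cross (β := β) hP hR
    rw [← hc, diagForm_smul_left, diagForm_smul_right] at hβ
    simp only [mul_eq_zero, hc0, false_or] at hβ
    rw [hβ] at this
    exact (mul_eq_zero.mp this.symm).resolve_left hne

/-- Conversely, two conjugate points of the conic lie on a common tangent line of the other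
conic, which is tangent at `P` if they coincide. -/
theorem exists_side_of_conjugate (h2 : (2 : k) ≠ 0) {β P X : Fin 3 → k} (hP0 : P ≠ 0)
    (hX0 : X ≠ 0)
    (hP : P ⬝ᵥ P = 0) (hX : X ⬝ᵥ X = 0)
    (h : diagForm (fun i => 2 * β i - ∑ j, β j) X P = 0) :
    ∃ l : Fin 3 → k, l ≠ 0 ∧ diagForm β l l = 0 ∧ P ⬝ᵥ l = 0 ∧ X ⬝ᵥ l = 0 ∧
      ((∃ c : k, c • P = X) → l = P) := by
  by_cases hPX : ∃ c : k, c • P = X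
  · obtain ⟨c, rfl⟩ := hPX
    have hc0 : c ≠ 0 := by rintro rfl; exact hX0 (zero_smul _ _)
    refine ⟨P, hP0, ?_, hP, by simp [hP], fun _ => rfl⟩
    have h' : diagForm (fun i => 2 * β i - ∑ j, β j) (c • P) P
        = c * (2 * diagForm β P P - (∑ j, β j) * (P ⬝ᵥ P)) := by
      simp only [diagForm, Fin.sum_univ_three, vec3_dotProduct, Pi.smul_apply, smul_eq_mul]; ring
    rw [h', hP] at h
    simpa [hc0, h2] using h
  · refine ⟨crossProduct P X, cross_ne_zero_of_not_smul hP0 hPX, ?_, dot_self_cross _ _,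
      dot_cross_self _ _, fun h' => absurd h' hPX⟩
    rw [diagForm_cross hP hX, diagForm_comm, h, mul_zero]

/-- Closed quadrilaterals inscribed in `x ⬝ᵥ x = 0` and circumscribed about the conic with dual
equation `∑ β i * ξ i ^ 2 = 0`, given by the vectors of their vertices and sides. -/
structure IsQuadrilateral (β : Fin 3 → k) (P ξ : Fin 4 → Fin 3 → k) : Prop where
  vertex_ne_zero : ∀ i, P i ≠ 0
  side_ne_zero : ∀ i, ξ i ≠ 0
  vertex_iff : ∀ i, ∀ X : Fin 3 → k, X ≠ 0 →
    ((X ⬝ᵥ X = 0 ∧ X ⬝ᵥ ξ i = 0) ↔ (∃ c : k, c • P i = X) ∨ ∃ c : k, c • P (i + 1) = X)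
  side_iff : ∀ i, ∀ l : Fin 3 → k, l ≠ 0 →
    ((diagForm β l l = 0 ∧ P (i + 1) ⬝ᵥ l = 0) ↔
      (∃ c : k, c • ξ i = l) ∨ ∃ c : k, c • ξ (i + 1) = l)

namespace IsQuadrilateral

variable {β : Fin 3 → k} {P ξ : Fin 4 → Fin 3 → k}

theorem rotate (h : IsQuadrilateral β P ξ) :
    IsQuadrilateral β (fun i => P (i + 1)) (fun i => ξ (i + 1)) :=
  ⟨fun _ => h.1 _, fun _ => h.2 _, fun _ => h.3 _, fun _ => h.4 _⟩

theorem isotropic (h : IsQuadrilateral β P ξ) (i : Fin 4) : P i ⬝ᵥ P i = 0 :=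
  ((h.vertex_iff i _ (h.1 i)).mpr (.inl ⟨1, one_smul _ _⟩)).1

theorem vertex_dot_side (h : IsQuadrilateral β P ξ) (i : Fin 4) : P i ⬝ᵥ ξ i = 0 :=
  ((h.vertex_iff i _ (h.1 i)).mpr (.inl ⟨1, one_smul _ _⟩)).2

theorem succ_vertex_dot_side (h : IsQuadrilateral β P ξ) (i : Fin 4) : P (i + 1) ⬝ᵥ ξ i = 0 :=
  ((h.vertex_iff i _ (h.1 _)).mpr (.inr ⟨1, one_smul _ _⟩)).2

theorem tangent (h : IsQuadrilateral β P ξ) (i : Fin 4) : diagForm β (ξ i) (ξ i) = 0 :=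
  ((h.side_iff i _ (h.2 i)).mpr (.inl ⟨1, one_smul _ _⟩)).1

theorem conjugate (h2 : (2 : k) ≠ 0) (h : IsQuadrilateral β P ξ) (i : Fin 4) :
    diagForm (fun i => 2 * β i - ∑ j, β j) (P i) (P (i + 1)) = 0 :=
  conjugate_of_side h2 (h.1 _) (h.1 _) (h.2 i) (h.tangent i) (h.vertex_iff i)

/-- If the two neighbours of a vertex coincide, the opposite chord is tangent there. -/
theorem cross_eq_zero_of_eq (h2 : (2 : k) ≠ 0) (h : IsQuadrilateral β P ξ) (i : Fin 4)
    (h13 : ∃ c : k, c • P i = P (i + 1 + 1)) :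
    crossProduct (fun j => (2 * β j - ∑ j, β j) * P (i + 1) j) (P i) = 0 := by
  -- Write `L` for the weights `2 * β j - tr β`. The points conjugate to `P (i + 1)` form the line
  -- `L P (i + 1)`. It suffices that this line meets the conic only in `P i`, since the tangent
  -- there has coordinates `P i`.
  have key := cross_eq_zero_of_unique (d := 1) h2 (P := P i)
    (ξ := fun j => (2 * β j - ∑ j, β j) * P (i + 1) j)
    (by rw [diagForm_one]; exact h.isotropic i) ?_ ?_
  · rwa [one_mul] at key
  · rw [← h.conjugate h2 i]
    simp only [diagForm, Fin.sum_univ_three, vec3_dotProduct]; ring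
  intro X hX0 hXX hXP
  rw [diagForm_one] at hXX
  have hconj : diagForm (fun i => 2 * β i - ∑ j, β j) X (P (i + 1)) = 0 := by
    rw [← hXP]; simp only [diagForm, Fin.sum_univ_three, vec3_dotProduct]; ring
  obtain ⟨l, hl0, hl, hPl, hXl, hl'⟩ :=
    exists_side_of_conjugate h2 (h.1 (i + 1)) hX0 (h.isotropic _) hXX hconj
  obtain ⟨c, hc⟩ := h13
  have hc0 : c ≠ 0 := by rintro rfl; exact h.1 (i + 1 + 1) (by rw [← hc, zero_smul])
  -- The tangent `l` to the other conic through `P (i + 1)` is one of the two consecutive sides.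
  -- Both have their vertices among `P i` and `P (i + 1)`, because `P (i + 2)` is `P i`.
  have hl_mem : ∀ Y : Fin 3 → k, Y ≠ 0 → Y ⬝ᵥ Y = 0 → Y ⬝ᵥ l = 0 →
      (∃ c : k, c • P i = Y) ∨ ∃ c : k, c • P (i + 1) = Y := by
    intro Y hY0 hYY hYl
    rcases (h.side_iff i l hl0).mp ⟨hl, hPl⟩ with ⟨b, rfl⟩ | ⟨b, rfl⟩
    · have hb0 : b ≠ 0 := by rintro rfl; exact hl0 (zero_smul _ _)
      exact (h.vertex_iff i Y hY0).mp ⟨hYY, by simpa [hb0] using hYl⟩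
    · have hb0 : b ≠ 0 := by rintro rfl; exact hl0 (zero_smul _ _)
      rcases (h.vertex_iff (i + 1) Y hY0).mp ⟨hYY, by simpa [hb0] using hYl⟩ with h' | ⟨d, hd⟩
      · exact .inr h'
      · exact .inl ⟨d * c, by rw [mul_smul, hc, hd]⟩
  have hl_iff : ∀ Y : Fin 3 → k, Y = P i → Y ⬝ᵥ l = 0 := by
    rintro Y rfl
    rcases (h.side_iff i l hl0).mp ⟨hl, hPl⟩ with ⟨b, rfl⟩ | ⟨b, rfl⟩
    · simp [h.vertex_dot_side i]
    · have := h.succ_vertex_dot_side (i + 1)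
      rw [← hc] at this
      simpa [hc0] using Or.inr this
  rcases hl_mem X hX0 hXX hXl with h' | hPX
  · exact h'
  -- If `X` is `P (i + 1)`, then `l` is the tangent at that point. As `P i` lies on it, the two
  -- vertices coincide.
  · have hlP := hl' hPX
    obtain ⟨d, hd⟩ := hPX
    have : ∃ c : k, c • P i = P (i + 1) :=
      exists_smul_of_isotropic (h.1 i) (h.isotropic i) (h.isotropic _)
        (by rw [← hlP]; exact hl_iff _ rfl)
    obtain ⟨b, hb⟩ := this
    exact ⟨d * b, by rw [mul_smul, hb, hd]⟩

/-- A diagonal map that sends two independent vectors into one line has a nontrivial kernel, so one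
of its entries vanishes. -/
theorem exists_zero_of_smul {l x y z : Fin 3 → k} (hx : x ≠ 0)
    (hxy : ¬ ∃ c : k, c • x = y)
    (h1 : ∃ c : k, c • z = fun j => l j * x j) (h2 : ∃ c : k, c • z = fun j => l j * y j) :
    ∃ i, l i = 0 := by
  by_contra! hl
  obtain ⟨a, ha⟩ := h1
  obtain ⟨b, hb⟩ := h2
  have ha' := fun j => congrFun ha j
  have hb' := fun j => congrFun hb j
  simp only [Pi.smul_apply, smul_eq_mul] at ha' hb'
  by_cases ha0 : a = 0
  · apply hx
    ext j
    have := ha' j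
    rw [ha0, zero_mul] at this
    exact (mul_eq_zero.mp this.symm).resolve_left (hl j)
  · apply hxy
    refine ⟨b / a, ?_⟩
    ext j
    rw [Pi.smul_apply, smul_eq_mul]
    apply mul_left_cancel₀ (hl j)
    rw [← hb' j, mul_left_comm, ← ha' j]
    field_simp

theorem dot_weighted (l x y : Fin 3 → k) : x ⬝ᵥ (fun j => l j * y j) = diagForm l x y := by
  simp only [diagForm, Fin.sum_univ_three, vec3_dotProduct]; ring

/-- The core of the necessity of Cayley's criterion. If `P 1` and `P 3` differ, their polars for the
form with weights `2 * β j - tr β` are both the line `P 0 × P 2`. If they coincide, the polars of `P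
0` and `P 2` are both the tangent line at `P 1`. Either way two distinct points have the same polar,
so the form is singular. -/
theorem exists_zero_of_not_smul (h2 : (2 : k) ≠ 0) (h : IsQuadrilateral β P ξ)
    (h02 : ¬ ∃ c : k, c • P 0 = P 2) : ∃ i, 2 * β i - ∑ j, β j = 0 := by
  by_cases h13 : ∃ c : k, c • P 1 = P 3
  · have e1 := h.cross_eq_zero_of_eq h2 1 h13
    have h31 : ∃ c : k, c • P 3 = P 1 := by
      obtain ⟨c, hc⟩ := h13
      have hc0 : c ≠ 0 := by rintro rfl; exact h.1 3 (by rw [← hc, zero_smul])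
      exact ⟨c⁻¹, by rw [← hc, inv_smul_smul₀ hc0]⟩
    have e3 := h.cross_eq_zero_of_eq h2 3 h31
    rw [← cross_anticomm, neg_eq_zero] at e1 e3
    obtain ⟨c, hc⟩ := h13
    obtain ⟨d, hd⟩ := exists_smul_of_cross_eq_zero (h.1 3) e3
    exact exists_zero_of_smul (l := fun i => 2 * β i - ∑ j, β j) (h.1 0) h02
      ⟨d * c, by rw [mul_smul, hc, hd]; rfl⟩ (exists_smul_of_cross_eq_zero (h.1 1) e1)
  · refine exists_zero_of_smul (l := fun i => 2 * β i - ∑ j, β j) (h.1 1) h13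
      (exists_smul_cross (h.1 0) h02 ?_ ?_) (exists_smul_cross (h.1 0) h02 ?_ ?_)
    · rw [dot_weighted]; exact h.conjugate h2 0
    · rw [dot_weighted, diagForm_comm]; exact h.conjugate h2 1
    · rw [dot_weighted, diagForm_comm]; exact h.conjugate h2 3
    · rw [dot_weighted]; exact h.conjugate h2 2

theorem side_smul_of_smul (h2 : (2 : k) ≠ 0) (h : IsQuadrilateral β P ξ) (i : Fin 4)
    (hi : ∃ c : k, c • P i = P (i + 1)) : ∃ c : k, c • P i = ξ i := by
  obtain ⟨c, hc⟩ := hi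
  have key := cross_eq_zero_of_unique (d := 1) h2 (P := P i) (ξ := ξ i)
    (by rw [diagForm_one]; exact h.isotropic i) (h.vertex_dot_side i) (fun X hX hXX hXξ => by
      rw [diagForm_one] at hXX
      rcases (h.vertex_iff i X hX).mp ⟨hXX, hXξ⟩ with h' | ⟨d, hd⟩
      · exact h'
      · exact ⟨d * c, by rw [mul_smul, hc, hd]⟩)
  rw [one_mul, ← cross_anticomm, neg_eq_zero] at key
  exact exists_smul_of_cross_eq_zero (h.1 i) key

theorem exists_smul_inv {x y : Fin 3 → k} (hy : y ≠ 0) (h : ∃ c : k, c • x = y) :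
    ∃ c : k, c • y = x := by
  obtain ⟨c, rfl⟩ := h
  have hc0 : c ≠ 0 := by rintro rfl; exact hy (zero_smul _ _)
  exact ⟨c⁻¹, inv_smul_smul₀ hc0 _⟩

theorem exists_smul_trans {x y z : Fin 3 → k} (h : ∃ c : k, c • x = y)
    (h' : ∃ c : k, c • y = z) : ∃ c : k, c • x = z := by
  obtain ⟨c, rfl⟩ := h
  obtain ⟨d, rfl⟩ := h'
  exact ⟨d * c, mul_smul _ _ _⟩

/-- Both sides are the chord from `P i` to `P (i + 1)`, or, if these points coincide, the tangent
line there. -/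
theorem side_smul_side (h2 : (2 : k) ≠ 0) (h : IsQuadrilateral β P ξ) (i : Fin 4)
    (hi : ∃ c : k, c • P i = P (i + 1 + 1)) : ∃ c : k, c • ξ i = ξ (i + 1) := by
  by_cases hP : ∃ c : k, c • P i = P (i + 1)
  · have a1 := h.side_smul_of_smul h2 i hP
    have a2 := h.side_smul_of_smul h2 (i + 1)
      (exists_smul_trans (exists_smul_inv (h.1 _) hP) hi)
    exact exists_smul_trans (exists_smul_inv (h.2 _) a1) (exists_smul_trans hP a2)
  · obtain ⟨c, hc⟩ := hi
    have hc0 : c ≠ 0 := by rintro rfl; exact h.1 (i + 1 + 1) (by rw [← hc, zero_smul])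
    have a1 := exists_smul_cross (h.1 i) hP (h.vertex_dot_side i) (h.succ_vertex_dot_side i)
    have a2 := exists_smul_cross (h.1 i) hP (ξ := ξ (i + 1)) (by
      have := h.succ_vertex_dot_side (i + 1)
      rw [← hc] at this
      simpa [hc0] using this) (h.vertex_dot_side (i + 1))
    exact exists_smul_trans (exists_smul_inv (h.2 _) a1) a2

/-- If the polygon turns back at the vertex `i + 1`, that vertex lies on both conics. -/
theorem cross_weighted_side_eq_zero (h2 : (2 : k) ≠ 0) (h : IsQuadrilateral β P ξ) (i : Fin 4)
    (hi : ∃ c : k, c • P i = P (i + 1 + 1)) : crossProduct (P (i + 1)) (β * ξ i) = 0 := by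
  refine cross_eq_zero_of_unique h2 (h.tangent i)
    (by rw [dotProduct_comm]; exact h.succ_vertex_dot_side i) (fun X hX hXX hXP => ?_)
  rcases (h.side_iff i X hX).mp ⟨hXX, by rwa [dotProduct_comm]⟩ with h' | h'
  · exact h'
  · exact exists_smul_trans (h.side_smul_side h2 i hi) h'

/-- What remains is the polygon with both pairs of opposite vertices equal. It would turn back at
two consecutive vertices, and this cannot happen when the `β i` are distinct and nonzero. -/
theorem exists_weight_eq (h2 : (2 : k) ≠ 0) (hβ : ∀ i, β i ≠ 0) (hinj : Function.Injective β)
    (h : IsQuadrilateral β P ξ) : ∃ i, 2 * β i - ∑ j, β j = 0 := by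
  by_cases h02 : ∃ c : k, c • P 0 = P 2
  swap
  · exact h.exists_zero_of_not_smul h2 h02
  by_cases h13 : ∃ c : k, c • P 1 = P 3
  swap
  · exact h.rotate.exists_zero_of_not_smul h2 h13
  exfalso
  -- The path turns back at vertices `1` and `0`, so both are the contact point `β * ξ 0` of a
  -- common side. They therefore coincide, and that side is also tangent to the first conic there.
  have e0 := h.cross_weighted_side_eq_zero h2 0 h02
  have e3 := h.cross_weighted_side_eq_zero h2 3 (exists_smul_inv (h.1 3) h13)
  obtain ⟨c, hc⟩ := h.side_smul_side h2 3 (exists_smul_inv (h.1 3) h13)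
  obtain ⟨a, ha⟩ := exists_smul_of_cross_eq_zero (h.1 _) e0
  obtain ⟨b, hb⟩ := exists_smul_of_cross_eq_zero (h.1 _) e3
  simp only [Fin.reduceAdd, zero_add] at ha hb hc
  have hβξ : β * ξ 0 ≠ 0 := by
    obtain ⟨j, hj⟩ := Function.ne_iff.mp (h.2 0)
    exact Function.ne_iff.mpr ⟨j, mul_ne_zero (hβ j) hj⟩
  have hb' : (c * b) • P 0 = β * ξ 0 := by
    rw [mul_smul, hb, ← hc, mul_smul_comm]
  have h01 : ∃ c : k, c • P 0 = P 1 :=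
    exists_smul_trans ⟨_, hb'⟩ (exists_smul_inv hβξ ⟨_, ha⟩)
  obtain ⟨d, hd⟩ := h.side_smul_of_smul h2 0 h01
  have hd0 : d ≠ 0 := by rintro rfl; exact h.2 0 (by rw [← hd, zero_smul])
  have hP := h.isotropic 0
  rw [← hd] at hb'
  have hj : ∀ j, c * b * P 0 j = d * (β j * P 0 j) := fun j => by
    have := congrFun hb' j
    simp only [Pi.smul_apply, smul_eq_mul, Pi.mul_apply] at this
    rw [this]; ring
  -- Now `P 0` is an eigenvector of the diagonal matrix with distinct entries `β`, so at most one
  -- coordinate is nonzero. Isotropy then makes it zero.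
  have hij : ∀ i j, i ≠ j → P 0 i * P 0 j = 0 := fun i j hne => by
    have h1 : d * (β i - β j) * (P 0 i * P 0 j) = 0 := by
      linear_combination (P 0 i) * hj j - (P 0 j) * hj i
    exact (mul_eq_zero.mp h1).resolve_left
      (mul_ne_zero hd0 (sub_ne_zero.mpr fun e => hne (hinj e)))
  have h01' := hij 0 1 (by decide)
  have h02' := hij 0 2 (by decide)
  have h12' := hij 1 2 (by decide)
  rw [vec3_dotProduct] at hP
  apply h.1 0
  have h0 : P 0 0 = 0 := by
    apply pow_eq_zero_iff (n := 3) (by norm_num) |>.mp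
    linear_combination P 0 0 * hP - P 0 1 * h01' - P 0 2 * h02'
  have h1 : P 0 1 = 0 := by
    apply pow_eq_zero_iff (n := 3) (by norm_num) |>.mp
    linear_combination P 0 1 * hP - P 0 0 * h01' - P 0 2 * h12'
  have h2 : P 0 2 = 0 := by
    apply pow_eq_zero_iff (n := 3) (by norm_num) |>.mp
    linear_combination P 0 2 * hP - P 0 0 * h02' - P 0 1 * h12'
  ext j
  fin_cases j
  exacts [h0, h1, h2]

end IsQuadrilateral

/-- An explicit closed quadrilateral when `β 0 = β 1 + β 2`. -/
theorem isQuadrilateral_of_weight_eq (h2 : (2 : k) ≠ 0) {β : Fin 3 → k} (hβ : ∀ i, β i ≠ 0)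
    (h : β 0 = β 1 + β 2) {ι : k} (hι : ι * ι = -1) :
    IsQuadrilateral β ![![ι, 1, 0], ![ι, 0, 1], ![-ι, 1, 0], ![-ι, 0, 1]]
      ![![1, -ι, -ι], ![1, ι, -ι], ![1, ι, ι], ![1, -ι, ι]] := by
  -- Each side `(1, s, t)` with `s ^ 2 = t ^ 2 = -1` meets `x ⬝ᵥ x = 0` where `X 1 * X 2 = 0`. The
  -- next two facts find the tangents through each kind of vertex by factoring the dual equation in
  -- the same way.
  have key1 : ∀ s t : k, s * s = -1 → t * t = -1 → ∀ X : Fin 3 → k,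
      ((X ⬝ᵥ X = 0 ∧ X ⬝ᵥ ![1, s, t] = 0) ↔
        (∃ c : k, c • ![-s, 1, 0] = X) ∨ ∃ c : k, c • ![-t, 0, 1] = X) := by
    intro s t hs ht X
    have hs0 : s ≠ 0 := by rintro rfl; simp at hs
    have ht0 : t ≠ 0 := by rintro rfl; simp at ht
    simp only [vec3_dotProduct, cons_val_zero, cons_val_one, cons_val]
    constructor
    · rintro ⟨hXX, hX⟩
      have h0 : (2 * s * t) * (X 1 * X 2) = 0 := by
        linear_combination hXX - (X 0 - s * X 1 - t * X 2) * hX - X 1 ^ 2 * hs - X 2 ^ 2 * ht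
      rcases mul_eq_zero.mp
        ((mul_eq_zero.mp h0).resolve_left (mul_ne_zero (mul_ne_zero h2 hs0) ht0)) with h1 | h1
      · refine .inr ⟨X 2, ?_⟩
        ext j
        fin_cases j <;> simp [h1]
        linear_combination -hX + s * h1
      · refine .inl ⟨X 1, ?_⟩
        ext j
        fin_cases j <;> simp [h1]
        linear_combination -hX + t * h1
    · rintro (⟨c, rfl⟩ | ⟨c, rfl⟩)
      · simp
        linear_combination c ^ 2 * hs
      · simp
        linear_combination c ^ 2 * ht
  have key2 : ∀ s t : k, s * s = -1 → t * t = -1 → ∀ X : Fin 3 → k,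
      ((diagForm β X X = 0 ∧ ![-t, 0, 1] ⬝ᵥ X = 0) ↔
        (∃ c : k, c • ![1, s, t] = X) ∨ ∃ c : k, c • ![1, -s, t] = X) := by
    intro s t hs ht X
    simp only [diagForm, Fin.sum_univ_three, vec3_dotProduct, cons_val_zero, cons_val_one, cons_val]
    constructor
    · rintro ⟨hXX, hX⟩
      have h0 : β 1 * ((X 1 - s * X 0) * (X 1 + s * X 0)) = 0 := by
        linear_combination hXX - β 2 * (X 2 + t * X 0) * hX - X 0 ^ 2 * h
          - β 1 * X 0 ^ 2 * hs - β 2 * X 0 ^ 2 * ht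
      rcases mul_eq_zero.mp ((mul_eq_zero.mp h0).resolve_left (hβ 1)) with h1 | h1
      · refine .inl ⟨X 0, ?_⟩
        ext j
        fin_cases j <;> simp
        · linear_combination -h1
        · linear_combination -hX
      · refine .inr ⟨X 0, ?_⟩
        ext j
        fin_cases j <;> simp
        · linear_combination -h1
        · linear_combination -hX
    · rintro (⟨c, rfl⟩ | ⟨c, rfl⟩)
      · simp
        constructor
        · linear_combination c ^ 2 * h + c ^ 2 * β 1 * hs + c ^ 2 * β 2 * ht
        · ring
      · simp
        constructor
        · linear_combination c ^ 2 * h + c ^ 2 * β 1 * hs + c ^ 2 * β 2 * ht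
        · ring
  have key3 : ∀ s t : k, s * s = -1 → t * t = -1 → ∀ X : Fin 3 → k,
      ((diagForm β X X = 0 ∧ ![-s, 1, 0] ⬝ᵥ X = 0) ↔
        (∃ c : k, c • ![1, s, t] = X) ∨ ∃ c : k, c • ![1, s, -t] = X) := by
    intro s t hs ht X
    simp only [diagForm, Fin.sum_univ_three, vec3_dotProduct, cons_val_zero, cons_val_one, cons_val]
    constructor
    · rintro ⟨hXX, hX⟩
      have h0 : β 2 * ((X 2 - t * X 0) * (X 2 + t * X 0)) = 0 := by
        linear_combination hXX - β 1 * (X 1 + s * X 0) * hX - X 0 ^ 2 * h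
          - β 1 * X 0 ^ 2 * hs - β 2 * X 0 ^ 2 * ht
      rcases mul_eq_zero.mp ((mul_eq_zero.mp h0).resolve_left (hβ 2)) with h1 | h1
      · refine .inl ⟨X 0, ?_⟩
        ext j
        fin_cases j <;> simp
        · linear_combination -hX
        · linear_combination -h1
      · refine .inr ⟨X 0, ?_⟩
        ext j
        fin_cases j <;> simp
        · linear_combination -hX
        · linear_combination -h1
    · rintro (⟨c, rfl⟩ | ⟨c, rfl⟩)
      · simp
        constructor
        · linear_combination c ^ 2 * h + c ^ 2 * β 1 * hs + c ^ 2 * β 2 * ht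
        · ring
      · simp
        constructor
        · linear_combination c ^ 2 * h + c ^ 2 * β 1 * hs + c ^ 2 * β 2 * ht
        · ring
  have hι' : (-ι) * (-ι) = -1 := by rw [neg_mul_neg, hι]
  constructor
  · intro i hi
    fin_cases i
    · simpa using congrFun hi 1
    · simpa using congrFun hi 2
    · simpa using congrFun hi 1
    · simpa using congrFun hi 2
  · intro i hi
    fin_cases i <;> simpa using congrFun hi 0
  · intro i X _
    fin_cases i
    · simpa using key1 (-ι) (-ι) hι' hι' X
    · rw [or_comm]
      simpa using key1 ι (-ι) hι hι' X
    · simpa using key1 ι ι hι hι X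
    · rw [or_comm]
      simpa using key1 (-ι) ι hι' hι X
  · intro i X _
    fin_cases i
    · simpa using key2 (-ι) (-ι) hι' hι' X
    · simpa using key3 ι (-ι) hι hι' X
    · simpa using key2 ι ι hι hι X
    · simpa using key3 (-ι) ι hι' hι X

end NormalForm

/-! ### From projective conics to matrices and Cayley's criterion -/

section Conics

variable {F : Type*} [Field F]

theorem geomMatrix_isSymm (A : Conic F) : A.geomMatrix.IsSymm := by
  have h : (A.rep : Matrix (Fin 3) (Fin 3) F).IsSymm := A.rep.2
  exact h.map _

theorem dot_mulVec_comm {k : Type*} [Field k] {A : Matrix (Fin 3) (Fin 3) k} (hA : A.IsSymm)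
    (x y : Fin 3 → k) : x ⬝ᵥ A *ᵥ y = y ⬝ᵥ A *ᵥ x := by
  rw [dotProduct_mulVec, ← mulVec_transpose, hA.eq, dotProduct_comm]

theorem polar_mk (A : Conic F) (x : Fin 3 → AlgebraicClosure F) (hx : x ≠ 0) :
    ∃ c : AlgebraicClosure F, c ≠ 0 ∧ (Projectivization.mk (AlgebraicClosure F) x hx).rep = c • x ∧
      A.polar (Projectivization.mk (AlgebraicClosure F) x hx) = c • A.geomMatrix *ᵥ x := by
  obtain ⟨c, hc⟩ := Projectivization.exists_smul_eq_mk_rep (AlgebraicClosure F) x hx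
  refine ⟨c, c.ne_zero, hc.symm, ?_⟩
  rw [Conic.polar, ← hc, Units.smul_def, mulVec_smul]

theorem contains_mk (A : Conic F) (x : Fin 3 → AlgebraicClosure F) (hx : x ≠ 0) :
    A.Contains (Projectivization.mk (AlgebraicClosure F) x hx) ↔ x ⬝ᵥ A.geomMatrix *ᵥ x = 0 := by
  obtain ⟨c, hc, h1, h2⟩ := polar_mk A x hx
  rw [Conic.Contains, h1, h2]
  simp [hc]

/-- Singular points are the kernel vectors of the matrix; such a vector lies on the conic
automatically. -/
theorem isSmooth_iff (A : Conic F) : A.IsSmooth ↔ A.geomMatrix.det ≠ 0 := by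
  rw [Ne, ← exists_mulVec_eq_zero_iff]
  constructor
  · rintro h ⟨x, hx, h0⟩
    obtain ⟨c, hc, h1, h2⟩ := polar_mk A x hx
    exact h (Projectivization.mk (AlgebraicClosure F) x hx) ((contains_mk A x hx).mpr (by simp [h0]))
      (by rw [h2, h0, smul_zero])
  · intro h P _ h0
    exact h ⟨P.rep, P.rep_nonzero, h0⟩

theorem transversal_iff (A B : Conic F) : A.Transversal B ↔
    ∀ x : Fin 3 → AlgebraicClosure F, x ≠ 0 → x ⬝ᵥ A.geomMatrix *ᵥ x = 0 → x ⬝ᵥ B.geomMatrix *ᵥ x = 0 →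
      LinearIndependent (AlgebraicClosure F) ![A.geomMatrix *ᵥ x, B.geomMatrix *ᵥ x] := by
  constructor
  · intro h x hx hA hB
    obtain ⟨c, hc, h1, h2⟩ := polar_mk A x hx
    have h3 : B.polar (Projectivization.mk (AlgebraicClosure F) x hx) = c • B.geomMatrix *ᵥ x := by
      rw [Conic.polar, h1, mulVec_smul]
    have := h _ ((contains_mk A x hx).mpr hA) ((contains_mk B x hx).mpr hB)
    rw [h2, h3] at this
    rw [LinearIndependent.pair_iff] at this ⊢
    intro s t hst
    apply this
    rw [smul_comm s c, smul_comm t c, ← smul_add, hst, smul_zero]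
  · intro h P hA hB
    exact h P.rep P.rep_nonzero hA hB

theorem isTangentLine_mk {B : Conic F} (ξ : Fin 3 → AlgebraicClosure F) (hξ : ξ ≠ 0) :
    B.IsTangentLine (Projectivization.mk (AlgebraicClosure F) ξ hξ) ↔
      ∃ y : Fin 3 → AlgebraicClosure F, y ⬝ᵥ B.geomMatrix *ᵥ y = 0 ∧ B.geomMatrix *ᵥ y = ξ := by
  constructor
  · rintro ⟨Q, hQ, h, hξQ⟩
    rw [Projectivization.mk_eq_mk_iff'] at hξQ
    obtain ⟨c, hc⟩ := hξQ
    rw [Conic.Contains, Conic.polar] at hQ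
    refine ⟨c • Q.rep, ?_, ?_⟩
    · rw [mulVec_smul, dotProduct_smul, smul_dotProduct, hQ]; simp
    · rw [mulVec_smul, ← hc, Conic.polar]
  · rintro ⟨y, hy, rfl⟩
    have hy0 : y ≠ 0 := by rintro rfl; exact hξ (mulVec_zero _)
    obtain ⟨c, hc, h1, h2⟩ := polar_mk B y hy0
    refine ⟨Projectivization.mk (AlgebraicClosure F) y hy0, (contains_mk B y hy0).mpr hy, ?_, ?_⟩
    · rw [h2]; exact smul_ne_zero hc hξ
    · rw [Projectivization.mk_eq_mk_iff']
      exact ⟨c⁻¹, by rw [h2, inv_smul_smul₀ hc]⟩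

section Transfer

variable {k : Type*} [Field k] {N N' : Matrix (Fin 3) (Fin 3) k}

theorem mulVec_ne_zero (h' : N' * N = 1) {x : Fin 3 → k} (hx : x ≠ 0) : N *ᵥ x ≠ 0 := by
  intro h
  apply hx
  rw [← one_mulVec x, ← h', ← mulVec_mulVec, h, mulVec_zero]

theorem mulVec_smul_iff (h' : N' * N = 1) {x y : Fin 3 → k} :
    (∃ c : k, c • N *ᵥ x = N *ᵥ y) ↔ ∃ c : k, c • x = y := by
  constructor
  · rintro ⟨c, hc⟩
    refine ⟨c, ?_⟩
    rw [← one_mulVec x, ← one_mulVec y, ← h', ← mulVec_mulVec, ← mulVec_mulVec, ← hc, mulVec_smul]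
  · rintro ⟨c, rfl⟩
    exact ⟨c, by rw [mulVec_smul]⟩

theorem dot_mulVec_mulVec (C : Matrix (Fin 3) (Fin 3) k) (x y : Fin 3 → k) :
    (N *ᵥ x) ⬝ᵥ C *ᵥ (N *ᵥ y) = x ⬝ᵥ (Nᵀ * C * N) *ᵥ y := by
  rw [← mulVec_mulVec, ← mulVec_mulVec, dotProduct_mulVec x, vecMul_transpose]

theorem dot_transpose_inv (h' : N' * N = 1) (x y : Fin 3 → k) :
    (N *ᵥ x) ⬝ᵥ (N'ᵀ *ᵥ y) = x ⬝ᵥ y := by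
  rw [dotProduct_mulVec, vecMul_transpose, mulVec_mulVec, h', one_mulVec]

theorem mulVec_diagonal_dot (b x y : Fin 3 → k) : x ⬝ᵥ diagonal b *ᵥ y = diagForm b x y := by
  simp only [diagForm, mulVec_diagonal, dotProduct]
  exact Finset.sum_congr rfl fun i _ => by ring

end Transfer

section TetragonNormalForm

variable {A B : Conic F} {N N' : Matrix (Fin 3) (Fin 3) (AlgebraicClosure F)}
  {b : Fin 3 → AlgebraicClosure F}

theorem mk_mulVec_eq_iff (h' : N' * N = 1) {x y : Fin 3 → AlgebraicClosure F}
    (hx : N *ᵥ x ≠ 0) (hy : N *ᵥ y ≠ 0) :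
    Projectivization.mk (AlgebraicClosure F) _ hx = Projectivization.mk (AlgebraicClosure F) _ hy ↔
      ∃ c : AlgebraicClosure F, c • y = x := by
  rw [Projectivization.mk_eq_mk_iff', mulVec_smul_iff h']

theorem contains_mulVec_iff (hA : Nᵀ * A.geomMatrix * N = 1) {x : Fin 3 → AlgebraicClosure F}
    (hx : N *ᵥ x ≠ 0) :
    A.Contains (Projectivization.mk (AlgebraicClosure F) _ hx) ↔ x ⬝ᵥ x = 0 := by
  rw [contains_mk, dot_mulVec_mulVec, hA, one_mulVec]

/-- The dual of the diagonal conic `b` is the diagonal conic `b⁻¹`, and line coordinates transform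
by the inverse transpose of the matrix acting on points. -/
theorem isTangentLine_mulVec_iff (h : N * N' = 1) (h' : N' * N = 1)
    (hB : Nᵀ * B.geomMatrix * N = diagonal b) (hb : ∀ i, b i ≠ 0)
    {ξ : Fin 3 → AlgebraicClosure F} (hξ : N'ᵀ *ᵥ ξ ≠ 0) :
    B.IsTangentLine (Projectivization.mk (AlgebraicClosure F) _ hξ) ↔
      diagForm (fun i => (b i)⁻¹) ξ ξ = 0 := by
  have hT : N'ᵀ * Nᵀ = 1 := by rw [← transpose_mul, h, transpose_one]
  have hT' : Nᵀ * N'ᵀ = 1 := by rw [← transpose_mul, h', transpose_one]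
  rw [isTangentLine_mk]
  constructor
  · rintro ⟨y, hy, hyξ⟩
    obtain ⟨z, rfl⟩ : ∃ z, N *ᵥ z = y := ⟨N' *ᵥ y, by rw [mulVec_mulVec, h, one_mulVec]⟩
    rw [dot_mulVec_mulVec, hB, mulVec_diagonal_dot] at hy
    have : ξ = diagonal b *ᵥ z := by
      rw [← hB, ← mulVec_mulVec, ← mulVec_mulVec, hyξ, mulVec_mulVec, hT', one_mulVec]
    rw [this, ← hy]
    simp only [diagForm, mulVec_diagonal]
    refine Finset.sum_congr rfl fun i _ => ?_
    have := hb i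
    field_simp
  · intro hβ
    refine ⟨N *ᵥ (fun i => (b i)⁻¹ * ξ i), ?_, ?_⟩
    · rw [dot_mulVec_mulVec, hB, mulVec_diagonal_dot, ← hβ]
      simp only [diagForm]
      refine Finset.sum_congr rfl fun i _ => ?_
      have := hb i
      field_simp
    · have : diagonal b *ᵥ (fun i => (b i)⁻¹ * ξ i) = ξ := by
        ext i
        rw [mulVec_diagonal, mul_inv_cancel_left₀ (hb i)]
      rw [← hB, ← mulVec_mulVec, ← mulVec_mulVec] at this
      conv_rhs => rw [← this, mulVec_mulVec, hT, one_mulVec]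

theorem isStep_iff (h : N * N' = 1) (h' : N' * N = 1) (hA : Nᵀ * A.geomMatrix * N = 1)
    (hB : Nᵀ * B.geomMatrix * N = diagonal b) (hb : ∀ i, b i ≠ 0)
    {P R ξ η : Fin 3 → AlgebraicClosure F} (hP : N *ᵥ P ≠ 0) (hR : N *ᵥ R ≠ 0)
    (hξ : N'ᵀ *ᵥ ξ ≠ 0) (hη : N'ᵀ *ᵥ η ≠ 0) :
    IsStep A B (Projectivization.mk (AlgebraicClosure F) _ hP,
        Projectivization.mk (AlgebraicClosure F) _ hξ)
      (Projectivization.mk (AlgebraicClosure F) _ hR,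
        Projectivization.mk (AlgebraicClosure F) _ hη) ↔
    (∀ X : Fin 3 → AlgebraicClosure F, X ≠ 0 → ((X ⬝ᵥ X = 0 ∧ X ⬝ᵥ ξ = 0) ↔
      (∃ c : AlgebraicClosure F, c • P = X) ∨ ∃ c : AlgebraicClosure F, c • R = X)) ∧
    (∀ l : Fin 3 → AlgebraicClosure F, l ≠ 0 →
      ((diagForm (fun i => (b i)⁻¹) l l = 0 ∧ R ⬝ᵥ l = 0) ↔
      (∃ c : AlgebraicClosure F, c • ξ = l) ∨ ∃ c : AlgebraicClosure F, c • η = l)) := by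
  have hT : N'ᵀ * Nᵀ = 1 := by rw [← transpose_mul, h, transpose_one]
  have hT' : Nᵀ * N'ᵀ = 1 := by rw [← transpose_mul, h', transpose_one]
  rw [IsStep]
  refine and_congr ⟨fun H X hX => ?_, fun H X => ?_⟩ ⟨fun H X hX => ?_, fun H X => ?_⟩
  · have := H (Projectivization.mk (AlgebraicClosure F) _ (mulVec_ne_zero h' hX))
    rwa [contains_mulVec_iff hA, Projectivization.orthogonal_mk, dot_transpose_inv h',
      mk_mulVec_eq_iff h', mk_mulVec_eq_iff h'] at this
  · obtain ⟨x, hx, rfl⟩ : ∃ x, ∃ hx : N *ᵥ x ≠ 0,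
        Projectivization.mk (AlgebraicClosure F) _ hx = X := by
      refine ⟨N' *ᵥ X.rep, ?_, ?_⟩
      · rw [mulVec_mulVec, h, one_mulVec]; exact X.rep_nonzero
      · simp only [mulVec_mulVec, h, one_mulVec, Projectivization.mk_rep]
    rw [contains_mulVec_iff hA, Projectivization.orthogonal_mk, dot_transpose_inv h',
      mk_mulVec_eq_iff h', mk_mulVec_eq_iff h']
    exact H x (by rintro rfl; exact hx (mulVec_zero _))
  · have := H (Projectivization.mk (AlgebraicClosure F) _ (mulVec_ne_zero hT' hX))
    rwa [isTangentLine_mulVec_iff h h' hB hb, Projectivization.orthogonal_mk, dot_transpose_inv h',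
      mk_mulVec_eq_iff hT', mk_mulVec_eq_iff hT'] at this
  · obtain ⟨x, hx, rfl⟩ : ∃ x, ∃ hx : N'ᵀ *ᵥ x ≠ 0,
        Projectivization.mk (AlgebraicClosure F) _ hx = X := by
      refine ⟨Nᵀ *ᵥ X.rep, ?_, ?_⟩
      · rw [mulVec_mulVec, hT, one_mulVec]; exact X.rep_nonzero
      · simp only [mulVec_mulVec, hT, one_mulVec, Projectivization.mk_rep]
    rw [isTangentLine_mulVec_iff h h' hB hb, Projectivization.orthogonal_mk, dot_transpose_inv h',
      mk_mulVec_eq_iff hT', mk_mulVec_eq_iff hT']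
    exact H x (by rintro rfl; exact hx (mulVec_zero _))

/-- A closed chain of four steps is indexed by `Fin 4`, where `e 4 = e 0` closes the cycle. Choosing
representative vectors in the coordinates of `N` turns it into a quadrilateral in normal form. -/
theorem tetragon_iff_isQuadrilateral (h : N * N' = 1) (h' : N' * N = 1)
    (hA : Nᵀ * A.geomMatrix * N = 1)
    (hB : Nᵀ * B.geomMatrix * N = diagonal b) (hb : ∀ i, b i ≠ 0) :
    NGonCondition 4 A B ↔ ∃ P ξ, IsQuadrilateral (fun i => (b i)⁻¹) P ξ := by
  have hT : N'ᵀ * Nᵀ = 1 := by rw [← transpose_mul, h, transpose_one]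
  have hT' : Nᵀ * N'ᵀ = 1 := by rw [← transpose_mul, h', transpose_one]
  constructor
  · rintro ⟨e, -, he, h40⟩
    have hPe : ∀ i : Fin 4, ∃ x, ∃ hx : N *ᵥ x ≠ 0,
        Projectivization.mk (AlgebraicClosure F) _ hx = (e i).1 := by
      refine fun i => ⟨N' *ᵥ (e i).1.rep, ?_, ?_⟩
      · rw [mulVec_mulVec, h, one_mulVec]; exact (e i).1.rep_nonzero
      · simp only [mulVec_mulVec, h, one_mulVec, Projectivization.mk_rep]
    have hξe : ∀ i : Fin 4, ∃ x, ∃ hx : N'ᵀ *ᵥ x ≠ 0,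
        Projectivization.mk (AlgebraicClosure F) _ hx = (e i).2 := by
      refine fun i => ⟨Nᵀ *ᵥ (e i).2.rep, ?_, ?_⟩
      · rw [mulVec_mulVec, hT, one_mulVec]; exact (e i).2.rep_nonzero
      · simp only [mulVec_mulVec, hT, one_mulVec, Projectivization.mk_rep]
    choose P hP hPe using hPe
    choose ξ hξ hξe using hξe
    have hstep : ∀ i : Fin 4, IsStep A B (e i) (e (i + 1 : Fin 4)) := by
      intro i
      have := he i i.2
      fin_cases i
      · exact this
      · exact this
      · exact this
      · simp only [Fin.reduceFinMk, Nat.reduceAdd, h40] at this ⊢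
        exact this
    have hstep' : ∀ i : Fin 4, _ := fun i => by
      have := hstep i
      rw [← Prod.mk.eta (p := e i), ← Prod.mk.eta (p := e (i + 1 : Fin 4)), ← hPe, ← hPe, ← hξe,
        ← hξe, isStep_iff h h' hA hB hb] at this
      exact this
    exact ⟨P, ξ, fun i h0 => hP i (by rw [h0, mulVec_zero]),
      fun i h0 => hξ i (by rw [h0, mulVec_zero]), fun i => (hstep' i).1, fun i => (hstep' i).2⟩
  · rintro ⟨P, ξ, H⟩
    refine ⟨fun i : ℕ => (Projectivization.mk (AlgebraicClosure F) _ (mulVec_ne_zero h' (H.1 (Fin.ofNat 4 i))),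
      Projectivization.mk (AlgebraicClosure F) _ (mulVec_ne_zero hT' (H.2 (Fin.ofNat 4 i)))), ?_, ?_, ?_⟩
    · refine ⟨?_, ?_, ?_⟩
      · rw [contains_mulVec_iff hA]; exact H.isotropic _
      · rw [isTangentLine_mulVec_iff h h' hB hb]; exact H.tangent _
      · rw [Projectivization.orthogonal_mk, dot_transpose_inv h']; exact H.vertex_dot_side _
    · intro i _
      have hi : Fin.ofNat 4 (i + 1) = Fin.ofNat 4 i + 1 := by
        ext; simp [Fin.ofNat, Fin.val_add]
      simp only [hi]
      rw [isStep_iff h h' hA hB hb]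
      exact ⟨H.3 _, H.4 _⟩
    · rfl

/-- Cayley's criterion for quadrilaterals, for two conics that are simultaneously diagonal. -/
theorem tetragon_iff (h2 : (2 : AlgebraicClosure F) ≠ 0) {a : Fin 3 → AlgebraicClosure F}
    (hN : N.det ≠ 0)
    (hA : Nᵀ * A.geomMatrix * N = diagonal a) (ha : ∀ i, a i ≠ 0)
    (hB : Nᵀ * B.geomMatrix * N = diagonal b) (hb : ∀ i, b i ≠ 0)
    (hab : Function.Injective fun i => a i / b i) :
    NGonCondition 4 A B ↔ ∃ i, 2 * (a i / b i) = ∑ j, a j / b j := by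
  -- Scaling the coordinates by square roots of `(a i)⁻¹` turns the first conic into `x ⬝ᵥ x = 0`,
  -- and the dual coefficients of the second into `a i / b i`.
  have hs : ∀ i, ∃ s : AlgebraicClosure F, s ^ 2 = (a i)⁻¹ := fun i =>
    IsAlgClosed.exists_pow_nat_eq _ two_pos
  choose s hs using hs
  have hs0 : ∀ i, s i ≠ 0 := fun i h0 => by
    have := hs i
    rw [h0, zero_pow two_ne_zero] at this
    exact inv_ne_zero (ha i) this.symm
  -- The coordinates may also be permuted, so that the distinguished index becomes `0`, as the
  -- explicit quadrilateral requires.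
  have key : ∀ π : Equiv.Perm (Fin 3), NGonCondition 4 A B ↔
      ∃ P ξ, IsQuadrilateral (fun i => a (π i) / b (π i)) P ξ := by
    intro π
    set N₁ := (N * diagonal s).submatrix id π with hN₁
    have hdet : N₁.det ≠ 0 := by
      rw [hN₁, det_permute', det_mul, det_diagonal]
      refine mul_ne_zero ?_ (mul_ne_zero hN (Finset.prod_ne_zero_iff.mpr fun i _ => hs0 i))
      rcases Int.units_eq_one_or (Equiv.Perm.sign π) with h | h <;> simp [h]
    have hconj : ∀ (C : Matrix (Fin 3) (Fin 3) (AlgebraicClosure F)) (c : Fin 3 → _),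
        Nᵀ * C * N = diagonal c → N₁ᵀ * C * N₁ = diagonal fun i => c (π i) / a (π i) := by
      intro C c hC
      have h1 : N₁ᵀ * C * N₁ = ((N * diagonal s)ᵀ * C * (N * diagonal s)).submatrix π π := by
        ext i j
        simp [hN₁, mul_apply]
      have h3 : (N * diagonal s)ᵀ * C * (N * diagonal s)
          = diagonal s * (Nᵀ * C * N) * diagonal s := by
        rw [transpose_mul, diagonal_transpose]; simp only [Matrix.mul_assoc]
      rw [h1, h3, hC, diagonal_mul_diagonal, diagonal_mul_diagonal, submatrix_diagonal_equiv]
      congr 1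
      ext i
      simp only [Function.comp_apply]
      rw [div_eq_mul_inv, ← hs]; ring
    have hu : IsUnit N₁.det := isUnit_iff_ne_zero.mpr hdet
    rw [tetragon_iff_isQuadrilateral (mul_nonsing_inv _ hu) (nonsing_inv_mul _ hu)
      ?_ (hconj _ _ hB) (fun i => div_ne_zero (hb _) (ha _))]
    · simp only [inv_div]
    · rw [hconj _ _ hA, ← diagonal_one]
      congr 1
      ext i
      exact div_self (ha _)
  constructor
  · intro h
    obtain ⟨P, ξ, h⟩ := (key 1).mp h
    obtain ⟨i, hi⟩ := h.exists_weight_eq h2 (fun i => div_ne_zero (ha _) (hb _)) hab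
    exact ⟨i, sub_eq_zero.mp hi⟩
  · rintro ⟨i, hi⟩
    obtain ⟨ι, hι⟩ := IsAlgClosed.exists_pow_nat_eq (-1 : AlgebraicClosure F) two_pos
    refine (key (Equiv.swap 0 i)).mpr ⟨_, _, isQuadrilateral_of_weight_eq (ι := ι) h2
      (fun i => div_ne_zero (ha _) (hb _)) ?_ (by rw [← hι, sq])⟩
    rw [← Equiv.sum_comp (Equiv.swap 0 i), Fin.sum_univ_three] at hi
    rw [Equiv.swap_apply_left] at hi ⊢
    linear_combination hi

end TetragonNormalForm

end Conics

/-! ### Conics through four points in the coordinates of the diagonal triangle -/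

section Frames

variable {k : Type*} [Field k]

/-- The matrix with columns `u 0 + u 1`, `u 0 + u 2`, `u 0 + u 3`: the vertices of the diagonal
triangle of the quadrangle `u`. -/
def frameMatrix (u : Fin 4 → Fin 3 → k) : Matrix (Fin 3) (Fin 3) k :=
  of fun i j => u 0 i + u j.succ i

/-- Four points in general position, normalised so that their coordinate vectors add up to `0`. -/
structure IsFrame (u : Fin 4 → Fin 3 → k) : Prop where
  sum_eq_zero : ∑ i, u i = 0
  det_ne_zero : (frameMatrix u).det ≠ 0

/-- The coordinates of the points of a frame in its diagonal triangle. -/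
def signVec (k : Type*) [Field k] : Fin 4 → Fin 3 → k :=
  ![![1, 1, 1], ![1, -1, -1], ![-1, 1, -1], ![-1, -1, 1]]

/-- The values of a quadratic form at the vertices of the diagonal triangle. -/
def frameCoord (u : Fin 4 → Fin 3 → k) (C : Matrix (Fin 3) (Fin 3) k) (j : Fin 3) : k :=
  (u 0 + u j.succ) ⬝ᵥ C *ᵥ (u 0 + u j.succ)

/-- The index of the pair of opposite sides of a quadrangle containing the side `i j`. -/
def pairIndex : Fin 4 → Fin 4 → Fin 3 :=
  ![![0, 0, 1, 2], ![0, 0, 2, 1], ![1, 2, 0, 0], ![2, 1, 0, 0]]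

/-- The factor `2` avoids denominators: for instance `2 u 0` is the sum of the three columns,
because the `u i` add up to zero. -/
theorem frameMatrix_mulVec_signVec {u : Fin 4 → Fin 3 → k} (hu : ∑ i, u i = 0) (i : Fin 4) :
    frameMatrix u *ᵥ signVec k i = (2 : k) • u i := by
  ext j
  have h := congrFun hu j
  simp only [Fin.sum_univ_four, Pi.add_apply, Pi.zero_apply] at h
  fin_cases i <;>
  simp only [frameMatrix, signVec, mulVec, vec3_dotProduct, of_apply, Fin.zero_eta, Fin.mk_one,
    Fin.reduceFinMk, cons_val_zero, cons_val_one, cons_val, Fin.succ_zero_eq_one,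
    Fin.succ_one_eq_two, Fin.reduceSucc, Pi.smul_apply, smul_eq_mul] <;>
  first | linear_combination h | linear_combination -h

theorem add_eq_or_neg {u : Fin 4 → Fin 3 → k} (hu : ∑ i, u i = 0) {i j : Fin 4} (hij : i ≠ j) :
    u i + u j = u 0 + u (pairIndex i j).succ ∨ u i + u j = -(u 0 + u (pairIndex i j).succ) := by
  rw [Fin.sum_univ_four] at hu
  fin_cases i <;> fin_cases j <;> first | exact absurd rfl hij | skip
  all_goals simp only [pairIndex, Fin.zero_eta, Fin.mk_one, Fin.reduceFinMk, cons_val_zero,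
    cons_val_one, cons_val, Fin.succ_zero_eq_one, Fin.succ_one_eq_two, Fin.reduceSucc, true_or]
  all_goals first
    | (left; exact add_comm _ _)
    | (right; linear_combination (exp := 1) hu)

/-- Since the vectors add up to zero, complementary pairs have opposite sums, and a quadratic form
does not see the sign. This makes the diagonal coordinates equivariant under permutations of the
frame. -/
theorem frameCoord_pairIndex {u : Fin 4 → Fin 3 → k} (hu : ∑ i, u i = 0)
    (C : Matrix (Fin 3) (Fin 3) k) {i j : Fin 4} (hij : i ≠ j) :
    (u i + u j) ⬝ᵥ C *ᵥ (u i + u j) = frameCoord u C (pairIndex i j) := by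
  rcases add_eq_or_neg hu hij with h | h <;> rw [h, frameCoord]
  rw [mulVec_neg, neg_dotProduct_neg]

section Diagonal

variable {u : Fin 4 → Fin 3 → k} {A B C : Matrix (Fin 3) (Fin 3) k}

theorem transpose_mul_mul_apply (N C : Matrix (Fin 3) (Fin 3) k) (i j : Fin 3) :
    (Nᵀ * C * N) i j = Nᵀ i ⬝ᵥ C *ᵥ Nᵀ j := by
  rw [Matrix.mul_assoc, mul_apply]
  simp only [dotProduct, mulVec, mul_apply, transpose_apply]

/-- The Gram matrix of a frame lying on a conic. -/
theorem gram_relations (h2 : (2 : k) ≠ 0) (hu : ∑ i, u i = 0) (hC : C.IsSymm)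
    (h : ∀ i, u i ⬝ᵥ C *ᵥ u i = 0) :
    u 0 ⬝ᵥ C *ᵥ u 1 + u 0 ⬝ᵥ C *ᵥ u 2 + u 0 ⬝ᵥ C *ᵥ u 3 = 0 ∧
      u 1 ⬝ᵥ C *ᵥ u 2 = u 0 ⬝ᵥ C *ᵥ u 3 ∧ u 1 ⬝ᵥ C *ᵥ u 3 = u 0 ⬝ᵥ C *ᵥ u 2 ∧
      u 2 ⬝ᵥ C *ᵥ u 3 = u 0 ⬝ᵥ C *ᵥ u 1 := by
  have key : ∀ i, u i ⬝ᵥ C *ᵥ u 0 + u i ⬝ᵥ C *ᵥ u 1 + u i ⬝ᵥ C *ᵥ u 2 + u i ⬝ᵥ C *ᵥ u 3 = 0 := by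
    intro i
    rw [Fin.sum_univ_four] at hu
    rw [← dotProduct_add, ← dotProduct_add, ← dotProduct_add, ← mulVec_add, ← mulVec_add,
      ← mulVec_add, hu, mulVec_zero, dotProduct_zero]
  have k0 := key 0
  have k1 := key 1
  have k2 := key 2
  have k3 := key 3
  rw [dot_mulVec_comm hC (u 1) (u 0)] at k1
  rw [dot_mulVec_comm hC (u 2) (u 0), dot_mulVec_comm hC (u 2) (u 1)] at k2
  rw [dot_mulVec_comm hC (u 3) (u 0), dot_mulVec_comm hC (u 3) (u 1),
    dot_mulVec_comm hC (u 3) (u 2)] at k3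
  rw [h] at k0 k1 k2 k3
  refine ⟨by linear_combination k0, ?_, ?_, ?_⟩ <;> apply mul_left_cancel₀ h2
  · linear_combination k1 + k2 - k0 - k3
  · linear_combination k1 + k3 - k0 - k2
  · linear_combination k2 + k3 - k0 - k1

/-- The diagonal triangle of a quadrangle is self-polar for every conic through its vertices. -/
theorem frameMatrix_diagonal (h2 : (2 : k) ≠ 0) (hu : ∑ i, u i = 0) (hC : C.IsSymm)
    (h : ∀ i, u i ⬝ᵥ C *ᵥ u i = 0) :
    (frameMatrix u)ᵀ * C * frameMatrix u = diagonal (frameCoord u C) := by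
  obtain ⟨h1, h3, h4, h5⟩ := gram_relations h2 hu hC h
  have hcol : ∀ j, (frameMatrix u)ᵀ j = u 0 + u j.succ := fun _ => rfl
  ext i j
  rw [transpose_mul_mul_apply, hcol, hcol]
  by_cases hij : i = j
  · subst hij
    rw [diagonal_apply_eq, frameCoord]
  · rw [diagonal_apply_ne _ hij]
    simp only [mulVec_add, dotProduct_add, add_dotProduct, h]
    rw [dot_mulVec_comm hC (u i.succ) (u 0)]
    fin_cases i <;> fin_cases j <;> first | exact absurd rfl hij | skip
    all_goals simp only [Fin.zero_eta, Fin.mk_one, Fin.reduceFinMk, Fin.succ_zero_eq_one,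
      Fin.succ_one_eq_two, Fin.reduceSucc]
    · linear_combination h1 + h3
    · linear_combination h1 + h4
    · linear_combination h1 + h3 + dot_mulVec_comm hC (u 2) (u 1)
    · linear_combination h1 + h5
    · linear_combination h1 + h4 + dot_mulVec_comm hC (u 3) (u 1)
    · linear_combination h1 + h5 + dot_mulVec_comm hC (u 3) (u 2)

/-- In diagonal coordinates this says that the conic passes through the points with coordinates
`±1`. -/
theorem frameCoord_sum (h2 : (2 : k) ≠ 0) (hu : ∑ i, u i = 0) (hC : C.IsSymm)
    (h : ∀ i, u i ⬝ᵥ C *ᵥ u i = 0) :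
    frameCoord u C 0 + frameCoord u C 1 + frameCoord u C 2 = 0 := by
  obtain ⟨h1, -⟩ := gram_relations h2 hu hC h
  have : ∀ j, frameCoord u C j = 2 * (u 0 ⬝ᵥ C *ᵥ u j.succ) := fun j => by
    rw [frameCoord]
    simp only [mulVec_add, dotProduct_add, add_dotProduct, h]
    rw [dot_mulVec_comm hC (u j.succ) (u 0)]; ring
  rw [this, this, this, Fin.succ_zero_eq_one, Fin.succ_one_eq_two,
    show (2 : Fin 3).succ = 3 from rfl]
  linear_combination 2 * h1

theorem frameCoord_smul (c : k) (j : Fin 3) : frameCoord u (c • C) j = c * frameCoord u C j := by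
  simp [frameCoord, smul_mulVec]

theorem frameCoord_add (j : Fin 3) :
    frameCoord u (A + B) j = frameCoord u A j + frameCoord u B j := by
  simp only [frameCoord, add_mulVec, dotProduct_add]

/-- The pencil of conics through a frame is determined by its diagonal coordinates. -/
theorem eq_zero_of_frameCoord_eq_zero (h2 : (2 : k) ≠ 0) (hu : IsFrame u) (hC : C.IsSymm)
    (h : ∀ i, u i ⬝ᵥ C *ᵥ u i = 0) (h0 : ∀ j, frameCoord u C j = 0) : C = 0 := by
  have hd := frameMatrix_diagonal h2 hu.1 hC h
  have hN : IsUnit (frameMatrix u) := (isUnit_iff_isUnit_det _).mpr hu.2.isUnit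
  have hN' : IsUnit (frameMatrix u)ᵀ := by
    rw [isUnit_iff_isUnit_det, det_transpose]; exact hu.2.isUnit
  rw [show frameCoord u C = 0 from funext h0, diagonal_zero'] at hd
  rw [hN.mul_left_eq_zero, hN'.mul_right_eq_zero] at hd
  exact hd

theorem det_ne_zero_iff_frameCoord (h2 : (2 : k) ≠ 0) (hu : IsFrame u) (hC : C.IsSymm)
    (h : ∀ i, u i ⬝ᵥ C *ᵥ u i = 0) : C.det ≠ 0 ↔ ∀ j, frameCoord u C j ≠ 0 := by
  have hd := congrArg det (frameMatrix_diagonal h2 hu.1 hC h)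
  rw [det_mul, det_mul, det_transpose, det_diagonal] at hd
  have hp : (∀ j, frameCoord u C j ≠ 0) ↔ ∏ j, frameCoord u C j ≠ 0 := by
    simp [Finset.prod_ne_zero_iff]
  rw [hp, ← hd]
  simp [hu.2]

/-- The minor of the diagonal coordinates of two conics of the pencil. -/
def frameMinor (u : Fin 4 → Fin 3 → k) (A B : Matrix (Fin 3) (Fin 3) k) : k :=
  frameCoord u A 0 * frameCoord u B 1 - frameCoord u A 1 * frameCoord u B 0

/-- In diagonal coordinates the polars of `u i` are the coefficient vectors of the two conics with
the same signs attached, so a relation between them is a relation between the coefficients. -/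
theorem linearIndependent_of_frameMinor (h2 : (2 : k) ≠ 0) (hu : IsFrame u) (hA : A.IsSymm)
    (hB : B.IsSymm) (hAu : ∀ i, u i ⬝ᵥ A *ᵥ u i = 0) (hBu : ∀ i, u i ⬝ᵥ B *ᵥ u i = 0)
    (hAB : frameMinor u A B ≠ 0) (i : Fin 4) :
    LinearIndependent k ![A *ᵥ u i, B *ᵥ u i] := by
  have hA' := frameMatrix_diagonal h2 hu.1 hA hAu
  have hB' := frameMatrix_diagonal h2 hu.1 hB hBu
  rw [LinearIndependent.pair_iff]
  intro s t hst
  have key : ∀ j, signVec k i j * (s * frameCoord u A j + t * frameCoord u B j) = 0 := by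
    intro j
    have hs : ∀ C : Matrix (Fin 3) (Fin 3) k, (2 : k) • (frameMatrix u)ᵀ *ᵥ (C *ᵥ u i)
        = ((frameMatrix u)ᵀ * C * frameMatrix u) *ᵥ signVec k i := by
      intro C
      rw [← mulVec_mulVec, frameMatrix_mulVec_signVec hu.1, mulVec_smul, mulVec_mulVec]
    have h1 := congrFun (congrArg (fun v => (frameMatrix u)ᵀ *ᵥ v) hst) j
    have hsA := congrFun (hs A) j
    have hsB := congrFun (hs B) j
    rw [hA'] at hsA
    rw [hB'] at hsB
    simp only [mulVec_add, mulVec_smul, mulVec_zero, Pi.zero_apply, Pi.add_apply, Pi.smul_apply,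
      smul_eq_mul, mulVec_diagonal] at h1 hsA hsB
    linear_combination 2 * h1 - s * hsA - t * hsB
  have hsg : ∀ j, signVec k i j ≠ 0 := by
    intro j; fin_cases i <;> fin_cases j <;> simp [signVec]
  have k0 := (mul_eq_zero.mp (key 0)).resolve_left (hsg 0)
  have k1 := (mul_eq_zero.mp (key 1)).resolve_left (hsg 1)
  constructor
  · refine (mul_eq_zero.mp (?_ : frameMinor u A B * s = 0)).resolve_left hAB
    rw [frameMinor]; linear_combination frameCoord u B 1 * k0 - frameCoord u B 0 * k1
  · refine (mul_eq_zero.mp (?_ : frameMinor u A B * t = 0)).resolve_left hAB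
    rw [frameMinor]; linear_combination frameCoord u A 0 * k1 - frameCoord u A 1 * k0

/-- Two conics of the pencil meet exactly in the points of the frame. -/
theorem exists_smul_frame (h2 : (2 : k) ≠ 0) (hu : IsFrame u) (hA : A.IsSymm)
    (hB : B.IsSymm) (hAu : ∀ i, u i ⬝ᵥ A *ᵥ u i = 0) (hBu : ∀ i, u i ⬝ᵥ B *ᵥ u i = 0)
    (hAB : frameMinor u A B ≠ 0) {x : Fin 3 → k} (hxA : x ⬝ᵥ A *ᵥ x = 0)
    (hxB : x ⬝ᵥ B *ᵥ x = 0) : ∃ i, ∃ c : k, c • u i = x := by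
  have hA' := frameMatrix_diagonal h2 hu.1 hA hAu
  have hB' := frameMatrix_diagonal h2 hu.1 hB hBu
  have hu' : IsUnit (frameMatrix u).det := hu.2.isUnit
  obtain ⟨y, rfl⟩ : ∃ y, frameMatrix u *ᵥ y = x := ⟨(frameMatrix u)⁻¹ *ᵥ x, by
    rw [mulVec_mulVec, mul_nonsing_inv _ hu', one_mulVec]⟩
  rw [dot_mulVec_mulVec, hA', mulVec_diagonal_dot, diagForm, Fin.sum_univ_three] at hxA
  rw [dot_mulVec_mulVec, hB', mulVec_diagonal_dot, diagForm, Fin.sum_univ_three] at hxB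
  have sA := frameCoord_sum h2 hu.1 hA hAu
  have sB := frameCoord_sum h2 hu.1 hB hBu
  -- As the coefficients of each conic add up to zero, both equations are linear in `y 0 ^ 2 - y 2 ^
  -- 2` and `y 1 ^ 2 - y 2 ^ 2`, with nonzero determinant. The coordinates thus agree up to signs.
  have e0 : (y 0 - y 2) * (y 0 + y 2) = 0 := by
    refine (mul_eq_zero.mp (?_ : frameMinor u A B * _ = 0)).resolve_left hAB
    rw [frameMinor]
    linear_combination frameCoord u B 1 * (hxA - y 2 * y 2 * sA)
      - frameCoord u A 1 * (hxB - y 2 * y 2 * sB)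
  have e1 : (y 1 - y 2) * (y 1 + y 2) = 0 := by
    refine (mul_eq_zero.mp (?_ : frameMinor u A B * _ = 0)).resolve_left hAB
    rw [frameMinor]
    linear_combination frameCoord u A 0 * (hxB - y 2 * y 2 * sB)
      - frameCoord u B 0 * (hxA - y 2 * y 2 * sA)
  have fin : ∀ i, ∀ c : k, y = c • signVec k i →
      ∃ i, ∃ c : k, c • u i = frameMatrix u *ᵥ y := by
    rintro i c rfl
    exact ⟨i, c * 2, by rw [mulVec_smul, frameMatrix_mulVec_signVec hu.1, mul_smul]⟩
  rcases mul_eq_zero.mp e0 with h0 | h0 <;> rcases mul_eq_zero.mp e1 with h1 | h1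
  · refine fin 0 (y 2) ?_
    ext j; fin_cases j <;> simp [signVec] <;> first | linear_combination h0 | linear_combination h1
  · refine fin 2 (-y 2) ?_
    ext j; fin_cases j <;> simp [signVec] <;> first | linear_combination h0 | linear_combination h1
  · refine fin 1 (-y 2) ?_
    ext j; fin_cases j <;> simp [signVec] <;> first | linear_combination h0 | linear_combination h1
  · refine fin 3 (y 2) ?_
    ext j; fin_cases j <;> simp [signVec] <;> first | linear_combination h0 | linear_combination h1

/-- If the minor vanishes, the two conics are proportional. -/
theorem proportional_of_frameMinor_eq_zero (h2 : (2 : k) ≠ 0) (hu : IsFrame u) (hA : A.IsSymm)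
    (hB : B.IsSymm) (hAu : ∀ i, u i ⬝ᵥ A *ᵥ u i = 0) (hBu : ∀ i, u i ⬝ᵥ B *ᵥ u i = 0)
    (hB0 : B ≠ 0) (hAB : frameMinor u A B = 0) : ∃ c : k, A = c • B := by
  have sA := frameCoord_sum h2 hu.1 hA hAu
  have sB := frameCoord_sum h2 hu.1 hB hBu
  rw [frameMinor] at hAB
  obtain ⟨j, hj⟩ : ∃ j, frameCoord u B j ≠ 0 := by
    by_contra! h
    exact hB0 (eq_zero_of_frameCoord_eq_zero h2 hu hB hBu h)
  refine ⟨frameCoord u A j / frameCoord u B j, ?_⟩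
  rw [← sub_eq_zero, sub_eq_add_neg, ← neg_smul]
  set c := -(frameCoord u A j / frameCoord u B j) with hc
  have hc' : c * frameCoord u B j = -frameCoord u A j := by
    rw [hc]; field_simp
  refine eq_zero_of_frameCoord_eq_zero h2 hu (hA.add (hB.smul _)) ?_ ?_
  · intro i
    rw [add_mulVec, dotProduct_add, smul_mulVec, dotProduct_smul, hAu, hBu]; simp
  · intro i
    rw [frameCoord_add, frameCoord_smul]
    refine (mul_eq_zero.mp (?_ : frameCoord u B j * _ = 0)).resolve_left hj
    have : frameCoord u B j * frameCoord u A i = frameCoord u A j * frameCoord u B i := by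
      fin_cases i <;> fin_cases j <;> simp only [Fin.zero_eta, Fin.mk_one, Fin.reduceFinMk] <;>
        grind
    linear_combination this + frameCoord u B i * hc'

end Diagonal

/-- A frame is determined up to a common factor by its points. -/
theorem frame_smul_unique (h2 : (2 : k) ≠ 0) {u v : Fin 4 → Fin 3 → k} (hu : IsFrame u)
    (hv : ∑ i, v i = 0) (h : ∀ i, ∃ c : k, c • u i = v i) : ∃ c : k, ∀ i, c • u i = v i := by
  choose c hc using h
  refine ⟨c 0, fun i => ?_⟩
  have h1 : frameMatrix u *ᵥ (∑ i, c i • signVec k i) = 0 := by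
    simp only [mulVec_sum, mulVec_smul, frameMatrix_mulVec_signVec hu.1, smul_comm _ (2 : k), hc]
    rw [← Finset.smul_sum, hv, smul_zero]
  have h3 : ∑ i, c i • signVec k i = 0 := by
    by_contra h0
    exact hu.2 (exists_mulVec_eq_zero_iff.mp ⟨_, h0, h1⟩)
  have e0 := congrFun h3 0
  have e1 := congrFun h3 1
  have e2 := congrFun h3 2
  simp [Fin.sum_univ_four, signVec] at e0 e1 e2
  have : c i = c 0 := by
    apply mul_left_cancel₀ h2
    fin_cases i <;> simp only [Fin.zero_eta, Fin.mk_one, Fin.reduceFinMk]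
    · linear_combination -e1 - e2
    · linear_combination -e0 - e2
    · linear_combination -e0 - e1
  rw [← this, hc]

end Frames

/-! ### Four common points of two transversal conics -/

section SimultaneousDiagonalisation

variable {k : Type*} [Field k] [IsAlgClosed k] {A B : Matrix (Fin 3) (Fin 3) k}

/-- The endomorphism `A⁻¹ * B` has an eigenvector in every nonzero invariant subspace; applied to
the whole space and then to an orthogonal complement. -/
theorem exists_relative_eigenvector (hA : A.det ≠ 0) (V : Submodule k (Fin 3 → k)) (hV : V ≠ ⊥)
    (hT : ∀ x ∈ V, (A⁻¹ * B) *ᵥ x ∈ V) :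
    ∃ x ∈ V, x ≠ 0 ∧ ∃ c : k, B *ᵥ x = c • A *ᵥ x := by
  have : Nontrivial V := Submodule.nontrivial_iff_ne_bot.mpr hV
  obtain ⟨c, hc⟩ := Module.End.exists_eigenvalue ((toLin' (A⁻¹ * B)).restrict hT)
  obtain ⟨x, hx, hx0⟩ := hc.exists_hasEigenvector
  refine ⟨x, x.2, by simpa using hx0, c, ?_⟩
  have h1 : (A⁻¹ * B) *ᵥ (x : Fin 3 → k) = c • (x : Fin 3 → k) :=
    congrArg Subtype.val (Module.End.mem_eigenspace_iff.mp hx)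
  rw [← mulVec_smul, ← h1, mulVec_mulVec, ← Matrix.mul_assoc, mul_nonsing_inv _ hA.isUnit,
    Matrix.one_mul]

/-- Two transversal smooth conics have a common self-polar triangle. -/
theorem exists_self_polar_triangle (hAs : A.IsSymm) (hBs : B.IsSymm) (hA : A.det ≠ 0)
    (hE : ∀ x : Fin 3 → k, x ≠ 0 → ∀ c : k, B *ᵥ x = c • A *ᵥ x → x ⬝ᵥ A *ᵥ x ≠ 0) :
    ∃ (v : Fin 3 → Fin 3 → k) (c : Fin 3 → k), (∀ i, v i ⬝ᵥ A *ᵥ v i ≠ 0) ∧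
      (∀ i j, i ≠ j → v i ⬝ᵥ A *ᵥ v j = 0) ∧ (∀ i, B *ᵥ v i = c i • A *ᵥ v i) ∧
      Function.Injective c := by
  have hAinj : ∀ x, A *ᵥ x = 0 → x = 0 := fun x hx => by
    by_contra h0
    exact hA (exists_mulVec_eq_zero_iff.mp ⟨x, h0, hx⟩)
  obtain ⟨v, -, hv0, c, hv⟩ := exists_relative_eigenvector (B := B) hA ⊤ top_ne_bot
    (fun _ _ => Submodule.mem_top)
  let f : (Fin 3 → k) →ₗ[k] k :=
    { toFun := fun x => x ⬝ᵥ A *ᵥ v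
      map_add' := fun x y => add_dotProduct x y _
      map_smul' := fun r x => smul_dotProduct r x _ }
  have hf : ∀ x, f x = x ⬝ᵥ A *ᵥ v := fun _ => rfl
  have hker : LinearMap.ker f ≠ ⊥ := LinearMap.ker_ne_bot_of_finrank_lt (by simp)
  obtain ⟨w, hwf, hw0, d, hw⟩ := exists_relative_eigenvector (B := B) hA (LinearMap.ker f) hker (by
    intro x hx
    rw [LinearMap.mem_ker, hf] at hx ⊢
    rw [dot_mulVec_comm hAs, mulVec_mulVec, ← Matrix.mul_assoc, mul_nonsing_inv _ hA.isUnit,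
      Matrix.one_mul, dot_mulVec_comm hBs, hv, dotProduct_smul, hx, smul_zero])
  rw [LinearMap.mem_ker, hf] at hwf
  have hvA := hE v hv0 c hv
  have hwA := hE w hw0 d hw
  have hindep : ¬ ∃ e : k, e • v = w := by
    rintro ⟨e, rfl⟩
    rw [smul_dotProduct, smul_eq_mul] at hwf
    have he : e = 0 := (mul_eq_zero.mp hwf).resolve_right hvA
    exact hw0 (by rw [he, zero_smul])
  have hAindep : ¬ ∃ e : k, e • A *ᵥ v = A *ᵥ w := by
    rintro ⟨e, he⟩
    refine hindep ⟨e, ?_⟩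
    rw [← sub_eq_zero]
    apply hAinj
    rw [mulVec_sub, mulVec_smul, he, sub_self]
  have hAv0 : A *ᵥ v ≠ 0 := fun h => hv0 (hAinj _ h)
  -- The third vertex is the pole of the line through `v` and `w`. As `A z` and `B z` are both
  -- orthogonal to `v` and `w`, they are proportional, so `z` is again an eigenvector.
  set z := crossProduct (A *ᵥ v) (A *ᵥ w) with hz
  have hz0 : z ≠ 0 := cross_ne_zero_of_not_smul hAv0 hAindep
  have hzv : v ⬝ᵥ A *ᵥ z = 0 := by
    rw [dot_mulVec_comm hAs, dotProduct_comm, hz, dot_self_cross]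
  have hzw : w ⬝ᵥ A *ᵥ z = 0 := by
    rw [dot_mulVec_comm hAs, dotProduct_comm, hz, dot_cross_self]
  obtain ⟨e, he⟩ := exists_smul_cross hv0 hindep hzv hzw
  obtain ⟨e', he'⟩ := exists_smul_cross hv0 hindep (ξ := B *ᵥ z)
    (by rw [dot_mulVec_comm hBs, hv, dotProduct_smul, dot_mulVec_comm hAs, hzv, smul_zero])
    (by rw [dot_mulVec_comm hBs, hw, dotProduct_smul, dot_mulVec_comm hAs, hzw, smul_zero])
  have he0 : e ≠ 0 := by
    rintro rfl
    exact hz0 (hAinj _ (by rw [← he, zero_smul]))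
  have hzE : B *ᵥ z = (e' / e) • A *ᵥ z := by
    rw [← he, ← he', smul_smul, div_mul_cancel₀ _ he0]
  have hzA := hE z hz0 _ hzE
  set V : Fin 3 → Fin 3 → k := ![v, w, z]
  set L : Fin 3 → k := ![c, d, e' / e]
  have hVV : ∀ i, V i ⬝ᵥ A *ᵥ V i ≠ 0 := by intro i; fin_cases i <;> assumption
  have hVE : ∀ i, B *ᵥ V i = L i • A *ᵥ V i := by intro i; fin_cases i <;> assumption
  have hVO : ∀ i j, i ≠ j → V i ⬝ᵥ A *ᵥ V j = 0 := by
    intro i j hij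
    fin_cases i <;> fin_cases j <;> first | exact absurd rfl hij | skip
    · exact (dot_mulVec_comm hAs _ _).trans hwf
    · exact hzv
    · exact hwf
    · exact hzw
    · exact (dot_mulVec_comm hAs _ _).trans hzv
    · exact (dot_mulVec_comm hAs _ _).trans hzw
  refine ⟨V, L, hVV, hVO, hVE, ?_⟩
  intro i j hij
  by_contra hne
  -- If two eigenvalues agreed, the span of their eigenvectors would consist of eigenvectors and
  -- would contain an isotropic one, contrary to `hE`.
  obtain ⟨s, hs⟩ := IsAlgClosed.exists_pow_nat_eq
    (-(V i ⬝ᵥ A *ᵥ V i) / (V j ⬝ᵥ A *ᵥ V j)) two_pos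
  rw [eq_div_iff (hVV j)] at hs
  have hx0 : V i + s • V j ≠ 0 := by
    intro h0
    have := congrArg (fun x => V i ⬝ᵥ A *ᵥ x) h0
    simp only [mulVec_add, mulVec_smul, dotProduct_add, dotProduct_smul, hVO i j hne,
      mulVec_zero, dotProduct_zero, smul_zero, add_zero] at this
    exact hVV i this
  refine hE (V i + s • V j) hx0 (L i) ?_ ?_
  · rw [mulVec_add, mulVec_smul, hVE, hVE, ← hij, mulVec_add, mulVec_smul, smul_add, smul_comm s]
  · simp only [mulVec_add, mulVec_smul, dotProduct_add, dotProduct_smul, add_dotProduct,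
      smul_dotProduct, hVO i j hne, hVO j i (Ne.symm hne), zero_add, smul_eq_mul]
    linear_combination hs

/-- Two transversal smooth conics meet in four points in general position. -/
theorem exists_frame (h2 : (2 : k) ≠ 0) (hAs : A.IsSymm) (hBs : B.IsSymm) (hA : A.det ≠ 0)
    (hT : ∀ x : Fin 3 → k, x ≠ 0 → x ⬝ᵥ A *ᵥ x = 0 → x ⬝ᵥ B *ᵥ x = 0 →
      LinearIndependent k ![A *ᵥ x, B *ᵥ x]) :
    ∃ u : Fin 4 → Fin 3 → k, IsFrame u ∧ (∀ i, u i ⬝ᵥ A *ᵥ u i = 0) ∧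
      ∀ i, u i ⬝ᵥ B *ᵥ u i = 0 := by
  -- At an isotropic relative eigenvector both conics would pass with the same tangent, so
  -- transversality excludes it.
  have hE : ∀ x : Fin 3 → k, x ≠ 0 → ∀ c : k, B *ᵥ x = c • A *ᵥ x → x ⬝ᵥ A *ᵥ x ≠ 0 := by
    intro x hx c hc h0
    have := hT x hx h0 (by rw [hc, dotProduct_smul, h0, smul_zero])
    rw [LinearIndependent.pair_iff] at this
    have h1 := (this (-c) 1 (by rw [hc]; simp)).2
    exact one_ne_zero h1
  obtain ⟨v, c, hvA, hvO, hvE, hc⟩ := exists_self_polar_triangle hAs hBs hA hE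
  set a : Fin 3 → k := fun i => v i ⬝ᵥ A *ᵥ v i with ha
  -- The weights `w i = d i * a i` are proportional to `(c 2 - c 1, c 0 - c 2, c 1 - c 0)`, the
  -- solution of `∑ w i = 0` and `∑ c i * w i = 0`. Hence the points `∑ ± s i • v i` with `s i ^ 2 =
  -- d i` lie on both conics.
  set d : Fin 3 → k := ![a 1 * a 2 * (c 2 - c 1), a 2 * a 0 * (c 0 - c 2), a 0 * a 1 * (c 1 - c 0)]
    with hd
  have hd0 : ∀ i, d i ≠ 0 := by
    intro i
    fin_cases i
    · exact mul_ne_zero (mul_ne_zero (hvA 1) (hvA 2)) (sub_ne_zero.mpr (hc.ne (by decide)))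
    · exact mul_ne_zero (mul_ne_zero (hvA 2) (hvA 0)) (sub_ne_zero.mpr (hc.ne (by decide)))
    · exact mul_ne_zero (mul_ne_zero (hvA 0) (hvA 1)) (sub_ne_zero.mpr (hc.ne (by decide)))
  have hs : ∀ i, ∃ s : k, s ^ 2 = d i := fun i => IsAlgClosed.exists_pow_nat_eq _ two_pos
  choose s hs using hs
  have hs0 : ∀ i, s i ≠ 0 := fun i h0 => hd0 i (by rw [← hs, h0, zero_pow two_ne_zero])
  set N : Matrix (Fin 3) (Fin 3) k := (of fun i => s i • v i)ᵀ with hN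
  have hNA : Nᵀ * A * N = diagonal fun i => d i * a i := by
    ext i j
    rw [transpose_mul_mul_apply]
    simp only [hN, transpose_transpose]
    change s i • v i ⬝ᵥ A *ᵥ (s j • v j) = _
    rw [mulVec_smul, smul_dotProduct, dotProduct_smul]
    by_cases hij : i = j
    · subst hij
      rw [diagonal_apply_eq, ← hs]
      simp only [smul_eq_mul, ha]; ring
    · rw [diagonal_apply_ne _ hij, hvO i j hij]; simp
  have hNB : Nᵀ * B * N = diagonal fun i => c i * (d i * a i) := by
    ext i j
    rw [transpose_mul_mul_apply]
    simp only [hN, transpose_transpose]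
    change s i • v i ⬝ᵥ B *ᵥ (s j • v j) = _
    rw [mulVec_smul, smul_dotProduct, dotProduct_smul, hvE, dotProduct_smul]
    by_cases hij : i = j
    · subst hij
      rw [diagonal_apply_eq, ← hs]
      simp only [smul_eq_mul, ha]; ring
    · rw [diagonal_apply_ne _ hij, hvO i j hij]; simp
  have hNdet : N.det ≠ 0 := by
    intro h0
    have := congrArg det hNA
    rw [det_mul, h0, mul_zero, det_diagonal] at this
    exact Finset.prod_ne_zero_iff.mpr (fun i _ => mul_ne_zero (hd0 i) (hvA i)) this.symm
  have hsq : ∀ i j, signVec k i j * signVec k i j = 1 := by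
    intro i j
    fin_cases i <;> fin_cases j <;> simp [signVec]
  have hsum : d 0 * a 0 + d 1 * a 1 + d 2 * a 2 = 0 := by
    simp [hd]; ring
  have hsumc : c 0 * (d 0 * a 0) + c 1 * (d 1 * a 1) + c 2 * (d 2 * a 2) = 0 := by
    simp [hd]; ring
  refine ⟨fun i => N *ᵥ signVec k i, ⟨?_, ?_⟩, fun i => ?_, fun i => ?_⟩
  · rw [← mulVec_sum]
    have : ∑ i, signVec k i = 0 := by
      ext j; fin_cases j <;> simp [Fin.sum_univ_four, signVec]
    rw [this, mulVec_zero]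
  · have : frameMatrix (fun i => N *ᵥ signVec k i) = (2 : k) • N := by
      ext i j
      simp only [frameMatrix, of_apply, ← Pi.add_apply, ← mulVec_add]
      simp only [mulVec, vec3_dotProduct, Pi.add_apply, Matrix.smul_apply, smul_eq_mul]
      fin_cases j <;> simp [signVec] <;> ring
    rw [this, det_smul]
    exact mul_ne_zero (pow_ne_zero _ h2) hNdet
  · rw [dot_mulVec_mulVec, hNA, mulVec_diagonal_dot, diagForm, Fin.sum_univ_three]
    simp only [mul_assoc, hsq]
    linear_combination hsum
  · rw [dot_mulVec_mulVec, hNB, mulVec_diagonal_dot, diagForm, Fin.sum_univ_three]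
    simp only [mul_assoc, hsq]
    linear_combination hsumc

end SimultaneousDiagonalisation

/-! ### Permuting, scaling and moving frames -/

section FramePermutations

variable {k : Type*} [Field k] {u : Fin 4 → Fin 3 → k}

/-- `frameMatrix` singles out `u 0`; the condition that the vectors span is symmetric in the four
points, as permuting a frame requires. -/
theorem det_frameMatrix_ne_zero_iff (h2 : (2 : k) ≠ 0) (hu : ∑ i, u i = 0) :
    (frameMatrix u).det ≠ 0 ↔ ∀ f : Fin 3 → k, (∀ i, f ⬝ᵥ u i = 0) → f = 0 := by
  rw [Ne, ← exists_vecMul_eq_zero_iff]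
  have key : ∀ f : Fin 3 → k, f ᵥ* frameMatrix u = 0 ↔ ∀ i, f ⬝ᵥ u i = 0 := by
    intro f
    constructor
    · intro h i
      have : f ⬝ᵥ ((2 : k) • u i) = 0 := by
        rw [← frameMatrix_mulVec_signVec hu, dotProduct_mulVec, h, zero_dotProduct]
      rw [dotProduct_smul, smul_eq_mul] at this
      exact (mul_eq_zero.mp this).resolve_left h2
    · intro h
      ext j
      change f ⬝ᵥ (u 0 + u j.succ) = 0
      rw [dotProduct_add, h, h, add_zero]
  constructor
  · intro h f hf
    by_contra h0
    exact h ⟨f, h0, (key f).mpr hf⟩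
  · rintro h ⟨f, h0, hf⟩
    exact h0 (h f ((key f).mp hf))

theorem IsFrame.comp (h2 : (2 : k) ≠ 0) (hu : IsFrame u) (π : Equiv.Perm (Fin 4)) :
    IsFrame (u ∘ π) := by
  have hs : ∑ i, (u ∘ π) i = 0 := (Equiv.sum_comp π u).trans hu.1
  refine ⟨hs, (det_frameMatrix_ne_zero_iff h2 hs).mpr fun f hf => ?_⟩
  refine (det_frameMatrix_ne_zero_iff h2 hu.1).mp hu.2 f fun i => ?_
  simpa using hf (π.symm i)

theorem IsFrame.smul (hu : IsFrame u) {c : k} (hc : c ≠ 0) : IsFrame (fun i => c • u i) := by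
  refine ⟨by rw [← Finset.smul_sum, hu.1, smul_zero], ?_⟩
  have : frameMatrix (fun i => c • u i) = c • frameMatrix u := by
    ext i j
    simp [frameMatrix, mul_add]
  rw [this, det_smul]
  exact mul_ne_zero (pow_ne_zero _ hc) hu.2

theorem IsFrame.mulVec (hu : IsFrame u) {g : Matrix (Fin 3) (Fin 3) k} (hg : g.det ≠ 0) :
    IsFrame (fun i => g *ᵥ u i) := by
  refine ⟨by rw [← mulVec_sum, hu.1, mulVec_zero], ?_⟩
  have : frameMatrix (fun i => g *ᵥ u i) = g * frameMatrix u := by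
    ext i j
    simp only [frameMatrix, of_apply, ← Pi.add_apply, ← mulVec_add]
    rfl
  rw [this, det_mul]
  exact mul_ne_zero hg hu.2

theorem IsFrame.not_smul (h2 : (2 : k) ≠ 0) (hu : IsFrame u) {i j : Fin 4} (hij : i ≠ j) (c : k) :
    c • u i ≠ u j := by
  intro h
  have h1 : frameMatrix u *ᵥ (c • signVec k i - signVec k j) = 0 := by
    rw [mulVec_sub, mulVec_smul, frameMatrix_mulVec_signVec hu.1, frameMatrix_mulVec_signVec hu.1,
      smul_comm, h, sub_self]
  have h3 : c • signVec k i - signVec k j = 0 := by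
    by_contra h0
    exact hu.2 (exists_mulVec_eq_zero_iff.mp ⟨_, h0, h1⟩)
  have e0 := congrFun h3 0
  have e1 := congrFun h3 1
  have e2 := congrFun h3 2
  clear h h1 h3
  fin_cases i <;> fin_cases j <;> first | exact absurd rfl hij | skip
  all_goals
    simp [signVec] at e0 e1 e2
    grind

theorem IsFrame.ne_zero (h2 : (2 : k) ≠ 0) (hu : IsFrame u) (i : Fin 4) : u i ≠ 0 := by
  intro h
  obtain ⟨j, hj⟩ : ∃ j : Fin 4, j ≠ i := exists_ne i
  exact hu.not_smul h2 hj 0 (by rw [h, zero_smul])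

end FramePermutations

/-! ### The set of conics over the base field through a frame -/

section FramePencil

variable {F : Type*} [Field F]

/-- The conics over `F` through the points of a frame. -/
def framePencil (u : Fin 4 → Fin 3 → AlgebraicClosure F) : Set (Conic F) :=
  {C | ∀ i, u i ⬝ᵥ C.geomMatrix *ᵥ u i = 0}

theorem geomMatrix_ne_zero (A : Conic F) : A.geomMatrix ≠ 0 := by
  intro h
  apply A.rep_nonzero
  ext i j
  have := congrFun (congrFun h i) j
  simpa [Conic.geomMatrix] using this

/-- The scalar is a quotient of matrix entries, so it already lies in `F`. -/
theorem conic_eq_of_geomMatrix {A B : Conic F} {c : AlgebraicClosure F}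
    (h : A.geomMatrix = c • B.geomMatrix) : A = B := by
  obtain ⟨i, hi⟩ := Function.ne_iff.mp (geomMatrix_ne_zero B)
  obtain ⟨j, hj⟩ := Function.ne_iff.mp hi
  have hent : ∀ i j, algebraMap F (AlgebraicClosure F) ((A.rep : Matrix _ _ F) i j)
      = c * algebraMap F (AlgebraicClosure F) ((B.rep : Matrix _ _ F) i j) :=
    fun i j => congrFun (congrFun h i) j
  have hj' : algebraMap F (AlgebraicClosure F) ((B.rep : Matrix _ _ F) i j) ≠ 0 := hj
  have hc : c = algebraMap F (AlgebraicClosure F)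
      ((A.rep : Matrix _ _ F) i j / (B.rep : Matrix _ _ F) i j) := by
    rw [map_div₀, eq_div_iff hj', hent]
  rw [← A.mk_rep, ← B.mk_rep, Projectivization.mk_eq_mk_iff']
  refine ⟨(A.rep : Matrix _ _ F) i j / (B.rep : Matrix _ _ F) i j, ?_⟩
  ext i' j'
  apply (algebraMap F (AlgebraicClosure F)).injective
  rw [hent, hc, ← map_mul]
  rfl

variable {u : Fin 4 → Fin 3 → AlgebraicClosure F} {A B C : Conic F}

theorem frameMinor_ne_zero (h2 : (2 : AlgebraicClosure F) ≠ 0) (hu : IsFrame u)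
    (hA : A ∈ framePencil u) (hB : B ∈ framePencil u) (hAB : A ≠ B) :
    frameMinor u A.geomMatrix B.geomMatrix ≠ 0 := by
  intro h
  obtain ⟨c, hc⟩ := proportional_of_frameMinor_eq_zero h2 hu (geomMatrix_isSymm A)
    (geomMatrix_isSymm B) hA hB (geomMatrix_ne_zero B) h
  exact hAB (conic_eq_of_geomMatrix hc)

theorem isSmooth_iff_frameCoord (h2 : (2 : AlgebraicClosure F) ≠ 0) (hu : IsFrame u)
    (hA : A ∈ framePencil u) : A.IsSmooth ↔ ∀ j, frameCoord u A.geomMatrix j ≠ 0 := by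
  rw [isSmooth_iff, det_ne_zero_iff_frameCoord h2 hu (geomMatrix_isSymm A) hA]

theorem transversal_of_mem_framePencil (h2 : (2 : AlgebraicClosure F) ≠ 0) (hu : IsFrame u)
    (hA : A ∈ framePencil u) (hB : B ∈ framePencil u) (hAB : A ≠ B) : A.Transversal B := by
  have hm := frameMinor_ne_zero h2 hu hA hB hAB
  rw [transversal_iff]
  intro x hx hxA hxB
  obtain ⟨i, c, rfl⟩ := exists_smul_frame h2 hu (geomMatrix_isSymm A) (geomMatrix_isSymm B) hA hB hm
    hxA hxB
  have hc : c ≠ 0 := by rintro rfl; exact hx (zero_smul _ _)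
  have := linearIndependent_of_frameMinor h2 hu (geomMatrix_isSymm A) (geomMatrix_isSymm B) hA hB
    hm i
  rw [LinearIndependent.pair_iff] at this ⊢
  intro s t hst
  apply this
  rw [mulVec_smul, mulVec_smul, smul_comm s, smul_comm t, ← smul_add] at hst
  exact (smul_eq_zero.mp hst).resolve_left hc

/-- The pairs in `Ψ` inside the pencil through a frame. -/
theorem mem_smoothPairs_iff (h2 : (2 : AlgebraicClosure F) ≠ 0) (hu : IsFrame u)
    (hA : A ∈ framePencil u) (hB : B ∈ framePencil u) :
    (A, B) ∈ smoothPairs F ↔ A.IsSmooth ∧ B.IsSmooth ∧ A ≠ B := by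
  constructor
  · rintro ⟨h1, h3, h4⟩
    refine ⟨h1, h3, ?_⟩
    rintro rfl
    have := (transversal_iff A A).mp h4 (u 0) (hu.ne_zero h2 0) (hA 0) (hA 0)
    rw [LinearIndependent.pair_iff] at this
    exact one_ne_zero (this 1 (-1) (by simp)).1
  · rintro ⟨h1, h3, h4⟩
    exact ⟨h1, h3, transversal_of_mem_framePencil h2 hu hA hB h4⟩

theorem inter_eq_frame (h2 : (2 : AlgebraicClosure F) ≠ 0) (hu : IsFrame u)
    (hA : A ∈ framePencil u) (hB : B ∈ framePencil u) (hAB : A ≠ B) (X : GeomPoint F) :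
    (A.Contains X ∧ B.Contains X) ↔ X ∈ Set.range fun i =>
      Projectivization.mk (AlgebraicClosure F) (u i) (hu.ne_zero h2 i) := by
  constructor
  · rintro ⟨h1, h3⟩
    obtain ⟨i, c, hc⟩ := exists_smul_frame h2 hu (geomMatrix_isSymm A) (geomMatrix_isSymm B) hA hB
      (frameMinor_ne_zero h2 hu hA hB hAB) h1 h3
    have hc0 : c ≠ 0 := by rintro rfl; exact X.rep_nonzero (by rw [← hc, zero_smul])
    refine ⟨i, ?_⟩
    conv_rhs => rw [← X.mk_rep]
    rw [Projectivization.mk_eq_mk_iff']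
    exact ⟨c⁻¹, by rw [← hc, inv_smul_smul₀ hc0]⟩
  · rintro ⟨i, rfl⟩
    exact ⟨(contains_mk A _ _).mpr (hA i), (contains_mk B _ _).mpr (hB i)⟩

end FramePencil

/-! ### Frobenius action on the common points -/

section Frobenius

variable {F : Type*} [Field F] [Fintype F]

/-- The descent of Frobenius-invariant elements. -/
theorem exists_algebraMap_eq_of_pow_card {x : AlgebraicClosure F} (hx : x ^ Fintype.card F = x) :
    ∃ y : F, algebraMap F (AlgebraicClosure F) y = x := by
  classical
  by_contra! h
  let p : Polynomial (AlgebraicClosure F) := Polynomial.X ^ Fintype.card F - Polynomial.X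
  have hp : p ≠ 0 := FiniteField.X_pow_card_sub_X_ne_zero _ Fintype.one_lt_card
  let S : Finset (AlgebraicClosure F) :=
    insert x (Finset.univ.image (algebraMap F (AlgebraicClosure F)))
  have hS : S ⊆ p.roots.toFinset := by
    intro y hy
    rw [Multiset.mem_toFinset, Polynomial.mem_roots hp]
    rcases Finset.mem_insert.mp hy with rfl | hy
    · simp [p, hx]
    · obtain ⟨z, -, rfl⟩ := Finset.mem_image.mp hy
      simp [p, ← map_pow, FiniteField.pow_card]
  have h1 : S.card = Fintype.card F + 1 := by
    rw [Finset.card_insert_of_notMem (by simpa using h),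
      Finset.card_image_of_injective _ (algebraMap F _).injective, Finset.card_univ]
  have h3 := (Finset.card_le_card hS).trans ((Multiset.toFinset_card_le _).trans p.card_roots')
  rw [h1, FiniteField.X_pow_card_sub_X_natDegree_eq _ Fintype.one_lt_card] at h3
  omega

/-- The Frobenius permutes the vectors of `u` by `σ`. -/
def IsTwisted (σ : Equiv.Perm (Fin 4)) (u : Fin 4 → Fin 3 → AlgebraicClosure F) : Prop :=
  ∀ i j, u i j ^ Fintype.card F = u (σ i) j

/-- The action of a permutation of the points of a quadrangle on its pairs of opposite sides. -/
def pairPerm (σ : Equiv.Perm (Fin 4)) (j : Fin 3) : Fin 3 := pairIndex (σ 0) (σ j.succ)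

theorem frobenius_dot (C : Conic F) (x y : Fin 3 → AlgebraicClosure F) :
    (x ⬝ᵥ C.geomMatrix *ᵥ y) ^ Fintype.card F =
      (fun i => x i ^ Fintype.card F) ⬝ᵥ C.geomMatrix *ᵥ (fun i => y i ^ Fintype.card F) := by
  let φ := FiniteField.frobeniusAlgHom F (AlgebraicClosure F)
  have hφ : ∀ z, φ z = z ^ Fintype.card F := fun _ => rfl
  simp only [← hφ, dotProduct, mulVec, map_sum, map_mul]
  simp only [Conic.geomMatrix, map_apply, AlgHom.commutes]

/-- Frobenius fixes the matrix of `C` and carries `u 0 + u j.succ` to a sum of two frame vectors,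
which gives a diagonal coordinate again. -/
theorem frameCoord_pow_card {σ : Equiv.Perm (Fin 4)} {u : Fin 4 → Fin 3 → AlgebraicClosure F}
    (hu : IsFrame u) (hσ : IsTwisted σ u) (C : Conic F) (j : Fin 3) :
    frameCoord u C.geomMatrix j ^ Fintype.card F = frameCoord u C.geomMatrix (pairPerm σ j) := by
  rw [pairPerm, ← frameCoord_pairIndex hu.1 _ (σ.injective.ne (Fin.succ_ne_zero j).symm),
    frameCoord, frobenius_dot]
  have : (fun i => (u 0 + u j.succ) i ^ Fintype.card F) = u (σ 0) + u (σ j.succ) := by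
    ext i
    rw [Pi.add_apply, Pi.add_apply, ← hσ, ← hσ]
    exact map_add (FiniteField.frobeniusAlgHom F (AlgebraicClosure F)) _ _
  rw [this]

/-- Frobenius permutes the common points, so it permutes the frame vectors up to a common scalar
`e`, by uniqueness of the normalisation. The scalar is removed by a rescaling. -/
theorem exists_twisted_frame (h2 : (2 : AlgebraicClosure F) ≠ 0) {A B : Conic F}
    (h : (A, B) ∈ smoothPairs F) :
    ∃ (σ : Equiv.Perm (Fin 4)) (u : Fin 4 → Fin 3 → AlgebraicClosure F), IsFrame u ∧
      IsTwisted σ u ∧ A ∈ framePencil u ∧ B ∈ framePencil u := by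
  obtain ⟨u, hu, hA, hB⟩ := exists_frame h2 (geomMatrix_isSymm A) (geomMatrix_isSymm B)
    ((isSmooth_iff A).mp h.1) ((transversal_iff A B).mp h.2.2)
  have hAB' : A ≠ B := ((mem_smoothPairs_iff h2 hu hA hB).mp h).2.2
  let φ := FiniteField.frobeniusAlgHom F (AlgebraicClosure F)
  have hφ : ∀ z, φ z = z ^ Fintype.card F := fun _ => rfl
  have hφinj : ∀ {a b}, φ a = φ b → a = b := fun h => φ.toRingHom.injective h
  have hq : Fintype.card F ≠ 0 := Fintype.card_ne_zero
  have hfr : ∀ i, ∃ i', ∃ c : AlgebraicClosure F, c • u i' = fun j => φ (u i j) := by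
    intro i
    apply exists_smul_frame h2 hu (geomMatrix_isSymm A) (geomMatrix_isSymm B) hA hB
      (frameMinor_ne_zero h2 hu hA hB hAB')
    · exact (frobenius_dot A _ _).symm.trans (by rw [hA, zero_pow hq])
    · exact (frobenius_dot B _ _).symm.trans (by rw [hB, zero_pow hq])
  choose σ c hc using hfr
  have hσ : Function.Injective σ := by
    intro i j hij
    by_contra hne
    have hci : c i ≠ 0 := by
      intro h0
      apply hu.ne_zero h2 i
      ext l
      have := congrFun (hc i) l
      rw [h0, zero_smul, Pi.zero_apply] at this
      exact (map_eq_zero φ).mp this.symm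
    -- A `q`-th root of the scalar relating the Frobenius images relates `u i` and `u j` themselves,
    -- against general position.
    obtain ⟨d, hd⟩ := IsAlgClosed.exists_pow_nat_eq (c j / c i) (Fintype.card_pos (α := F))
    refine hu.not_smul h2 hne d ?_
    ext l
    apply hφinj
    rw [Pi.smul_apply, smul_eq_mul, map_mul, hφ d, hd]
    have h1 := congrFun (hc i) l
    have h3 := congrFun (hc j) l
    rw [← h1, ← h3, ← hij]
    simp only [Pi.smul_apply, smul_eq_mul]
    field_simp
  let σ' : Equiv.Perm (Fin 4) := Equiv.ofBijective σ (Finite.injective_iff_bijective.mp hσ)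
  obtain ⟨e, he⟩ := frame_smul_unique h2 (hu.comp h2 σ') (v := fun i j => φ (u i j))
    (by
      ext j
      have := congrFun hu.1 j
      simp only [Finset.sum_apply, Pi.zero_apply] at this ⊢
      rw [← map_sum, this, map_zero]) (fun i => ⟨c i, hc i⟩)
  have he0 : e ≠ 0 := by
    rintro rfl
    apply hu.ne_zero h2 0
    ext l
    have := congrFun (he 0) l
    rw [zero_smul, Pi.zero_apply] at this
    exact (map_eq_zero φ).mp this.symm
  -- With `d ^ (q - 1) = e⁻¹` one gets `d ^ q * e = d`, so the frame `d • u` is permuted exactly.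
  obtain ⟨d, hd⟩ := IsAlgClosed.exists_pow_nat_eq (e⁻¹)
    (Nat.sub_pos_of_lt (Fintype.one_lt_card (α := F)))
  have hd0 : d ≠ 0 := by
    rintro rfl
    rw [zero_pow (Nat.sub_pos_of_lt Fintype.one_lt_card).ne'] at hd
    exact inv_ne_zero he0 hd.symm
  refine ⟨σ', fun i => d • u i, hu.smul hd0, fun i j => ?_, fun i => ?_, fun i => ?_⟩
  · have h1 := congrFun (he i) j
    simp only [Pi.smul_apply, smul_eq_mul, Function.comp_apply, hφ] at h1 ⊢
    rw [mul_pow, ← h1, ← Nat.sub_add_cancel (Fintype.one_lt_card (α := F)).le, pow_add, pow_one,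
      hd]
    field_simp
  · rw [mulVec_smul, smul_dotProduct, dotProduct_smul, hA]; simp
  · rw [mulVec_smul, smul_dotProduct, dotProduct_smul, hB]; simp

end Frobenius

/-! ### Parametrising a pencil and its singular and tetragon members -/

section PencilMembers

variable {F : Type*} [Field F] {u : Fin 4 → Fin 3 → AlgebraicClosure F} {A B C : Conic F}

theorem geomMatrix_mk (M : symMatrices F) (hM : M ≠ 0) :
    ∃ c : AlgebraicClosure F, c ≠ 0 ∧ Conic.geomMatrix (Projectivization.mk F M hM) =
      c • (M : Matrix (Fin 3) (Fin 3) F).map (algebraMap F (AlgebraicClosure F)) := by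
  obtain ⟨c, hc⟩ := Projectivization.exists_smul_eq_mk_rep F M hM
  refine ⟨algebraMap F _ c, by simp, ?_⟩
  ext i j
  rw [Conic.geomMatrix, ← hc]
  simp [Units.smul_def, -algebraMap_smul]

theorem conic_eq_of_rep {y : F} (h : A.rep = y • B.rep) : A = B := by
  rw [← A.mk_rep, ← B.mk_rep, Projectivization.mk_eq_mk_iff']
  exact ⟨y, h.symm⟩

theorem mem_pencil_iff : C ∈ A.pencil B ↔ ∃ y z : F, C.rep = y • A.rep + z • B.rep := by
  rw [Conic.pencil, Set.mem_ofPred_eq, C.submodule_eq, A.submodule_eq, B.submodule_eq,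
    Submodule.span_singleton_le_iff_mem, Submodule.mem_sup]
  constructor
  · rintro ⟨a, ha, b, hb, h⟩
    obtain ⟨y, rfl⟩ := Submodule.mem_span_singleton.mp ha
    obtain ⟨z, rfl⟩ := Submodule.mem_span_singleton.mp hb
    exact ⟨y, z, h.symm⟩
  · rintro ⟨y, z, h⟩
    exact ⟨_, Submodule.smul_mem _ _ (Submodule.mem_span_singleton_self _), _,
      Submodule.smul_mem _ _ (Submodule.mem_span_singleton_self _), h.symm⟩

theorem geomMatrix_of_rep {y z : F} (h : C.rep = y • A.rep + z • B.rep) :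
    C.geomMatrix = algebraMap F (AlgebraicClosure F) y • A.geomMatrix
      + algebraMap F (AlgebraicClosure F) z • B.geomMatrix := by
  ext i j
  rw [Conic.geomMatrix, h]
  simp [Conic.geomMatrix, -algebraMap_smul]

theorem mem_framePencil_of_rep {y z : F} (hA : A ∈ framePencil u) (hB : B ∈ framePencil u)
    (h : C.rep = y • A.rep + z • B.rep) : C ∈ framePencil u := by
  intro i
  rw [geomMatrix_of_rep h, add_mulVec, smul_mulVec, smul_mulVec, dotProduct_add, dotProduct_smul,
    dotProduct_smul, hA i, hB i]
  simp

/-- Two conics of the pencil through a frame generate it over the algebraic closure. -/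
theorem exists_geomMatrix_eq (h2 : (2 : AlgebraicClosure F) ≠ 0) (hu : IsFrame u)
    (hA : A ∈ framePencil u) (hB : B ∈ framePencil u) (hAB : A ≠ B) (hC : C ∈ framePencil u) :
    ∃ y z : AlgebraicClosure F, C.geomMatrix = y • A.geomMatrix + z • B.geomMatrix := by
  have hm := frameMinor_ne_zero h2 hu hA hB hAB
  obtain ⟨D, hD⟩ : ∃ D, D = frameMinor u A.geomMatrix B.geomMatrix := ⟨_, rfl⟩
  obtain ⟨y, hy⟩ : ∃ y, y * D = frameMinor u C.geomMatrix B.geomMatrix :=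
    ⟨_, div_mul_cancel₀ _ (hD ▸ hm)⟩
  obtain ⟨z, hz⟩ : ∃ z, z * D = frameMinor u A.geomMatrix C.geomMatrix :=
    ⟨_, div_mul_cancel₀ _ (hD ▸ hm)⟩
  refine ⟨y, z, ?_⟩
  have sA := frameCoord_sum h2 hu.1 (geomMatrix_isSymm A) hA
  have sB := frameCoord_sum h2 hu.1 (geomMatrix_isSymm B) hB
  have sC := frameCoord_sum h2 hu.1 (geomMatrix_isSymm C) hC
  have key : C.geomMatrix + (-y) • A.geomMatrix + (-z) • B.geomMatrix = 0 := by
    refine eq_zero_of_frameCoord_eq_zero h2 hu (((geomMatrix_isSymm C).add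
      ((geomMatrix_isSymm A).smul _)).add ((geomMatrix_isSymm B).smul _)) ?_ ?_
    · intro i
      rw [add_mulVec, add_mulVec, smul_mulVec, smul_mulVec, dotProduct_add, dotProduct_add,
        dotProduct_smul, dotProduct_smul, hA i, hB i, hC i]
      simp
    · intro j
      rw [frameCoord_add, frameCoord_add, frameCoord_smul, frameCoord_smul]
      rw [← hD] at hm
      refine (mul_eq_zero.mp (?_ : D * _ = 0)).resolve_left hm
      rw [frameMinor] at hy hz hD
      have e0 : D * (frameCoord u C.geomMatrix 0 + -y * frameCoord u A.geomMatrix 0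
          + -z * frameCoord u B.geomMatrix 0) = 0 := by
        linear_combination -frameCoord u A.geomMatrix 0 * hy - frameCoord u B.geomMatrix 0 * hz
          + frameCoord u C.geomMatrix 0 * hD
      have e1 : D * (frameCoord u C.geomMatrix 1 + -y * frameCoord u A.geomMatrix 1
          + -z * frameCoord u B.geomMatrix 1) = 0 := by
        linear_combination -frameCoord u A.geomMatrix 1 * hy - frameCoord u B.geomMatrix 1 * hz
          + frameCoord u C.geomMatrix 1 * hD
      fin_cases j
      · exact e0
      · exact e1
      · simp only [Fin.reduceFinMk]
        linear_combination D * (sC - y * sA - z * sB) - e0 - e1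
  rw [add_assoc, add_eq_zero_iff_eq_neg] at key
  rw [key]; simp only [neg_smul, neg_add, neg_neg]

theorem rep_add_smul_ne_zero (hCB : C ≠ B) (x : F) : C.rep + x • B.rep ≠ 0 := by
  intro h
  refine hCB (conic_eq_of_rep (y := -x) ?_)
  exact (eq_neg_of_add_eq_zero_left h).trans (neg_smul x B.rep).symm

/-- The ratio of the diagonal coordinates of two conics. -/
noncomputable def ratio (u : Fin 4 → Fin 3 → AlgebraicClosure F) (C B : Conic F) (j : Fin 3) :
    AlgebraicClosure F :=
  frameCoord u C.geomMatrix j / frameCoord u B.geomMatrix j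

/-- The coordinates of each conic sum to zero, so all the `2 × 2` minors agree up to sign; one
equality of ratios would make the conics proportional. -/
theorem ratio_injective (h2 : (2 : AlgebraicClosure F) ≠ 0) (hu : IsFrame u) (hCB : C ≠ B)
    (hB : B ∈ framePencil u) (hC : C ∈ framePencil u)
    (hb : ∀ j, frameCoord u B.geomMatrix j ≠ 0) : Function.Injective (ratio u C B) := by
  have hm := frameMinor_ne_zero h2 hu hC hB hCB
  have sB := frameCoord_sum h2 hu.1 (geomMatrix_isSymm B) hB
  have sC := frameCoord_sum h2 hu.1 (geomMatrix_isSymm C) hC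
  rw [frameMinor] at hm
  intro i j hij
  rw [ratio, ratio, div_eq_div_iff (hb i) (hb j)] at hij
  by_contra hne
  apply hm
  fin_cases i <;> fin_cases j <;> first | exact absurd rfl hne | skip
  all_goals simp only [Fin.zero_eta, Fin.mk_one, Fin.reduceFinMk] at hij
  all_goals grind

/-- At most three conics of the pencil have two equal diagonal coordinates. -/
theorem ncard_not_injective_le (h2 : (2 : AlgebraicClosure F) ≠ 0) (hu : IsFrame u) :
    {B | B ∈ framePencil u ∧ ¬ Function.Injective (frameCoord u B.geomMatrix)}.ncard ≤ 3 := by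
  have hcase : ∀ B : Conic F, ¬ Function.Injective (frameCoord u B.geomMatrix) →
      ∃ i : Fin 3, frameCoord u B.geomMatrix (i + 1) = frameCoord u B.geomMatrix (i + 2) := by
    intro B hB
    by_contra! h
    have h0 := h 0
    have h1 := h 1
    have h3 := h 2
    simp only [Fin.reduceAdd, zero_add] at h0 h1 h3
    apply hB
    intro i j hij
    fin_cases i <;> fin_cases j <;> first | rfl | skip
    all_goals simp only [Fin.zero_eta, Fin.mk_one, Fin.reduceFinMk] at hij
    all_goals grind
  choose! f hf using hcase
  have h3 : (Set.univ : Set (Fin 3)).ncard ≤ 3 := by simp [Set.ncard_univ]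
  refine le_trans ?_ h3
  refine Set.ncard_le_ncard_of_injOn f (fun _ _ => Set.mem_univ _) ?_ (Set.toFinite _)
  rintro A ⟨hA, hA'⟩ B ⟨hB, hB'⟩ hAB
  by_contra hne
  apply frameMinor_ne_zero h2 hu hA hB hne
  have sA := frameCoord_sum h2 hu.1 (geomMatrix_isSymm A) hA
  have sB := frameCoord_sum h2 hu.1 (geomMatrix_isSymm B) hB
  have eA := hf A hA'
  have eB := hf B hB'
  rw [← hAB] at eB
  rw [frameMinor]
  generalize f A = i at *
  generalize frameCoord u A.geomMatrix = a at *
  generalize frameCoord u B.geomMatrix = b at *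
  fin_cases i <;> simp only [Fin.zero_eta, Fin.mk_one, Fin.reduceFinMk, Fin.reduceAdd,
    zero_add] at eA eB <;> grind

/-- The member `C + x B` of a pencil. -/
noncomputable def member (hCB : C ≠ B) (x : F) : Conic F :=
  Projectivization.mk F (C.rep + x • B.rep) (rep_add_smul_ne_zero hCB x)

theorem geomMatrix_member (hCB : C ≠ B) (x : F) :
    ∃ c : AlgebraicClosure F, c ≠ 0 ∧ (member hCB x).geomMatrix =
      c • (C.geomMatrix + algebraMap F (AlgebraicClosure F) x • B.geomMatrix) := by
  obtain ⟨c, hc, h⟩ := geomMatrix_mk _ (rep_add_smul_ne_zero hCB x)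
  refine ⟨c, hc, ?_⟩
  rw [member, h]
  congr 1
  ext i j
  simp [Conic.geomMatrix, -algebraMap_smul]

theorem member_mem (hCB : C ≠ B) (hB : B ∈ framePencil u) (hC : C ∈ framePencil u) (x : F) :
    member hCB x ∈ framePencil u := by
  intro i
  obtain ⟨c, -, h⟩ := geomMatrix_member hCB x
  rw [h, smul_mulVec, add_mulVec, smul_mulVec, dotProduct_smul, dotProduct_add, dotProduct_smul,
    hB i, hC i]
  simp

theorem frameCoord_member (u : Fin 4 → Fin 3 → AlgebraicClosure F) (hCB : C ≠ B) (x : F) :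
    ∃ c : AlgebraicClosure F, c ≠ 0 ∧ ∀ j, frameCoord u (member hCB x).geomMatrix j =
      c * (frameCoord u C.geomMatrix j +
        algebraMap F (AlgebraicClosure F) x * frameCoord u B.geomMatrix j) := by
  obtain ⟨c, hc, h⟩ := geomMatrix_member hCB x
  refine ⟨c, hc, fun j => ?_⟩
  rw [h, frameCoord_smul, frameCoord_add, frameCoord_smul]

theorem member_ne (h2 : (2 : AlgebraicClosure F) ≠ 0) (hu : IsFrame u) (hCB : C ≠ B)
    (hB : B ∈ framePencil u) (hC : C ∈ framePencil u) (x : F) : member hCB x ≠ B := by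
  intro h
  have hm := frameMinor_ne_zero h2 hu hC hB hCB
  obtain ⟨c, hc, hx⟩ := frameCoord_member u hCB x
  rw [h] at hx
  refine mul_ne_zero hc hm ?_
  rw [frameMinor]
  linear_combination frameCoord u B.geomMatrix 0 * hx 1 - frameCoord u B.geomMatrix 1 * hx 0

theorem member_injective (h2 : (2 : AlgebraicClosure F) ≠ 0) (hu : IsFrame u) (hCB : C ≠ B)
    (hB : B ∈ framePencil u) (hC : C ∈ framePencil u) : Function.Injective (member hCB) := by
  intro x y h
  have hm := frameMinor_ne_zero h2 hu hC hB hCB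
  obtain ⟨c, hc, hx⟩ := frameCoord_member u hCB x
  obtain ⟨d, hd, hy⟩ := frameCoord_member u hCB y
  rw [h] at hx
  have h0 := (hx 0).symm.trans (hy 0)
  have h1 := (hx 1).symm.trans (hy 1)
  rw [frameMinor] at hm
  have hcd : c = d := by
    apply mul_right_cancel₀ hm
    linear_combination frameCoord u B.geomMatrix 1 * h0 - frameCoord u B.geomMatrix 0 * h1
  subst hcd
  apply (algebraMap F (AlgebraicClosure F)).injective
  apply mul_left_cancel₀ hc
  apply mul_right_cancel₀ hm
  linear_combination frameCoord u C.geomMatrix 0 * h1 - frameCoord u C.geomMatrix 1 * h0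

theorem isSmooth_member_iff (h2 : (2 : AlgebraicClosure F) ≠ 0) (hu : IsFrame u) (hCB : C ≠ B)
    (hB : B ∈ framePencil u) (hC : C ∈ framePencil u)
    (hb : ∀ j, frameCoord u B.geomMatrix j ≠ 0) (x : F) :
    (member hCB x).IsSmooth ↔
      ¬ ∃ j, algebraMap F (AlgebraicClosure F) x = -ratio u C B j := by
  rw [isSmooth_iff_frameCoord h2 hu (member_mem hCB hB hC x), not_exists]
  obtain ⟨c, hc, hx⟩ := frameCoord_member u hCB x
  refine forall_congr' fun j => not_congr ?_
  have := hb j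
  rw [hx, mul_eq_zero, or_iff_right hc, ratio]
  constructor
  · intro h
    field_simp
    linear_combination h
  · intro h
    rw [h]
    field_simp
    ring

/-- The diagonal ratios of `C + x B` and `B` are `r j + x` up to a common factor, and `2 * (r j + x)
= ∑ i, r i + 3 * x` solves to the stated value of `x`. -/
theorem tetragon_member_iff (h2 : (2 : AlgebraicClosure F) ≠ 0) (hu : IsFrame u) (hCB : C ≠ B)
    (hB : B ∈ framePencil u) (hC : C ∈ framePencil u)
    (hb : ∀ j, frameCoord u B.geomMatrix j ≠ 0) (x : F) (hx : (member hCB x).IsSmooth) :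
    NGonCondition 4 (member hCB x) B ↔ ∃ j, algebraMap F (AlgebraicClosure F) x =
      2 * ratio u C B j - ∑ i, ratio u C B i := by
  have hmem := member_mem hCB hB hC x
  have ha := (isSmooth_iff_frameCoord h2 hu hmem).mp hx
  obtain ⟨c, hc, hcoord⟩ := frameCoord_member u hCB x
  have hr : ∀ j, frameCoord u (member hCB x).geomMatrix j / frameCoord u B.geomMatrix j
      = c * (ratio u C B j + algebraMap F (AlgebraicClosure F) x) := by
    intro j
    have := hb j
    rw [hcoord, ratio]
    field_simp
  have hinj := ratio_injective h2 hu hCB hB hC hb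
  rw [tetragon_iff h2 hu.2 (frameMatrix_diagonal h2 hu.1 (geomMatrix_isSymm _) hmem) ha
    (frameMatrix_diagonal h2 hu.1 (geomMatrix_isSymm _) hB) hb ?_]
  · refine exists_congr fun j => ?_
    simp only [hr, Fin.sum_univ_three]
    constructor
    · intro h
      apply mul_left_cancel₀ hc
      linear_combination -h
    · intro h
      linear_combination -c * h
  · intro i j hij
    simp only [hr] at hij
    exact hinj (add_right_cancel (mul_left_cancel₀ hc hij))

variable [Fintype F]

/-- The coefficients over the closure are unique and both conics are fixed by Frobenius, so the
coefficients are fixed too and lie in `F`. -/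
theorem exists_rep_eq (h2 : (2 : AlgebraicClosure F) ≠ 0) (hu : IsFrame u)
    (hA : A ∈ framePencil u) (hB : B ∈ framePencil u) (hAB : A ≠ B) (hC : C ∈ framePencil u) :
    ∃ y z : F, C.rep = y • A.rep + z • B.rep := by
  obtain ⟨y, z, hyz⟩ := exists_geomMatrix_eq h2 hu hA hB hAB hC
  have hm := frameMinor_ne_zero h2 hu hA hB hAB
  let φ := FiniteField.frobeniusAlgHom F (AlgebraicClosure F)
  have hφ : ∀ z, φ z = z ^ Fintype.card F := fun _ => rfl
  have hφC : ∀ (C : Conic F) i j, φ (C.geomMatrix i j) = C.geomMatrix i j := fun C i j =>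
    AlgHom.commutes φ _
  have h1 : C.geomMatrix = φ y • A.geomMatrix + φ z • B.geomMatrix := by
    ext i j
    have := congrArg φ (congrFun (congrFun hyz i) j)
    simpa [hφC] using this
  have hcoord : ∀ j, (φ y - y) * frameCoord u A.geomMatrix j
      + (φ z - z) * frameCoord u B.geomMatrix j = 0 := by
    intro j
    have e1 := congrArg (fun M => frameCoord u M j) h1
    have e2 := congrArg (fun M => frameCoord u M j) hyz
    simp only [frameCoord_add, frameCoord_smul] at e1 e2
    linear_combination e2 - e1
  rw [frameMinor] at hm
  have hy : φ y = y := by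
    rw [← sub_eq_zero]
    refine (mul_eq_zero.mp ?_).resolve_right hm
    linear_combination frameCoord u B.geomMatrix 1 * hcoord 0
      - frameCoord u B.geomMatrix 0 * hcoord 1
  have hz : φ z = z := by
    rw [← sub_eq_zero]
    refine (mul_eq_zero.mp ?_).resolve_right hm
    linear_combination frameCoord u A.geomMatrix 0 * hcoord 1
      - frameCoord u A.geomMatrix 1 * hcoord 0
  obtain ⟨y, rfl⟩ := exists_algebraMap_eq_of_pow_card hy
  obtain ⟨z, rfl⟩ := exists_algebraMap_eq_of_pow_card hz
  refine ⟨y, z, ?_⟩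
  ext i j
  apply (algebraMap F (AlgebraicClosure F)).injective
  have := congrFun (congrFun hyz i) j
  simpa [Conic.geomMatrix, -algebraMap_smul] using this

theorem pencil_eq_framePencil (h2 : (2 : AlgebraicClosure F) ≠ 0) (hu : IsFrame u)
    (hA : A ∈ framePencil u) (hB : B ∈ framePencil u) (hAB : A ≠ B) :
    A.pencil B = framePencil u := by
  ext C
  rw [mem_pencil_iff]
  exact ⟨fun ⟨_, _, h⟩ => mem_framePencil_of_rep hA hB h, exists_rep_eq h2 hu hA hB hAB⟩

theorem geomFrobenius_mk {x y : Fin 3 → AlgebraicClosure F} (hx : x ≠ 0) (hy : y ≠ 0)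
    (h : ∀ j, x j ^ Fintype.card F = y j) :
    geomFrobenius (Projectivization.mk (AlgebraicClosure F) x hx) =
      Projectivization.mk (AlgebraicClosure F) y hy := by
  rw [geomFrobenius, Projectivization.mk_eq_mk_iff']
  obtain ⟨c, hc⟩ := Projectivization.exists_smul_eq_mk_rep (AlgebraicClosure F) x hx
  refine ⟨(c : AlgebraicClosure F) ^ Fintype.card F, ?_⟩
  ext j
  rw [← hc, Pi.smul_apply, Units.smul_def, Pi.smul_apply, ← h]
  simp [mul_pow]

/-- Two labellings of the common points differ by a permutation that conjugates one Frobenius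
permutation into the other, so the cycle type does not depend on the labelling. -/
theorem hasIntersectionType_iff (h2 : (2 : AlgebraicClosure F) ≠ 0) (hu : IsFrame u)
    {σ : Equiv.Perm (Fin 4)} (hσ : IsTwisted σ u)
    (hA : A ∈ framePencil u) (hB : B ∈ framePencil u) (hAB : A ≠ B) (τ : Multiset ℕ) :
    HasIntersectionType A B τ ↔ σ.partition.parts = τ := by
  set p : Fin 4 → GeomPoint F := fun i =>
    Projectivization.mk (AlgebraicClosure F) (u i) (hu.ne_zero h2 i) with hp
  have hpinj : Function.Injective p := by
    intro i j hij
    by_contra hne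
    obtain ⟨c, hc⟩ := (Projectivization.mk_eq_mk_iff' _ _ _ _ _).mp hij
    exact hu.not_smul h2 (Ne.symm hne) c hc
  have hpfr : ∀ i, geomFrobenius (p i) = p (σ i) := fun i =>
    geomFrobenius_mk _ _ (hσ i)
  have hpr := inter_eq_frame h2 hu hA hB hAB
  constructor
  · rintro ⟨p', σ', hinj', hr', hfr', rfl⟩
    have hmem : ∀ i, ∃ j, p j = p' i := fun i => (hpr _).mp ((hr' _).mpr ⟨i, rfl⟩)
    choose π hπ using hmem
    have hπinj : Function.Injective π := fun i j hij => hinj' (by rw [← hπ, ← hπ, hij])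
    let π' : Equiv.Perm (Fin 4) := Equiv.ofBijective π (Finite.injective_iff_bijective.mp hπinj)
    have hπ' : ∀ i, p (π' i) = p' i := hπ
    have hcomm : π' * σ' = σ * π' := by
      ext1 i
      apply hpinj
      rw [Equiv.Perm.mul_apply, Equiv.Perm.mul_apply, hπ', ← hfr', ← hpfr, hπ']
    congr 1
    rw [← Equiv.Perm.partition_eq_of_isConj, isConj_iff]
    exact ⟨π'⁻¹, by rw [inv_inv, mul_assoc, ← hcomm, inv_mul_cancel_left]⟩
  · intro h
    exact ⟨p, σ, hpinj, hpr, hpfr, h⟩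

end PencilMembers

/-! ### Counting pairs inside one pencil -/

section Counting

/-- The number of pairs of opposite sides of a quadrangle fixed by a permutation of its points. -/
def fixedPairs (σ : Equiv.Perm (Fin 4)) : ℕ := (Finset.univ.filter fun j => pairPerm σ j = j).card

theorem fixedPairs_le (σ : Equiv.Perm (Fin 4)) : fixedPairs σ ≤ 3 :=
  (Finset.card_le_univ _).trans (by simp)

theorem ncard_eq_sum_fiber {α β : Type*} [Finite α] [Fintype β] (S : Set (α × β)) :
    S.ncard = ∑ b, {a | (a, b) ∈ S}.ncard := by
  have e : S ≃ Σ b, {a | (a, b) ∈ S} :=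
    { toFun := fun x => ⟨x.1.2, ⟨x.1.1, x.2⟩⟩
      invFun := fun y => ⟨(y.2.1, y.1), y.2.2⟩
      left_inv := fun _ => rfl
      right_inv := fun _ => rfl }
  rw [← Nat.card_coe_set_eq, Nat.card_congr e, Nat.card_sigma]
  rfl

variable {F : Type*} [Field F] [Fintype F]

/-- The rational values among three elements permuted by Frobenius. -/
theorem ncard_rational {σ : Equiv.Perm (Fin 4)} {m : Fin 3 → AlgebraicClosure F}
    (hm : Function.Injective m) (hσ : ∀ j, m j ^ Fintype.card F = m (pairPerm σ j)) :
    {x : F | ∃ j, algebraMap F (AlgebraicClosure F) x = m j}.ncard = fixedPairs σ := by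
  classical
  have hx : ∀ j, pairPerm σ j = j → ∃ x : F, algebraMap F (AlgebraicClosure F) x = m j :=
    fun j hj => exists_algebraMap_eq_of_pow_card (by rw [hσ, hj])
  choose! x hx using hx
  have : {x : F | ∃ j, algebraMap F (AlgebraicClosure F) x = m j} =
      x '' {j | pairPerm σ j = j} := by
    ext y
    constructor
    · rintro ⟨j, hj⟩
      have hfix : pairPerm σ j = j := by
        apply hm
        rw [← hσ, ← hj, ← map_pow, FiniteField.pow_card]
      exact ⟨j, hfix, (algebraMap F (AlgebraicClosure F)).injective (by rw [hx j hfix, hj])⟩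
    · rintro ⟨j, hj, rfl⟩
      exact ⟨j, hx j hj⟩
  rw [this, Set.InjOn.ncard_image, fixedPairs, ← Set.ncard_coe_finset]
  · congr 1
    ext j
    simp
  · intro i hi j hj hij
    apply hm
    rw [← hx i hi, ← hx j hj, hij]

variable {u : Fin 4 → Fin 3 → AlgebraicClosure F} {σ : Equiv.Perm (Fin 4)} {A B C : Conic F}

theorem exists_member_eq (h2 : (2 : AlgebraicClosure F) ≠ 0) (hu : IsFrame u) (hCB : C ≠ B)
    (hB : B ∈ framePencil u) (hC : C ∈ framePencil u) (hA : A ∈ framePencil u) (hAB : A ≠ B) :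
    ∃ x, member hCB x = A := by
  obtain ⟨y, z, h⟩ := exists_rep_eq h2 hu hC hB hCB hA
  have hy : y ≠ 0 := by
    rintro rfl
    exact hAB (conic_eq_of_rep (y := z) (by rw [h, zero_smul, zero_add]))
  refine ⟨z / y, ?_⟩
  conv_rhs => rw [← A.mk_rep]
  rw [member, Projectivization.mk_eq_mk_iff']
  refine ⟨y⁻¹, ?_⟩
  rw [h, smul_add, smul_smul, smul_smul, inv_mul_cancel₀ hy, one_smul, div_eq_inv_mul]

/-- The other members of a pencil with a given property, in terms of their parameters. -/
theorem ncard_members (h2 : (2 : AlgebraicClosure F) ≠ 0) (hu : IsFrame u) (hCB : C ≠ B)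
    (hB : B ∈ framePencil u) (hC : C ∈ framePencil u) (p : Conic F → Prop) :
    {A | A ∈ framePencil u ∧ A ≠ B ∧ p A}.ncard = {x | p (member hCB x)}.ncard := by
  rw [← Set.ncard_image_of_injective _ (member_injective h2 hu hCB hB hC)]
  congr 1
  ext A
  constructor
  · rintro ⟨hA, hAB, hpA⟩
    obtain ⟨x, rfl⟩ := exists_member_eq h2 hu hCB hB hC hA hAB
    exact ⟨x, hpA, rfl⟩
  · rintro ⟨x, hx, rfl⟩
    exact ⟨member_mem hCB hB hC x, member_ne h2 hu hCB hB hC x, hx⟩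

theorem ratio_pow_card (hu : IsFrame u) (hσ : IsTwisted σ u) (C B : Conic F) (j : Fin 3) :
    ratio u C B j ^ Fintype.card F = ratio u C B (pairPerm σ j) := by
  rw [ratio, div_pow, frameCoord_pow_card hu hσ, frameCoord_pow_card hu hσ, ratio]

/-- The excluded parameters are the values `-ratio u C B j` lying in `F`, and Frobenius permutes
these through `pairPerm σ`. -/
theorem ncard_smooth_ne (h2 : (2 : AlgebraicClosure F) ≠ 0) (hu : IsFrame u) (hσ : IsTwisted σ u)
    (hCB : C ≠ B) (hB : B ∈ framePencil u) (hC : C ∈ framePencil u) (hBs : B.IsSmooth) :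
    {A | A ∈ framePencil u ∧ A ≠ B ∧ A.IsSmooth}.ncard + fixedPairs σ = Fintype.card F := by
  have hb := (isSmooth_iff_frameCoord h2 hu hB).mp hBs
  rw [ncard_members h2 hu hCB hB hC, ← ncard_rational (σ := σ) (m := fun j => -ratio u C B j)
    (neg_injective.comp (ratio_injective h2 hu hCB hB hC hb))]
  · simp only [isSmooth_member_iff h2 hu hCB hB hC hb]
    rw [add_comm, ← Nat.card_eq_fintype_card, ← Set.ncard_add_ncard_compl
      {x : F | ∃ j, algebraMap F (AlgebraicClosure F) x = -ratio u C B j}]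
    rfl
  · intro j
    rw [← ratio_pow_card hu hσ]
    exact map_neg (FiniteField.frobeniusAlgHom F (AlgebraicClosure F)) _

/-- The candidates are the parameters `2 * r j - ∑ i, r i` in `F`; some may give singular conics,
which is impossible if the coordinates of `B` are distinct. -/
theorem ncard_tetragon (h2 : (2 : AlgebraicClosure F) ≠ 0) (hu : IsFrame u) (hσ : IsTwisted σ u)
    (hCB : C ≠ B) (hB : B ∈ framePencil u) (hC : C ∈ framePencil u) (hBs : B.IsSmooth) :
    {A | A ∈ framePencil u ∧ A ≠ B ∧ A.IsSmooth ∧ NGonCondition 4 A B}.ncard ≤ fixedPairs σ ∧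
    (Function.Injective (frameCoord u B.geomMatrix) →
      {A | A ∈ framePencil u ∧ A ≠ B ∧ A.IsSmooth ∧ NGonCondition 4 A B}.ncard =
        fixedPairs σ) := by
  have hb := (isSmooth_iff_frameCoord h2 hu hB).mp hBs
  have hinj := ratio_injective h2 hu hCB hB hC hb
  have hr := ncard_rational (σ := σ)
    (m := fun j => 2 * ratio u C B j - ∑ i, ratio u C B i)
    (fun i j hij => hinj (mul_left_cancel₀ h2 (sub_left_injective hij))) (by
      intro j
      let φ := FiniteField.frobeniusAlgHom F (AlgebraicClosure F)
      have hφ : ∀ j, φ (ratio u C B j) = ratio u C B (pairPerm σ j) := ratio_pow_card hu hσ C B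
      change φ _ = _
      have hbij : Function.Bijective (pairPerm σ) := by
        apply Finite.injective_iff_bijective.mp
        intro i j hij
        apply hinj
        apply φ.toRingHom.injective
        exact (hφ i).trans ((congrArg _ hij).trans (hφ j).symm)
      rw [map_sub, map_mul, map_ofNat, hφ, map_sum]
      simp only [hφ]
      rw [hbij.sum_comp (ratio u C B)])
  rw [ncard_members h2 hu hCB hB hC]
  have hset : {x : F | (member hCB x).IsSmooth ∧ NGonCondition 4 (member hCB x) B} =
      {x : F | (member hCB x).IsSmooth} ∩ {x : F | ∃ j, algebraMap F (AlgebraicClosure F) x =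
        2 * ratio u C B j - ∑ i, ratio u C B i} := by
    ext x
    exact and_congr_right fun hx => tetragon_member_iff h2 hu hCB hB hC hb x hx
  rw [hset]
  refine ⟨?_, fun hgood => ?_⟩
  · rw [← hr]
    exact Set.ncard_le_ncard Set.inter_subset_right (Set.toFinite _)
  · rw [← hr]
    congr 1
    apply Set.inter_eq_right.mpr
    rintro x ⟨j, hj⟩
    rw [Set.mem_ofPred_eq, isSmooth_member_iff h2 hu hCB hB hC hb]
    -- A collision `2 * r j - ∑ r = -r i` with `i ≠ j` makes two ratios equal. With `i = j`, the
    -- relations `∑ b = 0` and `∑ r * b = 0` make the other two coordinates of `B` equal.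
    rintro ⟨i, hi⟩
    have sB := frameCoord_sum h2 hu.1 (geomMatrix_isSymm B) hB
    have sC := frameCoord_sum h2 hu.1 (geomMatrix_isSymm C) hC
    have hmul : ∀ j, frameCoord u C.geomMatrix j = ratio u C B j * frameCoord u B.geomMatrix j :=
      fun j => (div_mul_cancel₀ _ (hb j)).symm
    rw [hmul, hmul, hmul] at sC
    have hr01 := hinj.ne (show (0 : Fin 3) ≠ 1 by decide)
    have hr02 := hinj.ne (show (0 : Fin 3) ≠ 2 by decide)
    have hr12 := hinj.ne (show (1 : Fin 3) ≠ 2 by decide)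
    have hb01 := hgood.ne (show (0 : Fin 3) ≠ 1 by decide)
    have hb02 := hgood.ne (show (0 : Fin 3) ≠ 2 by decide)
    have hb12 := hgood.ne (show (1 : Fin 3) ≠ 2 by decide)
    have key := hj.symm.trans hi
    rw [Fin.sum_univ_three] at key
    clear hj hi hset hr hmul
    generalize ratio u C B = r at *
    generalize frameCoord u B.geomMatrix = b at *
    fin_cases i <;> fin_cases j <;> simp only [Fin.zero_eta, Fin.mk_one, Fin.reduceFinMk] at key
    · refine mul_ne_zero (sub_ne_zero.mpr hr12) (sub_ne_zero.mpr hb12) ?_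
      linear_combination 2 * sC - 2 * r 0 * sB + (b 1 + b 2) * key
    · exact hr12 (by linear_combination key)
    · exact hr12 (by linear_combination -key)
    · exact hr02 (by linear_combination key)
    · refine mul_ne_zero (sub_ne_zero.mpr hr02) (sub_ne_zero.mpr hb02) ?_
      linear_combination 2 * sC - 2 * r 1 * sB + (b 0 + b 2) * key
    · exact hr02 (by linear_combination -key)
    · exact hr01 (by linear_combination key)
    · exact hr01 (by linear_combination -key)
    · refine mul_ne_zero (sub_ne_zero.mpr hr01) (sub_ne_zero.mpr hb01) ?_
      linear_combination 2 * sC - 2 * r 2 * sB + (b 0 + b 1) * key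

/-- The number of smooth conics in the pencil. -/
theorem ncard_smooth (h2 : (2 : AlgebraicClosure F) ≠ 0) (hu : IsFrame u) (hσ : IsTwisted σ u)
    (hCB : C ≠ B) (hB : B ∈ framePencil u) (hC : C ∈ framePencil u) (hBs : B.IsSmooth) :
    {A | A ∈ framePencil u ∧ A.IsSmooth}.ncard + fixedPairs σ = Fintype.card F + 1 := by
  have h := ncard_smooth_ne h2 hu hσ hCB hB hC hBs
  have : {A | A ∈ framePencil u ∧ A.IsSmooth} =
      insert B {A | A ∈ framePencil u ∧ A ≠ B ∧ A.IsSmooth} := by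
    ext A
    constructor
    · rintro ⟨hA, hAs⟩
      by_cases hAB : A = B
      · exact .inl hAB
      · exact .inr ⟨hA, hAB, hAs⟩
    · rintro (rfl | ⟨hA, -, hAs⟩)
      · exact ⟨hB, hBs⟩
      · exact ⟨hA, hAs⟩
  rw [this, Set.ncard_insert_of_notMem (fun h => h.2.1 rfl) (Set.toFinite _)]
  omega

theorem ncard_smoothPairsIn (h2 : (2 : AlgebraicClosure F) ≠ 0) (hu : IsFrame u)
    (hσ : IsTwisted σ u) (hCB : C ≠ B) (hB : B ∈ framePencil u) (hC : C ∈ framePencil u)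
    (hBs : B.IsSmooth) :
    ((smoothPairsIn (framePencil u)).ncard : ℝ) =
      (Fintype.card F + 1 - fixedPairs σ) * (Fintype.card F - fixedPairs σ) := by
  classical
  have := Fintype.ofFinite (Conic F)
  have hn := ncard_smooth h2 hu hσ hCB hB hC hBs
  -- The second member `D` is fixed and the first one counted; any other conic `E` of the pencil may
  -- serve to parametrise it.
  have hfib : ∀ D : Conic F, {A | (A, D) ∈ smoothPairsIn (framePencil u)}.ncard =
      if D ∈ {A | A ∈ framePencil u ∧ A.IsSmooth} then Fintype.card F - fixedPairs σ else 0 := by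
    intro D
    split_ifs with hD
    · obtain ⟨E, hE, hED⟩ : ∃ E ∈ framePencil u, E ≠ D := by
        by_cases h : B = D
        · exact ⟨C, hC, by rwa [← h]⟩
        · exact ⟨B, hB, h⟩
      have h1 := ncard_smooth_ne h2 hu hσ hED hD.1 hE hD.2
      have h3 : {A | (A, D) ∈ smoothPairsIn (framePencil u)} =
          {A | A ∈ framePencil u ∧ A ≠ D ∧ A.IsSmooth} := by
        ext A
        constructor
        · rintro ⟨h, hA, -⟩
          have := (mem_smoothPairs_iff h2 hu hA hD.1).mp h
          exact ⟨hA, this.2.2, this.1⟩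
        · rintro ⟨hA, hAD, hAs⟩
          exact ⟨(mem_smoothPairs_iff h2 hu hA hD.1).mpr ⟨hAs, hD.2, hAD⟩, hA, hD.1⟩
      rw [h3]; omega
    · rw [Set.ncard_eq_zero]
      ext A
      simp only [Set.mem_ofPred_eq, Set.mem_empty_iff_false, iff_false]
      rintro ⟨h, hA, hD'⟩
      exact hD ⟨hD', h.2.1⟩
  have hle : fixedPairs σ ≤ Fintype.card F := by
    have := ncard_smooth_ne h2 hu hσ hCB hB hC hBs
    omega
  rw [ncard_eq_sum_fiber, Finset.sum_congr rfl (fun D _ => hfib D), ← Finset.sum_filter,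
    Finset.sum_const, ← Set.ncard_coe_finset, smul_eq_mul, Nat.cast_mul, Nat.cast_sub hle]
  congr 1
  have : ((Finset.univ.filter fun D => D ∈ {A | A ∈ framePencil u ∧ A.IsSmooth} :
      Finset (Conic F)) : Set (Conic F)) = {A | A ∈ framePencil u ∧ A.IsSmooth} := by
    ext; simp
  rw [this, eq_sub_iff_add_eq]
  exact_mod_cast hn

theorem ncard_tetragonPairsIn (h2 : (2 : AlgebraicClosure F) ≠ 0) (hu : IsFrame u)
    (hσ : IsTwisted σ u) (hCB : C ≠ B) (hB : B ∈ framePencil u) (hC : C ∈ framePencil u)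
    (hBs : B.IsSmooth) :
    ((ponceletPairs F 4 ∩ smoothPairsIn (framePencil u)).ncard : ℝ) ≤
      fixedPairs σ * (Fintype.card F + 1 - fixedPairs σ) ∧
    fixedPairs σ * (Fintype.card F + 1 - fixedPairs σ - 3 : ℝ) ≤
      ((ponceletPairs F 4 ∩ smoothPairsIn (framePencil u)).ncard : ℝ) := by
  classical
  have := Fintype.ofFinite (Conic F)
  have hn := ncard_smooth h2 hu hσ hCB hB hC hBs
  set T : Finset (Conic F) :=
    Finset.univ.filter fun D => D ∈ framePencil u ∧ D.IsSmooth with hT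
  have hTset : (T : Set (Conic F)) = {A | A ∈ framePencil u ∧ A.IsSmooth} := by
    ext; simp [hT]
  have hTcard : (T.card : ℝ) = Fintype.card F + 1 - fixedPairs σ := by
    rw [← Set.ncard_coe_finset, hTset, eq_sub_iff_add_eq]
    exact_mod_cast hn
  -- Second members with two equal coordinates may have fewer than `fixedPairs σ` partners; they
  -- account for the loss of `3` in the lower bound.
  set bad : Finset (Conic F) := Finset.univ.filter fun D => D ∈ framePencil u ∧
    ¬ Function.Injective (frameCoord u D.geomMatrix) with hbad
  have hbadcard : bad.card ≤ 3 := by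
    refine le_trans (le_of_eq ?_) (ncard_not_injective_le h2 hu)
    rw [← Set.ncard_coe_finset]
    congr 1
    ext; simp [hbad]
  set g : Conic F → ℕ := fun D =>
    {A | (A, D) ∈ ponceletPairs F 4 ∩ smoothPairsIn (framePencil u)}.ncard with hg
  have hg0 : ∀ D, D ∉ T → g D = 0 := by
    intro D hD
    rw [hg]
    simp only
    rw [Set.ncard_eq_zero]
    ext A
    simp only [Set.mem_ofPred_eq, Set.mem_empty_iff_false, iff_false]
    rintro ⟨-, h, hA, hD'⟩
    exact hD (by simpa [hT] using ⟨hD', h.2.1⟩)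
  have hgT : ∀ D ∈ T, g D ≤ fixedPairs σ ∧ (D ∉ bad → g D = fixedPairs σ) := by
    intro D hD
    have hD : D ∈ framePencil u ∧ D.IsSmooth := by simpa [hT] using hD
    obtain ⟨E, hE, hED⟩ : ∃ E ∈ framePencil u, E ≠ D := by
      by_cases h : B = D
      · exact ⟨C, hC, by rwa [← h]⟩
      · exact ⟨B, hB, h⟩
    have h1 := ncard_tetragon h2 hu hσ hED hD.1 hE hD.2
    have h3 : g D = {A | A ∈ framePencil u ∧ A ≠ D ∧ A.IsSmooth ∧ NGonCondition 4 A D}.ncard := by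
      rw [hg]
      simp only
      congr 1
      ext A
      constructor
      · rintro ⟨⟨-, hng⟩, h, hA, -⟩
        have := (mem_smoothPairs_iff h2 hu hA hD.1).mp h
        exact ⟨hA, this.2.2, this.1, hng⟩
      · rintro ⟨hA, hAD, hAs, hng⟩
        have := (mem_smoothPairs_iff h2 hu hA hD.1).mpr ⟨hAs, hD.2, hAD⟩
        exact ⟨⟨this, hng⟩, this, hA, hD.1⟩
    rw [h3]
    refine ⟨h1.1, fun hDb => h1.2 ?_⟩
    by_contra hni
    exact hDb (by simpa [hbad] using ⟨hD.1, hni⟩)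
  have hsum : (ponceletPairs F 4 ∩ smoothPairsIn (framePencil u)).ncard = ∑ D ∈ T, g D := by
    rw [ncard_eq_sum_fiber]
    exact (Finset.sum_subset (Finset.subset_univ T) fun D _ hD => hg0 D hD).symm
  rw [hsum, ← hTcard]
  constructor
  · have : ∑ D ∈ T, g D ≤ T.card * fixedPairs σ := by
      rw [← smul_eq_mul]
      exact Finset.sum_le_card_nsmul _ _ _ fun D hD => (hgT D hD).1
    rw [mul_comm]
    exact_mod_cast this
  · have h1 : ∑ D ∈ T \ bad, g D = (T \ bad).card * fixedPairs σ := by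
      rw [Finset.sum_const_nat]
      intro D hD
      rw [Finset.mem_sdiff] at hD
      exact (hgT D hD.1).2 hD.2
    have h3 : ∑ D ∈ T \ bad, g D ≤ ∑ D ∈ T, g D :=
      Finset.sum_le_sum_of_subset Finset.sdiff_subset
    have h4 : T.card ≤ (T \ bad).card + 3 := by
      have := Finset.le_card_sdiff bad T
      omega
    have h5 : (T.card : ℝ) - 3 ≤ (T \ bad).card := by
      rw [sub_le_iff_le_add]; exact_mod_cast h4
    calc (fixedPairs σ : ℝ) * (T.card - 3) ≤ fixedPairs σ * (T \ bad).card := by gcongr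
      _ = ((∑ D ∈ T \ bad, g D : ℕ) : ℝ) := by rw [h1]; push_cast; ring
      _ ≤ _ := by exact_mod_cast h3

end Counting

/-! ### Cycle types in the symmetric group on four points -/

section PermutationsOfFour

theorem partition_parts_cases : ∀ σ : Equiv.Perm (Fin 4), σ.partition.parts = {1, 1, 1, 1} ∨
    σ.partition.parts = {2, 1, 1} ∨ σ.partition.parts = {2, 2} ∨ σ.partition.parts = {3, 1} ∨
    σ.partition.parts = {4} := by decide

theorem fixedPairs_eq : ∀ σ : Equiv.Perm (Fin 4),
    (σ.partition.parts = {1, 1, 1, 1} → fixedPairs σ = 3) ∧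
    (σ.partition.parts = {2, 1, 1} → fixedPairs σ = 1) ∧
    (σ.partition.parts = {2, 2} → fixedPairs σ = 3) ∧
    (σ.partition.parts = {3, 1} → fixedPairs σ = 0) ∧
    (σ.partition.parts = {4} → fixedPairs σ = 1) := by decide

theorem card_partition_parts :
    (Finset.univ.filter fun σ : Equiv.Perm (Fin 4) => σ.partition.parts = {1, 1, 1, 1}).card = 1 ∧
    (Finset.univ.filter fun σ : Equiv.Perm (Fin 4) => σ.partition.parts = {2, 1, 1}).card = 6 ∧
    (Finset.univ.filter fun σ : Equiv.Perm (Fin 4) => σ.partition.parts = {2, 2}).card = 3 ∧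
    (Finset.univ.filter fun σ : Equiv.Perm (Fin 4) => σ.partition.parts = {3, 1}).card = 8 ∧
    (Finset.univ.filter fun σ : Equiv.Perm (Fin 4) => σ.partition.parts = {4}).card = 6 := by
  decide

theorem isConj_of_parts_eq {σ ρ : Equiv.Perm (Fin 4)}
    (h : σ.partition.parts = ρ.partition.parts) : IsConj σ ρ := by
  rw [Equiv.Perm.partition_eq_of_isConj]
  exact Nat.Partition.ext h

end PermutationsOfFour

/-! ### A twisted frame for every permutation -/

section Existence

variable {F : Type*} [Field F] [Fintype F]

/-- The separable polynomial `X ^ q ^ n - X` has `q ^ n` roots, too many to be roots of `X ^ q ^ d -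
X`. -/
theorem exists_pow_card_pow {n d : ℕ} (hd : d ≠ 0) (hdn : d < n) :
    ∃ t : AlgebraicClosure F, t ^ Fintype.card F ^ n = t ∧ t ^ Fintype.card F ^ d ≠ t := by
  classical
  obtain ⟨p, hp⟩ := CharP.exists F
  have : CharP (AlgebraicClosure F) p := charP_of_injective_algebraMap' F p
  have hpq : p ∣ Fintype.card F := by
    rw [← CharP.cast_eq_zero_iff F p, Nat.cast_card_eq_zero]
  have hq := Fintype.one_lt_card (α := F)
  by_contra! h
  let P (n : ℕ) : Polynomial (AlgebraicClosure F) :=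
    Polynomial.X ^ Fintype.card F ^ n - Polynomial.X
  have hn : n ≠ 0 := by omega
  have hP : ∀ m, m ≠ 0 → P m ≠ 0 := fun m hm =>
    FiniteField.X_pow_card_pow_sub_X_ne_zero _ hm hq
  have h1 : (P n).roots.toFinset ⊆ (P d).roots.toFinset := by
    intro t ht
    rw [Multiset.mem_toFinset, Polynomial.mem_roots (hP _ hn)] at ht
    rw [Multiset.mem_toFinset, Polynomial.mem_roots (hP _ hd)]
    simp only [P, Polynomial.IsRoot.def, Polynomial.eval_sub, Polynomial.eval_pow,
      Polynomial.eval_X, sub_eq_zero] at ht ⊢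
    exact h t ht
  have hsep : (P n).Separable := galois_poly_separable p _ (dvd_pow hpq hn)
  have h3 : (P n).roots.toFinset.card = Fintype.card F ^ n := by
    rw [Multiset.toFinset_card_of_nodup (Polynomial.nodup_roots hsep),
      IsAlgClosed.card_roots_eq_natDegree]
    exact FiniteField.X_pow_card_pow_sub_X_natDegree_eq _ hn hq
  have h4 : (P d).roots.toFinset.card ≤ Fintype.card F ^ d :=
    (Multiset.toFinset_card_le _).trans ((P d).card_roots'.trans
      (FiniteField.X_pow_card_pow_sub_X_natDegree_eq _ hd hq).le)
  have h5 := (Finset.card_le_card h1).trans h4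
  rw [h3] at h5
  exact absurd h5 (not_le.mpr (Nat.pow_lt_pow_right hq hdn))

theorem exists_twisted_param_of_isConj {σ ρ : Equiv.Perm (Fin 4)} (h : IsConj σ ρ)
    (hσ : ∃ t : Fin 4 → AlgebraicClosure F, Function.Injective t ∧
      ∀ i, t i ^ Fintype.card F = t (σ i)) :
    ∃ t : Fin 4 → AlgebraicClosure F, Function.Injective t ∧
      ∀ i, t i ^ Fintype.card F = t (ρ i) := by
  obtain ⟨t, ht, hσ⟩ := hσ
  obtain ⟨π, hπ⟩ := isConj_iff.mp h
  refine ⟨t ∘ (π⁻¹ : Equiv.Perm (Fin 4)), ht.comp (Equiv.injective _), fun i => ?_⟩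
  rw [Function.comp_apply, Function.comp_apply, hσ, ← hπ]
  simp

/-- Four distinct elements permuted by Frobenius in a prescribed way. -/
theorem exists_twisted_param (h2 : (2 : AlgebraicClosure F) ≠ 0)
    (h3 : (3 : AlgebraicClosure F) ≠ 0) (σ : Equiv.Perm (Fin 4)) :
    ∃ t : Fin 4 → AlgebraicClosure F, Function.Injective t ∧
      ∀ i, t i ^ Fintype.card F = t (σ i) := by
  let φ := FiniteField.frobeniusAlgHom F (AlgebraicClosure F)
  have hφ : ∀ z, z ^ Fintype.card F = φ z := fun _ => rfl
  have hφ2 : ∀ z, z ^ Fintype.card F ^ 2 = φ (φ z) := fun z => by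
    rw [pow_two, pow_mul]; rfl
  have hφ3 : ∀ z, z ^ Fintype.card F ^ 3 = φ (φ (φ z)) := fun z => by
    rw [pow_succ, pow_mul, hφ2]; rfl
  have hφ4 : ∀ z, z ^ Fintype.card F ^ 4 = φ (φ (φ (φ z))) := fun z => by
    rw [pow_succ, pow_mul, hφ3]; rfl
  have hinj : ∀ {a b}, φ a = φ b → a = b := fun h => φ.toRingHom.injective h
  have hvec : ∀ a b c d : AlgebraicClosure F, a ≠ b → a ≠ c → a ≠ d → b ≠ c → b ≠ d → c ≠ d →
      Function.Injective ![a, b, c, d] := by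
    intro a b c d hab hac had hbc hbd hcd i j hij
    fin_cases i <;> fin_cases j <;> first | rfl | (exfalso; simp at hij; grind)
  obtain ⟨a, ha, ha'⟩ := exists_pow_card_pow (F := F) (n := 2) (d := 1) (by decide) (by decide)
  rw [pow_one, hφ] at ha'
  rw [hφ2] at ha
  simp only [hφ]
  -- One explicit permutation per cycle type suffices. Its fixed points are taken in the prime field
  -- and its cycles are Frobenius orbits; for two transpositions the second orbit is the first one
  -- shifted by `1`.
  rcases partition_parts_cases σ with h | h | h | h | h
  · refine exists_twisted_param_of_isConj (σ := 1) (isConj_of_parts_eq (by rw [h]; decide))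
      ⟨![0, 1, 2, 3], hvec _ _ _ _ ?_ ?_ ?_ ?_ ?_ ?_, fun i => ?_⟩
    · exact zero_ne_one
    · exact h2.symm
    · exact h3.symm
    · intro h; exact one_ne_zero (by linear_combination -h : (1 : AlgebraicClosure F) = 0)
    · intro h; exact h2 (by linear_combination -h)
    · intro h; exact one_ne_zero (by linear_combination -h : (1 : AlgebraicClosure F) = 0)
    · simp only [hφ]
      fin_cases i
      · exact map_zero φ
      · exact map_one φ
      · exact map_ofNat φ 2
      · exact map_ofNat φ 3
  · refine exists_twisted_param_of_isConj (σ := Equiv.swap 0 1)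
      (isConj_of_parts_eq (by rw [h]; decide))
      ⟨![a, φ a, 0, 1], hvec _ _ _ _ ha'.symm ?_ ?_ ?_ ?_ zero_ne_one, fun i => ?_⟩
    · rintro rfl; simp at ha'
    · rintro rfl; simp at ha'
    · intro h0
      rw [h0, map_zero] at ha
      exact ha' (by rw [h0, ha])
    · intro h0
      rw [h0, map_one] at ha
      exact ha' (by rw [h0, ha])
    · simp only [hφ]
      fin_cases i
      · rfl
      · exact ha
      · exact map_zero φ
      · exact map_one φ
  · refine exists_twisted_param_of_isConj (σ := Equiv.swap 0 1 * Equiv.swap 2 3)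
      (isConj_of_parts_eq (by rw [h]; decide))
      ⟨![a, φ a, a + 1, φ a + 1], hvec _ _ _ _ ha'.symm ?_ ?_ ?_ ?_ ?_, fun i => ?_⟩
    · simp
    · intro h0
      have := congrArg φ h0
      rw [map_add, ha, map_one] at this
      exact h2 (by linear_combination -h0 - this)
    · intro h0
      have := congrArg φ h0
      rw [map_add, ha, map_one] at this
      exact h2 (by linear_combination -h0 - this)
    · simp
    · simpa using ha'.symm
    · simp only [hφ]
      fin_cases i
      · rfl
      · exact ha
      · exact (map_add φ _ _).trans (by rw [map_one]; rfl)
      · exact (map_add φ _ _).trans (by rw [map_one, ha]; rfl)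
  · obtain ⟨b, hb, hb'⟩ := exists_pow_card_pow (F := F) (n := 3) (d := 1) (by decide) (by decide)
    rw [pow_one, hφ] at hb'
    rw [hφ3] at hb
    have hb2 : φ (φ b) ≠ b := by
      intro h0
      rw [h0] at hb
      exact hb' hb
    have hb0 : b ≠ 0 := by rintro rfl; simp at hb'
    have hφ0 : ∀ {x}, x ≠ 0 → φ x ≠ 0 := fun hx h0 => hx (hinj (by rw [h0, map_zero]))
    refine exists_twisted_param_of_isConj (σ := Equiv.swap 0 1 * Equiv.swap 1 2)
      (isConj_of_parts_eq (by rw [h]; decide))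
      ⟨![b, φ b, φ (φ b), 0], hvec _ _ _ _ hb'.symm hb2.symm hb0 ?_ (hφ0 hb0) (hφ0 (hφ0 hb0)),
        fun i => ?_⟩
    · intro h0; exact hb' (hinj h0).symm
    · simp only [hφ]
      fin_cases i
      · rfl
      · rfl
      · exact hb
      · exact map_zero φ
  · obtain ⟨b, hb, hb'⟩ := exists_pow_card_pow (F := F) (n := 4) (d := 2) (by decide) (by decide)
    rw [hφ2] at hb'
    rw [hφ4] at hb
    have hb1 : φ b ≠ b := by
      intro h0
      rw [h0, h0] at hb'
      exact hb' rfl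
    have hb3 : φ (φ (φ b)) ≠ b := by
      intro h0
      rw [h0] at hb
      exact hb1 hb
    refine exists_twisted_param_of_isConj (σ := finRotate 4)
      (isConj_of_parts_eq (by rw [h]; decide))
      ⟨![b, φ b, φ (φ b), φ (φ (φ b))], hvec _ _ _ _ hb1.symm hb'.symm hb3.symm ?_ ?_ ?_,
        fun i => ?_⟩
    · intro h0; exact hb1 (hinj h0).symm
    · intro h0; exact hb' (hinj h0).symm
    · intro h0; exact hb1 (hinj (hinj h0)).symm
    · simp only [hφ]
      fin_cases i
      · rfl
      · rfl
      · rfl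
      · exact hb

/-- The points of the conic `x z = y ^ 2` with parameters `t`, with the coordinates scaled so that
they add up to `0`. -/
noncomputable def conicFrame {k : Type*} [Field k] (t : Fin 4 → k) (i : Fin 4) : Fin 3 → k :=
  (∏ j, if j = i then 1 else (t i - t j)⁻¹) • ![1, t i, t i ^ 2]

/-- The weights `∏ (t i - t j)⁻¹` are those of the third divided difference, which kills polynomials
of degree at most `2`; hence the sum is zero. The points span, because a polynomial of degree at
most `2` with three distinct roots vanishes. -/
theorem isFrame_conicFrame {k : Type*} [Field k] (h2 : (2 : k) ≠ 0) {t : Fin 4 → k}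
    (ht : Function.Injective t) : IsFrame (conicFrame t) := by
  have hne : ∀ i j, i ≠ j → t i - t j ≠ 0 := fun i j hij => sub_ne_zero.mpr (ht.ne hij)
  have hsum : ∑ i, conicFrame t i = 0 := by
    have h01 := hne 0 1 (by decide)
    have h02 := hne 0 2 (by decide)
    have h03 := hne 0 3 (by decide)
    have h12 := hne 1 2 (by decide)
    have h13 := hne 1 3 (by decide)
    have h23 := hne 2 3 (by decide)
    have h10 := hne 1 0 (by decide)
    have h20 := hne 2 0 (by decide)
    have h30 := hne 3 0 (by decide)
    have h21 := hne 2 1 (by decide)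
    have h31 := hne 3 1 (by decide)
    have h32 := hne 3 2 (by decide)
    rw [Fin.sum_univ_four]
    simp only [conicFrame, Fin.prod_univ_four]
    ext j
    fin_cases j <;> simp <;> field_simp <;> ring
  refine ⟨hsum, (det_frameMatrix_ne_zero_iff h2 hsum).mpr fun f hf => ?_⟩
  have hf' : ∀ i, f 0 + f 1 * t i + f 2 * t i ^ 2 = 0 := by
    intro i
    have := hf i
    rw [conicFrame, dotProduct_smul, smul_eq_mul, mul_eq_zero] at this
    have h0 : (∏ j, if j = i then (1 : k) else (t i - t j)⁻¹) ≠ 0 := by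
      refine Finset.prod_ne_zero_iff.mpr fun j _ => ?_
      split_ifs with h
      · exact one_ne_zero
      · exact inv_ne_zero (hne i j (Ne.symm h))
    have := this.resolve_left h0
    rw [vec3_dotProduct] at this
    simp only [cons_val_zero, cons_val_one, cons_val] at this
    linear_combination this
  have e0 := hf' 0
  have e1 := hf' 1
  have e2 := hf' 2
  have h01 := hne 0 1 (by decide)
  have h02 := hne 0 2 (by decide)
  have h12 := hne 1 2 (by decide)
  have a1 : f 1 + f 2 * (t 0 + t 1) = 0 := by
    apply mul_left_cancel₀ h01
    linear_combination e0 - e1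
  have a2 : f 1 + f 2 * (t 0 + t 2) = 0 := by
    apply mul_left_cancel₀ h02
    linear_combination e0 - e2
  have f2 : f 2 = 0 := by
    apply mul_left_cancel₀ h12
    linear_combination a1 - a2
  have f1 : f 1 = 0 := by
    rw [f2] at a1; linear_combination a1
  have f0 : f 0 = 0 := by
    rw [f1, f2] at e0; linear_combination e0
  ext j
  fin_cases j
  exacts [f0, f1, f2]

theorem isTwisted_conicFrame {t : Fin 4 → AlgebraicClosure F} {σ : Equiv.Perm (Fin 4)}
    (hσ : ∀ i, t i ^ Fintype.card F = t (σ i)) : IsTwisted σ (conicFrame t) := by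
  let φ := FiniteField.frobeniusAlgHom F (AlgebraicClosure F)
  have hφ : ∀ z, z ^ Fintype.card F = φ z := fun _ => rfl
  intro i j
  simp only [hφ] at hσ ⊢
  rw [conicFrame, conicFrame, Pi.smul_apply, Pi.smul_apply, smul_eq_mul, smul_eq_mul, map_mul,
    map_prod]
  congr 1
  · conv_rhs => rw [← Equiv.prod_comp σ]
    refine Finset.prod_congr rfl fun j _ => ?_
    by_cases h : j = i
    · simp [h]
    · simp [h, hσ]
  · fin_cases j <;> simp [hσ]

/-- The pencil through the points of `x z = y ^ 2` whose parameters are permuted by Frobenius. -/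
theorem exists_members_conicFrame (h2 : (2 : AlgebraicClosure F) ≠ 0)
    {t : Fin 4 → AlgebraicClosure F} {σ : Equiv.Perm (Fin 4)}
    (hσ : ∀ i, t i ^ Fintype.card F = t (σ i)) :
    ∃ B C : Conic F, B ∈ framePencil (conicFrame t) ∧ C ∈ framePencil (conicFrame t) ∧ C ≠ B ∧
      B.IsSmooth := by
  have h2F : (2 : F) ≠ 0 := by
    intro h
    apply h2
    rw [← map_ofNat (algebraMap F (AlgebraicClosure F)), h, map_zero]
  let φ := FiniteField.frobeniusAlgHom F (AlgebraicClosure F)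
  have hφ : ∀ z, z ^ Fintype.card F = φ z := fun _ => rfl
  -- The quartic with roots `t i` has coefficients in `F`, since Frobenius permutes its roots.
  let p : Polynomial (AlgebraicClosure F) := ∏ i, (Polynomial.X - Polynomial.C (t i))
  have hpφ : p.map φ.toRingHom = p := by
    simp only [p, Polynomial.map_prod, Polynomial.map_sub, Polynomial.map_X, Polynomial.map_C]
    conv_rhs => rw [← Equiv.prod_comp σ]
    refine Finset.prod_congr rfl fun i _ => ?_
    rw [← hσ]; rfl
  have hc : ∀ n, ∃ c : F, algebraMap F (AlgebraicClosure F) c = p.coeff n := by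
    intro n
    apply exists_algebraMap_eq_of_pow_card
    conv_rhs => rw [← hpφ, Polynomial.coeff_map]
    rfl
  choose c hc using hc
  have hdeg : p.natDegree = 4 := by
    simp only [p]
    rw [Polynomial.natDegree_prod_of_monic _ _ fun i _ => Polynomial.monic_X_sub_C _]
    simp
  have hmonic : p.Monic := Polynomial.monic_prod_of_monic _ _ fun i _ => Polynomial.monic_X_sub_C _
  have hroot : ∀ i, algebraMap F (AlgebraicClosure F) (c 0)
      + algebraMap F (AlgebraicClosure F) (c 1) * t i
      + algebraMap F (AlgebraicClosure F) (c 2) * t i ^ 2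
      + algebraMap F (AlgebraicClosure F) (c 3) * t i ^ 3 + t i ^ 4 = 0 := by
    intro i
    have h0 : p.eval (t i) = 0 := by
      simp only [p, Polynomial.eval_prod]
      exact Finset.prod_eq_zero (Finset.mem_univ i) (by simp)
    have h4 : p.coeff 4 = 1 := by rw [← hdeg]; exact hmonic
    rw [Polynomial.eval_eq_sum_range, hdeg] at h0
    simp only [Finset.sum_range_succ, Finset.sum_range_zero, h4] at h0
    rw [hc, hc, hc, hc, ← h0]
    ring
  -- `MB` is `2 (x z - y ^ 2)`. `MC` is a quadratic form whose value at `(1, t, t ^ 2)` is twice the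
  -- quartic.
  let MB : symMatrices F := ⟨!![0, 0, 1; 0, -2, 0; 1, 0, 0], by
    ext i j; fin_cases i <;> fin_cases j <;> rfl⟩
  let MC : symMatrices F := ⟨!![2 * c 0, c 1, 0; c 1, 2 * c 2, c 3; 0, c 3, 2], by
    ext i j; fin_cases i <;> fin_cases j <;> rfl⟩
  have hMB : MB ≠ 0 := by
    intro h
    have := congrFun (congrFun (congrArg Subtype.val h) 0) 2
    simp [MB] at this
  have hMC : MC ≠ 0 := by
    intro h
    have := congrFun (congrFun (congrArg Subtype.val h) 2) 2
    simp [MC, h2F] at this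
  have hmem : ∀ (M : symMatrices F) (hM : M ≠ 0),
      (∀ i, ![1, t i, t i ^ 2] ⬝ᵥ
        (M : Matrix (Fin 3) (Fin 3) F).map (algebraMap F (AlgebraicClosure F)) *ᵥ
          ![1, t i, t i ^ 2] = 0) →
      (Projectivization.mk F M hM : Conic F) ∈ framePencil (conicFrame t) := by
    intro M hM h i
    obtain ⟨d, -, hd⟩ := geomMatrix_mk M hM
    rw [hd, conicFrame, mulVec_smul, smul_mulVec, smul_dotProduct, dotProduct_smul,
      dotProduct_smul, h]
    simp
  refine ⟨Projectivization.mk F MB hMB, Projectivization.mk F MC hMC, hmem _ _ ?_, hmem _ _ ?_,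
    ?_, ?_⟩
  · intro i
    simp only [MB, mulVec, vec3_dotProduct, map_apply, of_apply, cons_val_zero, cons_val_one,
      cons_val, map_zero, map_one, map_neg, map_ofNat]
    ring
  · intro i
    simp only [MC, mulVec, vec3_dotProduct, map_apply, of_apply, cons_val_zero, cons_val_one,
      cons_val, map_zero, map_mul, map_ofNat]
    linear_combination 2 * hroot i
  · intro h
    obtain ⟨a, ha⟩ := (Projectivization.mk_eq_mk_iff' _ _ _ _ _).mp h
    have := congrFun (congrFun (congrArg Subtype.val ha) 2) 2
    simp [MB, MC] at this
    exact h2F this.symm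
  · rw [isSmooth_iff]
    obtain ⟨d, hd0, hd⟩ := geomMatrix_mk MB hMB
    rw [hd, det_smul]
    refine mul_ne_zero (pow_ne_zero _ hd0) ?_
    simp [MB, det_fin_three]
    first | exact h2 | exact h2F

end Existence

/-! ### The projective group acting on twisted frames -/

section Transitivity

theorem matrix_eq_of_mulVec_frame {k : Type*} [Field k] (h2 : (2 : k) ≠ 0)
    {u : Fin 4 → Fin 3 → k} (hu : IsFrame u) {M N : Matrix (Fin 3) (Fin 3) k}
    (h : ∀ i, M *ᵥ u i = N *ᵥ u i) : M = N := by
  rw [← sub_eq_zero]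
  refine funext fun a => ?_
  refine (det_frameMatrix_ne_zero_iff h2 hu.1).mp hu.2 _ fun i => ?_
  have := congrFun (h i) a
  rw [← sub_eq_zero, ← Pi.sub_apply, ← sub_mulVec] at this
  exact this

theorem eq_of_transpose_mul_mul {k : Type*} [Field k] {g X Y : Matrix (Fin 3) (Fin 3) k}
    (hg : g.det ≠ 0) (h : gᵀ * X * g = gᵀ * Y * g) : X = Y := by
  have hu : IsUnit g.det := hg.isUnit
  have hu' : IsUnit gᵀ.det := by rwa [det_transpose]
  have := congrArg (fun Z => (gᵀ)⁻¹ * Z * g⁻¹) h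
  simpa only [Matrix.mul_assoc gᵀ, nonsing_inv_mul_cancel_left _ _ hu',
    mul_nonsing_inv_cancel_right _ _ hu] using this

variable {F : Type*} [Field F]

/-- The linear action of a matrix over `F` on quadruples of geometric vectors. -/
noncomputable def moveFrame (g : Matrix (Fin 3) (Fin 3) F)
    (u : Fin 4 → Fin 3 → AlgebraicClosure F) : Fin 4 → Fin 3 → AlgebraicClosure F :=
  fun i => g.map (algebraMap F (AlgebraicClosure F)) *ᵥ u i

theorem det_map_ne_zero {g : Matrix (Fin 3) (Fin 3) F} (hg : g.det ≠ 0) :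
    (g.map (algebraMap F (AlgebraicClosure F))).det ≠ 0 := by
  have := RingHom.map_det (algebraMap F (AlgebraicClosure F)) g
  rw [RingHom.mapMatrix_apply] at this
  rw [← this]
  exact (map_ne_zero _).mpr hg

theorem IsFrame.moveFrame {u : Fin 4 → Fin 3 → AlgebraicClosure F} (hu : IsFrame u)
    {g : Matrix (Fin 3) (Fin 3) F} (hg : g.det ≠ 0) : IsFrame (moveFrame g u) :=
  hu.mulVec (det_map_ne_zero hg)

/-- The image of a conic under a projective transformation. -/
theorem exists_conic_congr (B : Conic F) {g : Matrix (Fin 3) (Fin 3) F} (hg : g.det ≠ 0) :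
    ∃ B' : Conic F, ∃ c : AlgebraicClosure F, c ≠ 0 ∧
      B'.geomMatrix = c • ((g.map (algebraMap F (AlgebraicClosure F)))ᵀ * B.geomMatrix *
        g.map (algebraMap F (AlgebraicClosure F))) := by
  let M : symMatrices F := ⟨gᵀ * (B.rep : Matrix _ _ F) * g, by
    have hB : (B.rep : Matrix (Fin 3) (Fin 3) F)ᵀ = (B.rep : Matrix (Fin 3) (Fin 3) F) := B.rep.2
    change (gᵀ * (B.rep : Matrix _ _ F) * g)ᵀ = gᵀ * (B.rep : Matrix _ _ F) * g
    rw [transpose_mul, transpose_mul, transpose_transpose, hB, Matrix.mul_assoc]⟩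
  have hM : M ≠ 0 := by
    intro h
    have h0 : gᵀ * (B.rep : Matrix _ _ F) * g = 0 := congrArg Subtype.val h
    apply B.rep_nonzero
    apply Subtype.ext
    exact eq_of_transpose_mul_mul hg (h0.trans (by simp))
  obtain ⟨c, hc, h⟩ := geomMatrix_mk M hM
  refine ⟨_, c, hc, h.trans ?_⟩
  simp only [M, Matrix.map_mul, transpose_map]
  rfl

theorem framePencil_smul_comp {u : Fin 4 → Fin 3 → AlgebraicClosure F}
    {c : AlgebraicClosure F} (hc : c ≠ 0) (π : Equiv.Perm (Fin 4)) :
    framePencil (fun i => c • u (π i)) = framePencil u := by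
  ext C
  have h : ∀ x, (c • x) ⬝ᵥ C.geomMatrix *ᵥ (c • x) = 0 ↔ x ⬝ᵥ C.geomMatrix *ᵥ x = 0 := by
    intro x
    rw [mulVec_smul, smul_dotProduct, dotProduct_smul, smul_eq_mul, smul_eq_mul, mul_eq_zero,
      mul_eq_zero, or_iff_right hc, or_iff_right hc]
  constructor
  · intro hC i
    have := hC (π.symm i)
    rwa [h, Equiv.apply_symm_apply] at this
  · intro hC i
    rw [h]
    exact hC _

variable [Fintype F] {u v : Fin 4 → Fin 3 → AlgebraicClosure F} {σ : Equiv.Perm (Fin 4)}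

theorem IsTwisted.moveFrame (hσ : IsTwisted σ u) (g : Matrix (Fin 3) (Fin 3) F) :
    IsTwisted σ (moveFrame g u) := by
  intro i j
  let φ := FiniteField.frobeniusAlgHom F (AlgebraicClosure F)
  have hφ : ∀ i j, φ (u i j) = u (σ i) j := hσ
  change φ _ = _
  simp only [Poncelet.moveFrame, mulVec, dotProduct, map_sum, map_mul, hφ, map_apply,
    AlgHom.commutes]

/-- Frames with the same Frobenius action are equivalent over `F`. -/
theorem exists_moveFrame_eq (h2 : (2 : AlgebraicClosure F) ≠ 0) (hu : IsFrame u)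
    (hσu : IsTwisted σ u) (hv : IsFrame v) (hσv : IsTwisted σ v) :
    ∃ g : Matrix (Fin 3) (Fin 3) F, g.det ≠ 0 ∧ moveFrame g u = v := by
  let φ := FiniteField.frobeniusAlgHom F (AlgebraicClosure F)
  have hφu : ∀ i j, φ (u i j) = u (σ i) j := hσu
  have hφv : ∀ i j, φ (v i j) = v (σ i) j := hσv
  set G := frameMatrix v * (frameMatrix u)⁻¹ with hG
  have hGu : ∀ i, G *ᵥ u i = v i := by
    intro i
    apply smul_right_injective _ h2
    simp only
    rw [← mulVec_smul, ← frameMatrix_mulVec_signVec hu.1, ← frameMatrix_mulVec_signVec hv.1, hG,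
      mulVec_mulVec, nonsing_inv_mul_cancel_right _ _ hu.2.isUnit]
  -- The linear map taking `u` to `v` is unique, and its Frobenius conjugate does the same because
  -- both frames are twisted by `σ`. So it is defined over `F`.
  have hφG : G.map φ = G := by
    refine matrix_eq_of_mulVec_frame h2 hu fun i => ?_
    obtain ⟨i, rfl⟩ := σ.surjective i
    rw [hGu]
    ext j
    rw [← hφv, ← hGu]
    simp only [mulVec, dotProduct, map_sum, map_mul, hφu, map_apply]
  have hent : ∀ i j, ∃ y : F, algebraMap F (AlgebraicClosure F) y = G i j := fun i j =>
    exists_algebraMap_eq_of_pow_card (congrFun (congrFun hφG i) j)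
  choose g hg using hent
  have hgG : (Matrix.of g).map (algebraMap F (AlgebraicClosure F)) = G := by
    ext i j
    exact hg i j
  refine ⟨of g, fun h0 => ?_, funext fun i => ?_⟩
  · have h1 := RingHom.map_det (algebraMap F (AlgebraicClosure F)) (of g)
    rw [RingHom.mapMatrix_apply, hgG, h0, map_zero, hG, det_mul, det_nonsing_inv,
      Ring.inverse_eq_inv'] at h1
    exact mul_ne_zero hv.2 (inv_ne_zero hu.2) h1.symm
  · rw [moveFrame, hgG, hGu]

theorem exists_frame_of_perm (h2 : (2 : AlgebraicClosure F) ≠ 0)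
    (h3 : (3 : AlgebraicClosure F) ≠ 0) (σ : Equiv.Perm (Fin 4)) :
    ∃ w : Fin 4 → Fin 3 → AlgebraicClosure F, IsFrame w ∧ IsTwisted σ w ∧
      ∃ B C : Conic F, B ∈ framePencil w ∧ C ∈ framePencil w ∧ C ≠ B ∧ B.IsSmooth := by
  obtain ⟨t, ht, hσ⟩ := exists_twisted_param h2 h3 σ
  exact ⟨conicFrame t, isFrame_conicFrame h2 ht, isTwisted_conicFrame hσ,
    exists_members_conicFrame h2 hσ⟩

/-- A matrix over `F` carries `u` to the model frame on `x z = y ^ 2`; the conics of the model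
pencil are pulled back along it. -/
theorem exists_members (h2 : (2 : AlgebraicClosure F) ≠ 0) (h3 : (3 : AlgebraicClosure F) ≠ 0)
    (hu : IsFrame u) (hσ : IsTwisted σ u) :
    ∃ B C : Conic F, B ∈ framePencil u ∧ C ∈ framePencil u ∧ C ≠ B ∧ B.IsSmooth := by
  obtain ⟨w, hw, hσw, B, C, hB, hC, hCB, hBs⟩ := exists_frame_of_perm h2 h3 σ
  obtain ⟨g, hg, rfl⟩ := exists_moveFrame_eq h2 hu hσ hw hσw
  obtain ⟨B', b, hb, hB'⟩ := exists_conic_congr B hg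
  obtain ⟨C', c, hc, hC'⟩ := exists_conic_congr C hg
  have hdet := det_map_ne_zero hg
  have hmem : ∀ (D D' : Conic F) (d : AlgebraicClosure F), D ∈ framePencil (moveFrame g u) →
      D'.geomMatrix = d • ((g.map (algebraMap F (AlgebraicClosure F)))ᵀ * D.geomMatrix *
        g.map (algebraMap F (AlgebraicClosure F))) → D' ∈ framePencil u := by
    intro D D' d hD hD' i
    have := hD i
    rw [moveFrame, dot_mulVec_mulVec] at this
    rw [hD', smul_mulVec, dotProduct_smul, this, smul_zero]
  refine ⟨B', C', hmem B B' b hB hB', hmem C C' c hC hC', ?_, ?_⟩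
  · rintro rfl
    apply hCB
    apply conic_eq_of_geomMatrix (c := c⁻¹ * b)
    rw [mul_smul, eq_inv_smul_iff₀ hc]
    apply eq_of_transpose_mul_mul hdet
    simpa only [Matrix.mul_smul, Matrix.smul_mul] using hC'.symm.trans hB'
  · rw [isSmooth_iff] at hBs ⊢
    rw [hB', det_smul, det_mul, det_mul, det_transpose]
    exact mul_ne_zero (pow_ne_zero _ hb) (mul_ne_zero (mul_ne_zero hdet hBs) hdet)

end Transitivity

/-! ### Counting pencils by type -/

section CountingPencils

variable {F : Type*} [Field F] [Fintype F] {u v : Fin 4 → Fin 3 → AlgebraicClosure F}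
  {σ ρ : Equiv.Perm (Fin 4)} {S : Finset (Equiv.Perm (Fin 4))}

/-- The frames permuted by Frobenius through one of the permutations in `S`. -/
def framesOf (F : Type*) [Field F] [Fintype F] (S : Finset (Equiv.Perm (Fin 4))) :
    Set (Fin 4 → Fin 3 → AlgebraicClosure F) :=
  {u | IsFrame u ∧ ∃ σ ∈ S, IsTwisted σ u}

theorem IsTwisted.unique (h2 : (2 : AlgebraicClosure F) ≠ 0) (hu : IsFrame u)
    (hσ : IsTwisted σ u) (hρ : IsTwisted ρ u) : σ = ρ := by
  ext1 i
  by_contra hne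
  refine hu.not_smul h2 hne 1 ?_
  rw [one_smul]
  ext j
  rw [← hσ, ← hρ]

/-- For each permutation the invertible matrices over `F` act simply transitively on the frames
twisted by it, and a frame determines its permutation. -/
theorem ncard_framesOf (h2 : (2 : AlgebraicClosure F) ≠ 0) (h3 : (3 : AlgebraicClosure F) ≠ 0)
    (S : Finset (Equiv.Perm (Fin 4))) :
    (framesOf F S).ncard = {g : Matrix (Fin 3) (Fin 3) F | g.det ≠ 0}.ncard * S.card := by
  choose w hw hσw _ using exists_frame_of_perm (F := F) h2 h3
  have : framesOf F S = (fun x : Matrix (Fin 3) (Fin 3) F × Equiv.Perm (Fin 4) =>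
      moveFrame x.1 (w x.2)) '' ({g | g.det ≠ 0} ×ˢ (S : Set (Equiv.Perm (Fin 4)))) := by
    ext u
    constructor
    · rintro ⟨hu, σ, hσ, hσu⟩
      obtain ⟨g, hg, rfl⟩ := exists_moveFrame_eq h2 (hw σ) (hσw σ) hu hσu
      exact ⟨(g, σ), ⟨hg, hσ⟩, rfl⟩
    · rintro ⟨⟨g, σ⟩, ⟨hg, hσ⟩, rfl⟩
      exact ⟨(hw σ).moveFrame hg, σ, hσ, (hσw σ).moveFrame g⟩
  rw [this, Set.InjOn.ncard_image, Set.ncard_prod, Set.ncard_coe_finset]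
  rintro ⟨g, σ⟩ ⟨hg, -⟩ ⟨g', σ'⟩ ⟨-, -⟩ h
  simp only at h
  obtain rfl : σ = σ' := ((hσw σ).moveFrame g).unique h2 ((hw σ).moveFrame hg)
    (h ▸ (hσw σ').moveFrame g')
  congr 1
  apply Matrix.map_injective (algebraMap F (AlgebraicClosure F)).injective
  exact matrix_eq_of_mulVec_frame h2 (hw σ) fun i => congrFun h i

theorem IsTwisted.smul_comp (hσ : IsTwisted σ u) (c : F) (π : Equiv.Perm (Fin 4)) :
    IsTwisted (π⁻¹ * σ * π) fun i => algebraMap F (AlgebraicClosure F) c • u (π i) := by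
  intro i j
  beta_reduce
  rw [Pi.smul_apply, smul_eq_mul, mul_pow, ← map_pow, FiniteField.pow_card, hσ]
  simp [-algebraMap_smul]

/-- A pencil determines its twisted frame up to a permutation and a scalar in `F`. -/
theorem exists_smul_comp_eq (h2 : (2 : AlgebraicClosure F) ≠ 0)
    (h3 : (3 : AlgebraicClosure F) ≠ 0) (hu : IsFrame u) (hσ : IsTwisted σ u) (hv : IsFrame v)
    (hρ : IsTwisted ρ v) (h : framePencil u = framePencil v) :
    ∃ (π : Equiv.Perm (Fin 4)) (c : F), c ≠ 0 ∧
      (fun i => algebraMap F (AlgebraicClosure F) c • u (π i)) = v := by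
  obtain ⟨B, C, hB, hC, hCB, -⟩ := exists_members h2 h3 hu hσ
  have hex : ∀ i, ∃ i', ∃ c : AlgebraicClosure F, c • u i' = v i := fun i =>
    exists_smul_frame h2 hu (geomMatrix_isSymm B) (geomMatrix_isSymm C) hB hC
      (frameMinor_ne_zero h2 hu hB hC hCB.symm) ((h ▸ hB : B ∈ framePencil v) i)
      ((h ▸ hC : C ∈ framePencil v) i)
  choose π c hc using hex
  have hc0 : ∀ i, c i ≠ 0 := by
    intro i h0
    apply hv.ne_zero h2 i
    rw [← hc, h0, zero_smul]
  have hπ : Function.Injective π := by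
    intro i j hij
    by_contra hne
    refine hv.not_smul h2 hne (c j * (c i)⁻¹) ?_
    rw [← hc i, ← hc j, hij, smul_smul, inv_mul_cancel_right₀ (hc0 i)]
  let π' : Equiv.Perm (Fin 4) := Equiv.ofBijective π (Finite.injective_iff_bijective.mp hπ)
  obtain ⟨d, hd⟩ := frame_smul_unique h2 (hu.comp h2 π') hv.1 fun i => ⟨c i, hc i⟩
  have hd0 : d ≠ 0 := by
    rintro rfl
    apply hv.ne_zero h2 0
    rw [← hd, zero_smul]
  -- Comparing the Frobenius images of both frames gives `d ^ q = d`, so the common scalar lies in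
  -- `F`.
  have hfr : ∀ i, d ^ Fintype.card F • u (σ (π' i)) = d • u (π' (ρ i)) := by
    intro i
    have := hd (ρ i)
    rw [Function.comp_apply] at this
    rw [this]
    ext j
    rw [← hρ, ← hd, Pi.smul_apply, Pi.smul_apply, smul_eq_mul, smul_eq_mul, mul_pow,
      Function.comp_apply, hσ]
  have hcomm : σ (π' 0) = π' (ρ 0) := by
    by_contra hne
    refine hu.not_smul h2 hne (d⁻¹ * d ^ Fintype.card F) ?_
    rw [mul_smul, hfr, inv_smul_smul₀ hd0]
  have hdq : d ^ Fintype.card F = d := by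
    have := hfr 0
    rw [hcomm] at this
    exact smul_left_injective _ (hu.ne_zero h2 _) this
  obtain ⟨d, rfl⟩ := exists_algebraMap_eq_of_pow_card hdq
  exact ⟨π', d, fun h0 => hd0 (by rw [h0, map_zero]), funext hd⟩

/-- The pencils through the frames permuted by Frobenius through a permutation in `S`. -/
def pencilsOf (F : Type*) [Field F] [Fintype F] (S : Finset (Equiv.Perm (Fin 4))) :
    Set (Set (Conic F)) :=
  framePencil '' framesOf F S

/-- The frames of a given pencil are the `24` reorderings of a chosen one, times a scalar of `F`.
Reordering conjugates the Frobenius permutation, so `S` must be closed under conjugation. -/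
theorem ncard_pencilsOf_mul (h2 : (2 : AlgebraicClosure F) ≠ 0)
    (h3 : (3 : AlgebraicClosure F) ≠ 0) (hS : ∀ σ ∈ S, ∀ π, π⁻¹ * σ * π ∈ S) :
    (pencilsOf F S).ncard * (24 * {c : F | c ≠ 0}.ncard) = (framesOf F S).ncard := by
  have hex : ∀ W ∈ pencilsOf F S, ∃ u ∈ framesOf F S, framePencil u = W := fun W hW => hW
  choose! f hf hfW using hex
  have : framesOf F S = (fun x : Set (Conic F) × Equiv.Perm (Fin 4) × F =>
      fun i => algebraMap F (AlgebraicClosure F) x.2.2 • f x.1 (x.2.1 i)) ''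
        (pencilsOf F S ×ˢ (Set.univ : Set (Equiv.Perm (Fin 4))) ×ˢ {c : F | c ≠ 0}) := by
    ext v
    constructor
    · rintro ⟨hv, ρ, hρS, hρ⟩
      have hW : framePencil v ∈ pencilsOf F S := ⟨v, ⟨hv, ρ, hρS, hρ⟩, rfl⟩
      obtain ⟨hu, σ, -, hσ⟩ := hf _ hW
      obtain ⟨π, c, hc, h⟩ := exists_smul_comp_eq h2 h3 hu hσ hv hρ (hfW _ hW)
      exact ⟨(framePencil v, π, c), ⟨hW, Set.mem_univ _, hc⟩, h⟩
    · rintro ⟨⟨W, π, c⟩, ⟨hW, -, hc⟩, rfl⟩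
      obtain ⟨hu, σ, hσS, hσ⟩ := hf _ hW
      exact ⟨(hu.comp h2 π).smul ((map_ne_zero _).mpr hc), _, hS σ hσS π, hσ.smul_comp c π⟩
  rw [this, Set.InjOn.ncard_image, Set.ncard_prod, Set.ncard_prod, Set.ncard_univ,
    Nat.card_eq_fintype_card, Fintype.card_perm, Fintype.card_fin]
  · rfl
  rintro ⟨W, π, c⟩ ⟨hW, -, hc⟩ ⟨W', π', c'⟩ ⟨hW', -, hc'⟩ h
  simp only at h hW hW' hc hc'
  have hc0 : algebraMap F (AlgebraicClosure F) c ≠ 0 := (map_ne_zero _).mpr hc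
  have hc0' : algebraMap F (AlgebraicClosure F) c' ≠ 0 := (map_ne_zero _).mpr hc'
  obtain rfl : W = W' := by
    rw [← hfW W hW, ← hfW W' hW', ← framePencil_smul_comp hc0 π, h, framePencil_smul_comp hc0']
  have hu := (hf W hW).1
  obtain rfl : π = π' := by
    ext1 i
    by_contra hne
    refine hu.not_smul h2 hne ((algebraMap F (AlgebraicClosure F) c')⁻¹ *
      algebraMap F (AlgebraicClosure F) c) ?_
    rw [mul_smul, congrFun h i, inv_smul_smul₀ hc0']
  obtain rfl : c = c' := (algebraMap F (AlgebraicClosure F)).injective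
    (smul_left_injective _ (hu.ne_zero h2 _) (congrFun h 0))
  rfl

/-- The factors `|GL₃(F)|` and `q - 1` occur for `S` and for the whole group alike, and cancel. -/
theorem ncard_pencilsOf (h2 : (2 : AlgebraicClosure F) ≠ 0)
    (h3 : (3 : AlgebraicClosure F) ≠ 0) (hS : ∀ σ ∈ S, ∀ π, π⁻¹ * σ * π ∈ S) :
    24 * (pencilsOf F S).ncard = S.card * (pencilsOf F Finset.univ).ncard := by
  have e1 := ncard_pencilsOf_mul h2 h3 hS
  have e2 := ncard_pencilsOf_mul (F := F) (S := Finset.univ) h2 h3 fun _ _ _ => Finset.mem_univ _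
  rw [ncard_framesOf h2 h3] at e1 e2
  rw [Finset.card_univ, Fintype.card_perm, Fintype.card_fin, show Nat.factorial 4 = 24 from rfl]
    at e2
  have h0 : 0 < {c : F | c ≠ 0}.ncard := (Set.ncard_pos (Set.toFinite _)).mpr ⟨1, one_ne_zero⟩
  apply Nat.eq_of_mul_eq_mul_right h0
  have e3 : {g : Matrix (Fin 3) (Fin 3) F | g.det ≠ 0}.ncard =
      (pencilsOf F Finset.univ).ncard * {c : F | c ≠ 0}.ncard := by
    linarith
  rw [e3] at e1
  linarith

theorem pencilsOf_nonempty (h2 : (2 : AlgebraicClosure F) ≠ 0)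
    (h3 : (3 : AlgebraicClosure F) ≠ 0) (hS : S.Nonempty) : (pencilsOf F S).Nonempty := by
  obtain ⟨σ, hσ⟩ := hS
  obtain ⟨w, hw, hσw, -⟩ := exists_frame_of_perm (F := F) h2 h3 σ
  exact ⟨_, w, ⟨hw, σ, hσ, hσw⟩, rfl⟩

/-- Every twisted frame comes from a pair in `Ψ`. -/
theorem exists_mem_smoothPairs (h2 : (2 : AlgebraicClosure F) ≠ 0)
    (h3 : (3 : AlgebraicClosure F) ≠ 0) (hq : 3 < Fintype.card F) (hu : IsFrame u)
    (hσ : IsTwisted σ u) :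
    ∃ A B : Conic F, A ∈ framePencil u ∧ B ∈ framePencil u ∧ A ≠ B ∧ (A, B) ∈ smoothPairs F := by
  obtain ⟨B, C, hB, hC, hCB, hBs⟩ := exists_members h2 h3 hu hσ
  have h := ncard_smooth_ne h2 hu hσ hCB hB hC hBs
  have hle := fixedPairs_le σ
  obtain ⟨A, hA, hAB, hAs⟩ := Set.nonempty_of_ncard_ne_zero
    (s := {A | A ∈ framePencil u ∧ A ≠ B ∧ A.IsSmooth}) (by omega)
  exact ⟨A, B, hA, hB, hAB, (mem_smoothPairs_iff h2 hu hA hB).mpr ⟨hAs, hBs, hAB⟩⟩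

theorem pencils_eq (h2 : (2 : AlgebraicClosure F) ≠ 0) (h3 : (3 : AlgebraicClosure F) ≠ 0)
    (hq : 3 < Fintype.card F) : pencils F = pencilsOf F Finset.univ := by
  ext W
  constructor
  · rintro ⟨⟨A, B⟩, h, rfl⟩
    obtain ⟨σ, u, hu, hσ, hA, hB⟩ := exists_twisted_frame h2 h
    have hAB := ((mem_smoothPairs_iff h2 hu hA hB).mp h).2.2
    exact ⟨u, ⟨hu, σ, Finset.mem_univ _, hσ⟩, (pencil_eq_framePencil h2 hu hA hB hAB).symm⟩
  · rintro ⟨u, ⟨hu, σ, -, hσ⟩, rfl⟩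
    obtain ⟨A, B, hA, hB, hAB, h⟩ := exists_mem_smoothPairs h2 h3 hq hu hσ
    exact ⟨(A, B), h, (pencil_eq_framePencil h2 hu hA hB hAB).symm⟩

theorem pencilsOfType_eq (h2 : (2 : AlgebraicClosure F) ≠ 0) (h3 : (3 : AlgebraicClosure F) ≠ 0)
    (hq : 3 < Fintype.card F) (τ : Multiset ℕ) : pencilsOfType F τ =
      pencilsOf F (Finset.univ.filter fun σ => σ.partition.parts = τ) := by
  ext W
  constructor
  · rintro ⟨⟨A, B⟩, ⟨h, hτ⟩, rfl⟩
    obtain ⟨σ, u, hu, hσ, hA, hB⟩ := exists_twisted_frame h2 h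
    have hAB := ((mem_smoothPairs_iff h2 hu hA hB).mp h).2.2
    exact ⟨u, ⟨hu, σ, Finset.mem_filter.mpr ⟨Finset.mem_univ _,
      (hasIntersectionType_iff h2 hu hσ hA hB hAB τ).mp hτ⟩, hσ⟩,
      (pencil_eq_framePencil h2 hu hA hB hAB).symm⟩
  · rintro ⟨u, ⟨hu, σ, hτ, hσ⟩, rfl⟩
    obtain ⟨A, B, hA, hB, hAB, h⟩ := exists_mem_smoothPairs h2 h3 hq hu hσ
    exact ⟨(A, B), ⟨h, (hasIntersectionType_iff h2 hu hσ hA hB hAB τ).mpr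
      (Finset.mem_filter.mp hτ).2⟩, (pencil_eq_framePencil h2 hu hA hB hAB).symm⟩

theorem proportion_pencilsOfType (h2 : (2 : AlgebraicClosure F) ≠ 0)
    (h3 : (3 : AlgebraicClosure F) ≠ 0) (hq : 3 < Fintype.card F) (τ : Multiset ℕ) :
    proportion (pencilsOfType F τ) (pencils F) =
      (Finset.univ.filter fun σ : Equiv.Perm (Fin 4) => σ.partition.parts = τ).card / 24 := by
  have hsub : pencilsOfType F τ ⊆ pencils F := by
    rintro W ⟨x, hx, rfl⟩
    exact ⟨x, hx.1, rfl⟩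
  rw [proportion, Set.inter_eq_left.mpr hsub, pencils_eq h2 h3 hq, pencilsOfType_eq h2 h3 hq]
  have h0 : 0 < (pencilsOf F Finset.univ).ncard :=
    (Set.ncard_pos (Set.toFinite _)).mpr (pencilsOf_nonempty h2 h3 Finset.univ_nonempty)
  rw [div_eq_div_iff (by exact_mod_cast h0.ne') (by norm_num), mul_comm]
  exact_mod_cast ncard_pencilsOf h2 h3 (S := Finset.univ.filter fun σ => σ.partition.parts = τ)
    (fun σ hσ π => by
      rw [Finset.mem_filter] at hσ ⊢
      refine ⟨Finset.mem_univ _, hσ.2 ▸ ?_⟩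
      congr 1
      rw [← Equiv.Perm.partition_eq_of_isConj, isConj_comm, isConj_iff]
      exact ⟨π⁻¹, by rw [inv_inv]⟩)

end CountingPencils

/-! ### Densities and error estimates -/

section Densities

theorem ncard_eq_sum_of_partition {α ι : Type*} [Finite α] (X : Set α) (I : Finset ι)
    (Y : ι → Set α) (hcover : ∀ x, x ∈ X ↔ ∃ i ∈ I, x ∈ Y i)
    (hdisj : ∀ x, ∀ i ∈ I, ∀ j ∈ I, x ∈ Y i → x ∈ Y j → i = j) :
    X.ncard = ∑ i ∈ I, (Y i).ncard := by
  classical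
  have := Fintype.ofFinite α
  have hX : X.toFinset = I.biUnion fun i => (Y i).toFinset := by
    ext x
    simp [hcover]
  simp only [Set.ncard_eq_toFinset_card']
  rw [hX, Finset.card_biUnion]
  intro i hi j hj hij
  refine Finset.disjoint_left.mpr ?_
  intro x hx hx'
  exact hij (hdisj x i hi j hj (Set.mem_toFinset.mp hx) (Set.mem_toFinset.mp hx'))

/-- The hypotheses bound `q ^ 2` times the error by `100`, and `q ^ (-2) ≤ q ^ (-3 / 2)` since `1 ≤
q`. -/
theorem abs_div_sub_div_le {q N T c : ℝ} (hq : 1 ≤ q) (hN : 0 < N)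
    (h1 : q * (q * T - c * N) ≤ 100 * N) (h2 : -(100 * N) ≤ q * (q * T - c * N)) :
    |T / N - c / q| ≤ 100 * q ^ (-(3 / 2) : ℝ) := by
  have hq0 : 0 < q := by linarith
  have hpow : q ^ (-2 : ℝ) ≤ q ^ (-(3 / 2) : ℝ) :=
    Real.rpow_le_rpow_of_exponent_le hq (by norm_num)
  have hq2 : q ^ (-2 : ℝ) = 1 / q ^ 2 := by
    rw [Real.rpow_neg hq0.le, Real.rpow_ofNat, one_div]
  refine le_trans ?_ (mul_le_mul_of_nonneg_left hpow (by norm_num))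
  have e : T / N - c / q = (q * (q * T - c * N)) / (q ^ 2 * N) := by
    field_simp
  have e' : 100 * q ^ (-2 : ℝ) = 100 * N / (q ^ 2 * N) := by
    rw [hq2]; field_simp
  rw [e, e', abs_div, abs_of_pos (by positivity : 0 < q ^ 2 * N)]
  gcongr
  exact abs_le.mpr ⟨h2, h1⟩

variable {F : Type*} [Field F] [Fintype F] {τ : Multiset ℕ} {s : ℕ}

theorem exists_frame_of_mem_pencilsOfType (h2 : (2 : AlgebraicClosure F) ≠ 0)
    (h3 : (3 : AlgebraicClosure F) ≠ 0) (hq : 3 < Fintype.card F) {W : Set (Conic F)}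
    (hW : W ∈ pencilsOfType F τ) : ∃ σ u, IsFrame u ∧ IsTwisted σ u ∧ σ.partition.parts = τ ∧
      framePencil u = W := by
  rw [pencilsOfType_eq h2 h3 hq] at hW
  obtain ⟨u, ⟨hu, σ, hτ, hσ⟩, rfl⟩ := hW
  exact ⟨σ, u, hu, hσ, (Finset.mem_filter.mp hτ).2, rfl⟩

theorem ncard_pairs_of_pencil (h2 : (2 : AlgebraicClosure F) ≠ 0)
    (h3 : (3 : AlgebraicClosure F) ≠ 0) (hq : 3 < Fintype.card F)
    (hs : ∀ σ : Equiv.Perm (Fin 4), σ.partition.parts = τ → fixedPairs σ = s)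
    {W : Set (Conic F)} (hW : W ∈ pencilsOfType F τ) :
    ((smoothPairsIn W).ncard : ℝ) = (Fintype.card F + 1 - s) * (Fintype.card F - s) ∧
    ((ponceletPairs F 4 ∩ smoothPairsIn W).ncard : ℝ) ≤ s * (Fintype.card F + 1 - s) ∧
    s * (Fintype.card F + 1 - s - 3 : ℝ) ≤
      ((ponceletPairs F 4 ∩ smoothPairsIn W).ncard : ℝ) := by
  obtain ⟨σ, u, hu, hσ, hτ, rfl⟩ := exists_frame_of_mem_pencilsOfType h2 h3 hq hW
  obtain ⟨B, C, hB, hC, hCB, hBs⟩ := exists_members h2 h3 hu hσ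
  rw [← hs σ hτ]
  exact ⟨ncard_smoothPairsIn h2 hu hσ hCB hB hC hBs, ncard_tetragonPairsIn h2 hu hσ hCB hB hC hBs⟩

/-- The pairs in `Ψ` of a given type are distributed among the pencils of that type. -/
theorem ncard_inter_smoothPairsOfType (h2 : (2 : AlgebraicClosure F) ≠ 0)
    (h3 : (3 : AlgebraicClosure F) ≠ 0) (hq : 3 < Fintype.card F) (τ : Multiset ℕ)
    (P : Set (Conic F × Conic F)) :
    (P ∩ smoothPairsOfType F τ).ncard =
      ∑ W ∈ (Set.toFinite (pencilsOfType F τ)).toFinset, (P ∩ smoothPairsIn W).ncard := by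
  apply ncard_eq_sum_of_partition
  · rintro ⟨A, B⟩
    simp only [Set.Finite.mem_toFinset]
    constructor
    · rintro ⟨hP, h, hτ⟩
      obtain ⟨σ, u, hu, hσ, hA, hB⟩ := exists_twisted_frame h2 h
      have hAB := ((mem_smoothPairs_iff h2 hu hA hB).mp h).2.2
      have hp := pencil_eq_framePencil h2 hu hA hB hAB
      exact ⟨_, ⟨(A, B), ⟨h, hτ⟩, rfl⟩, hP, h, hp ▸ hA, hp ▸ hB⟩
    · rintro ⟨W, hW, hP, h, hA, hB⟩
      obtain ⟨σ, u, hu, hσ, hτ, rfl⟩ := exists_frame_of_mem_pencilsOfType h2 h3 hq hW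
      have hAB := ((mem_smoothPairs_iff h2 hu hA hB).mp h).2.2
      exact ⟨hP, h, (hasIntersectionType_iff h2 hu hσ hA hB hAB τ).mpr hτ⟩
  · have key : ∀ W ∈ pencilsOfType F τ, ∀ A B : Conic F, (A, B) ∈ smoothPairsIn W →
        A.pencil B = W := by
      rintro W hW A B ⟨h, hA, hB⟩
      obtain ⟨σ, u, hu, hσ, hτ, rfl⟩ := exists_frame_of_mem_pencilsOfType h2 h3 hq hW
      exact pencil_eq_framePencil h2 hu hA hB ((mem_smoothPairs_iff h2 hu hA hB).mp h).2.2
    rintro ⟨A, B⟩ W hW W' hW' ⟨-, h⟩ ⟨-, h'⟩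
    rw [Set.Finite.mem_toFinset] at hW hW'
    rw [← key W hW A B h, key W' hW' A B h']

theorem ncard_pairs_of_type (h2 : (2 : AlgebraicClosure F) ≠ 0)
    (h3 : (3 : AlgebraicClosure F) ≠ 0) (hq : 3 < Fintype.card F)
    (hs : ∀ σ : Equiv.Perm (Fin 4), σ.partition.parts = τ → fixedPairs σ = s) :
    ((smoothPairsOfType F τ).ncard : ℝ) =
      (pencilsOfType F τ).ncard * ((Fintype.card F + 1 - s) * (Fintype.card F - s)) ∧
    ((ponceletPairs F 4 ∩ smoothPairsOfType F τ).ncard : ℝ) ≤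
      (pencilsOfType F τ).ncard * (s * (Fintype.card F + 1 - s)) ∧
    (pencilsOfType F τ).ncard * (s * (Fintype.card F + 1 - s - 3 : ℝ)) ≤
      ((ponceletPairs F 4 ∩ smoothPairsOfType F τ).ncard : ℝ) := by
  have e1 := ncard_inter_smoothPairsOfType h2 h3 hq τ Set.univ
  have e2 := ncard_inter_smoothPairsOfType h2 h3 hq τ (ponceletPairs F 4)
  simp only [Set.univ_inter] at e1
  have hb : ∀ W ∈ (Set.toFinite (pencilsOfType F τ)).toFinset, _ := fun W hW =>
    ncard_pairs_of_pencil h2 h3 hq hs ((Set.Finite.mem_toFinset _).mp hW)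
  rw [e1, e2, Set.ncard_eq_toFinset_card _ (Set.toFinite _)]
  push_cast
  refine ⟨?_, ?_, ?_⟩
  · rw [Finset.sum_congr rfl fun W hW => (hb W hW).1, Finset.sum_const,
      nsmul_eq_mul]
  · rw [← nsmul_eq_mul]
    exact Finset.sum_le_card_nsmul _ _ _ fun W hW => (hb W hW).2.1
  · rw [← nsmul_eq_mul]
    exact Finset.card_nsmul_le_sum _ _ _ fun W hW => (hb W hW).2.2

/-- Here `M` is the number of pencils counted, so one estimate covers a single pencil and a whole
type. Cleared of denominators it is polynomial in `q`, with `4 ≤ q` keeping all factors positive. -/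
theorem abs_proportion_sub_le {q M N T : ℝ} (hq : 4 ≤ q) (hM : 0 < M) (hs : s = 1 ∨ s = 3)
    (hN : N = M * ((q + 1 - s) * (q - s))) (hT : T ≤ M * (s * (q + 1 - s)))
    (hT' : M * (s * (q + 1 - s - 3)) ≤ T) :
    |T / N - s / q| ≤ 100 * q ^ (-(3 / 2) : ℝ) := by
  have hq1 : 0 < q - 3 := by linarith
  have hq2 : 0 < q - 2 := by linarith
  have hq3 : 0 < q - 1 := by linarith
  have hq0 : 0 < q := by linarith
  have a1 : 0 ≤ q * (q * (M * (s * (q + 1 - s)) - T)) :=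
    mul_nonneg hq0.le (mul_nonneg hq0.le (sub_nonneg.mpr hT))
  have a2 : 0 ≤ q * (q * (T - M * (s * (q + 1 - s - 3)))) :=
    mul_nonneg hq0.le (mul_nonneg hq0.le (sub_nonneg.mpr hT'))
  have p0 : 0 ≤ M * (q - 4) := mul_nonneg hM.le (by linarith)
  have p1 : 0 ≤ M * (q - 4) * (q - 4) := mul_nonneg p0 (by linarith)
  rcases hs with rfl | rfl <;> push_cast at *
  · apply abs_div_sub_div_le (by linarith)
    · rw [hN, show q + 1 - 1 = q by ring]
      positivity
    · rw [hN]
      nlinarith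
    · rw [hN]
      nlinarith
  · apply abs_div_sub_div_le (by linarith)
    · rw [hN, show q + 1 - 3 = q - 2 by ring]
      positivity
    · rw [hN]
      nlinarith
    · rw [hN]
      nlinarith

/-- The polynomials are averages over `S₄`: `s` equals `3`, `1`, `0` with weights `1/6`, `1/2`,
`1/3`. The mean of `(q + 1 - s) (q - s)` is `q ^ 2 - q + 1`, and those of the two tetragon bounds
are `q - 1` and `q - 4`. -/
theorem abs_proportion_sub_le_of_bounds {q M N T : ℝ} (hq : 4 ≤ q) (hM : 0 < M)
    (hN : N = M * (q ^ 2 - q + 1)) (hT : T ≤ M * (q - 1)) (hT' : M * (q - 4) ≤ T) :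
    |T / N - 1 / q| ≤ 100 * q ^ (-(3 / 2) : ℝ) := by
  have hq0 : 0 < q := by linarith
  have p1 : 0 ≤ q * (q * (M * (q - 1) - T)) :=
    mul_nonneg hq0.le (mul_nonneg hq0.le (sub_nonneg.mpr hT))
  have p2 : 0 ≤ q * (q * (T - M * (q - 4))) :=
    mul_nonneg hq0.le (mul_nonneg hq0.le (sub_nonneg.mpr hT'))
  have p0 : 0 ≤ M * (q - 4) := mul_nonneg hM.le (by linarith)
  have p3 : 0 ≤ M * (q - 4) * (q - 4) := mul_nonneg p0 (by linarith)
  apply abs_div_sub_div_le (by linarith)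
  · rw [hN]
    exact mul_pos hM (by nlinarith)
  · rw [hN]
    nlinarith
  · rw [hN]
    nlinarith

theorem tetragonDensity (h2 : (2 : AlgebraicClosure F) ≠ 0) (h3 : (3 : AlgebraicClosure F) ≠ 0)
    (hq : 3 < Fintype.card F)
    (hs : ∀ σ : Equiv.Perm (Fin 4), σ.partition.parts = τ → fixedPairs σ = s)
    (hs' : s = 1 ∨ s = 3) (hτ : ∃ σ : Equiv.Perm (Fin 4), σ.partition.parts = τ) :
    TetragonDensity F 100 τ s := by
  have hq' : (4 : ℝ) ≤ Fintype.card F := by exact_mod_cast hq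
  constructor
  · obtain ⟨a, b, c⟩ := ncard_pairs_of_type h2 h3 hq hs
    refine abs_proportion_sub_le hq' ?_ hs' a b c
    have : (pencilsOfType F τ).Nonempty := by
      obtain ⟨σ, hσ⟩ := hτ
      rw [pencilsOfType_eq h2 h3 hq]
      exact pencilsOf_nonempty h2 h3 ⟨σ, by simpa using hσ⟩
    exact_mod_cast (Set.ncard_pos (Set.toFinite _)).mpr this
  · intro W hW
    obtain ⟨a, b, c⟩ := ncard_pairs_of_pencil h2 h3 hq hs hW
    exact abs_proportion_sub_le hq' one_pos hs' (by rw [one_mul, a]) (by rwa [one_mul])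
      (by rwa [one_mul])

theorem ncard_inter_smoothPairs (h2 : (2 : AlgebraicClosure F) ≠ 0)
    (P : Set (Conic F × Conic F)) :
    (P ∩ smoothPairs F).ncard = (P ∩ smoothPairsOfType F {1, 1, 1, 1}).ncard +
      (P ∩ smoothPairsOfType F {2, 1, 1}).ncard + (P ∩ smoothPairsOfType F {2, 2}).ncard +
      (P ∩ smoothPairsOfType F {3, 1}).ncard + (P ∩ smoothPairsOfType F {4}).ncard := by
  rw [ncard_eq_sum_of_partition (P ∩ smoothPairs F)
    ({{1, 1, 1, 1}, {2, 1, 1}, {2, 2}, {3, 1}, {4}} : Finset (Multiset ℕ))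
    (fun τ => P ∩ smoothPairsOfType F τ)]
  · rw [Finset.sum_insert (by decide), Finset.sum_insert (by decide),
      Finset.sum_insert (by decide), Finset.sum_insert (by decide), Finset.sum_singleton]
    ring
  · rintro ⟨A, B⟩
    constructor
    · rintro ⟨hP, h⟩
      obtain ⟨σ, u, hu, hσ, hA, hB⟩ := exists_twisted_frame h2 h
      have hAB := ((mem_smoothPairs_iff h2 hu hA hB).mp h).2.2
      refine ⟨σ.partition.parts, ?_, hP, h,
        (hasIntersectionType_iff h2 hu hσ hA hB hAB _).mpr rfl⟩
      simpa using partition_parts_cases σ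
    · rintro ⟨τ, -, hP, h, -⟩
      exact ⟨hP, h⟩
  · rintro ⟨A, B⟩ τ - τ' - ⟨-, h, hτ⟩ ⟨-, -, hτ'⟩
    obtain ⟨σ, u, hu, hσ, hA, hB⟩ := exists_twisted_frame h2 h
    have hAB := ((mem_smoothPairs_iff h2 hu hA hB).mp h).2.2
    rw [← (hasIntersectionType_iff h2 hu hσ hA hB hAB _).mp hτ,
      ← (hasIntersectionType_iff h2 hu hσ hA hB hAB _).mp hτ']

theorem ncard_pencilsOfType (h2 : (2 : AlgebraicClosure F) ≠ 0)
    (h3 : (3 : AlgebraicClosure F) ≠ 0) (hq : 3 < Fintype.card F) :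
    0 < (pencils F).ncard ∧ ∀ τ, ((pencilsOfType F τ).ncard : ℝ) =
      (Finset.univ.filter fun σ : Equiv.Perm (Fin 4) => σ.partition.parts = τ).card / 24 *
        (pencils F).ncard := by
  have h0 : 0 < (pencils F).ncard := by
    rw [pencils_eq h2 h3 hq]
    exact (Set.ncard_pos (Set.toFinite _)).mpr (pencilsOf_nonempty h2 h3 Finset.univ_nonempty)
  refine ⟨h0, fun τ => ?_⟩
  rw [← proportion_pencilsOfType h2 h3 hq, proportion, div_mul_cancel₀ _ (by exact_mod_cast h0.ne')]
  congr 2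
  refine (Set.inter_eq_left.mpr ?_).symm
  rintro W ⟨x, hx, rfl⟩
  exact ⟨x, hx.1, rfl⟩

theorem abs_proportion_smoothPairs_sub_le (h2 : (2 : AlgebraicClosure F) ≠ 0)
    (h3 : (3 : AlgebraicClosure F) ≠ 0) (hq : 3 < Fintype.card F) :
    |proportion (ponceletPairs F 4) (smoothPairs F) - 1 / (Fintype.card F : ℝ)|
      ≤ 100 * (Fintype.card F : ℝ) ^ (-(3 / 2) : ℝ) := by
  have hq' : (4 : ℝ) ≤ Fintype.card F := by exact_mod_cast hq
  obtain ⟨hM, hτ⟩ := ncard_pencilsOfType h2 h3 hq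
  have hM' : (0 : ℝ) < (pencils F).ncard := by exact_mod_cast hM
  obtain ⟨c1, c2, c3, c4, c5⟩ := card_partition_parts
  have m1 := hτ {1, 1, 1, 1}
  have m2 := hτ {2, 1, 1}
  have m3 := hτ {2, 2}
  have m4 := hτ {3, 1}
  have m5 := hτ {4}
  rw [c1] at m1
  rw [c2] at m2
  rw [c3] at m3
  rw [c4] at m4
  rw [c5] at m5
  obtain ⟨a1, b1, d1⟩ := ncard_pairs_of_type h2 h3 hq fun σ => (fixedPairs_eq σ).1
  obtain ⟨a2, b2, d2⟩ := ncard_pairs_of_type h2 h3 hq fun σ => (fixedPairs_eq σ).2.1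
  obtain ⟨a3, b3, d3⟩ := ncard_pairs_of_type h2 h3 hq fun σ => (fixedPairs_eq σ).2.2.1
  obtain ⟨a4, b4, d4⟩ := ncard_pairs_of_type h2 h3 hq fun σ => (fixedPairs_eq σ).2.2.2.1
  obtain ⟨a5, b5, d5⟩ := ncard_pairs_of_type h2 h3 hq fun σ => (fixedPairs_eq σ).2.2.2.2
  rw [m1] at a1 b1 d1
  rw [m2] at a2 b2 d2
  rw [m3] at a3 b3 d3
  rw [m4] at a4 b4 d4
  rw [m5] at a5 b5 d5
  have e1 : ((smoothPairs F).ncard : ℝ) = _ :=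
    congrArg (Nat.cast (R := ℝ)) (by simpa only [Set.univ_inter] using ncard_inter_smoothPairs h2 Set.univ)
  have e2 : ((ponceletPairs F 4 ∩ smoothPairs F).ncard : ℝ) = _ :=
    congrArg (Nat.cast (R := ℝ)) (ncard_inter_smoothPairs h2 (ponceletPairs F 4))
  push_cast at e1 e2 a1 b1 d1 a2 b2 d2 a3 b3 d3 a4 b4 d4 a5 b5 d5
  rw [proportion]
  generalize ((pencils F).ncard : ℝ) = M at *
  generalize (Fintype.card F : ℝ) = q at *
  generalize ((ponceletPairs F 4 ∩ smoothPairs F).ncard : ℝ) = T at *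
  generalize ((smoothPairs F).ncard : ℝ) = N at *
  refine abs_proportion_sub_le_of_bounds (M := M) hq' hM' ?_ ?_ ?_
  · rw [e1, a1, a2, a3, a4, a5]; ring
  · rw [e2]; linarith
  · rw [e2]; linarith

/-- A three-cycle fixes no pair of opposite sides, so the upper bound on the number of tetragon
pairs is `0`. -/
theorem disjoint_ponceletPairs_smoothPairsOfType (h2 : (2 : AlgebraicClosure F) ≠ 0)
    (h3 : (3 : AlgebraicClosure F) ≠ 0) (hq : 3 < Fintype.card F) :
    Disjoint (ponceletPairs F 4) (smoothPairsOfType F {3, 1}) := by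
  have h := (ncard_pairs_of_type h2 h3 hq fun σ => (fixedPairs_eq σ).2.2.2.1).2.1
  rw [Nat.cast_zero, zero_mul, mul_zero] at h
  rw [Set.disjoint_iff_inter_eq_empty, ← Set.ncard_eq_zero (Set.toFinite _)]
  have : (ponceletPairs F 4 ∩ smoothPairsOfType F {3, 1}).ncard ≤ 0 := by exact_mod_cast h
  omega

end Densities

end Poncelet

/-! ### The main theorem, with absolute constant `100` -/

theorem mainTheorem4 :
    ∃ C : ℝ, ∀ (F : Type*) [Field F] [Fintype F], 3 < ringChar F →
      -- the density `|Γ₄| / |Ψ|`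
      |Poncelet.proportion (Poncelet.ponceletPairs F 4) (Poncelet.smoothPairs F)
            - 1 / (Fintype.card F : ℝ)|
          ≤ C * (Fintype.card F : ℝ) ^ (-(3 / 2) : ℝ) ∧
      -- the density of the pencils of each type
      Poncelet.proportion (Poncelet.pencilsOfType F {1, 1, 1, 1}) (Poncelet.pencils F) = 1 / 24 ∧
      Poncelet.proportion (Poncelet.pencilsOfType F {2, 1, 1}) (Poncelet.pencils F) = 1 / 4 ∧
      Poncelet.proportion (Poncelet.pencilsOfType F {2, 2}) (Poncelet.pencils F) = 1 / 8 ∧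
      Poncelet.proportion (Poncelet.pencilsOfType F {3, 1}) (Poncelet.pencils F) = 1 / 3 ∧
      Poncelet.proportion (Poncelet.pencilsOfType F {4}) (Poncelet.pencils F) = 1 / 4 ∧
      -- the density of the pairs satisfying the tetragon condition, for each type
      Poncelet.TetragonDensity F C {1, 1, 1, 1} 3 ∧
      Poncelet.TetragonDensity F C {2, 1, 1} 1 ∧
      Poncelet.TetragonDensity F C {2, 2} 3 ∧
      Poncelet.TetragonDensity F C {4} 1 ∧
      -- for type `(3, 1)` the density is exactly zero
      Disjoint (Poncelet.ponceletPairs F 4) (Poncelet.smoothPairsOfType F {3, 1}) := by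
  refine ⟨100, fun F _ _ hF => ?_⟩
  have hchar : CharP (AlgebraicClosure F) (ringChar F) :=
    charP_of_injective_algebraMap' F (ringChar F)
  -- Characteristic above `3` makes `2` and `3` invertible and gives `3 < q`, so that every pencil
  -- retains at least two smooth conics.
  have hne : ∀ n : ℕ, 0 < n → n ≤ 3 → (n : AlgebraicClosure F) ≠ 0 := by
    intro n hn hn3 h
    have := Nat.le_of_dvd hn ((CharP.cast_eq_zero_iff (AlgebraicClosure F) (ringChar F) n).mp h)
    omega
  have h2 : (2 : AlgebraicClosure F) ≠ 0 := by exact_mod_cast hne 2 (by norm_num) (by norm_num)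
  have h3 : (3 : AlgebraicClosure F) ≠ 0 := by exact_mod_cast hne 3 (by norm_num) (by norm_num)
  have hq : 3 < Fintype.card F := by
    refine hF.trans_le (Nat.le_of_dvd Fintype.card_pos ?_)
    rw [← CharP.cast_eq_zero_iff F (ringChar F), Nat.cast_card_eq_zero]
  obtain ⟨c1, c2, c3, c4, c5⟩ := Poncelet.card_partition_parts
  refine ⟨Poncelet.abs_proportion_smoothPairs_sub_le h2 h3 hq, ?_, ?_, ?_, ?_, ?_, ?_, ?_, ?_, ?_,
    Poncelet.disjoint_ponceletPairs_smoothPairsOfType h2 h3 hq⟩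
  · rw [Poncelet.proportion_pencilsOfType h2 h3 hq, c1]; norm_num
  · rw [Poncelet.proportion_pencilsOfType h2 h3 hq, c2]; norm_num
  · rw [Poncelet.proportion_pencilsOfType h2 h3 hq, c3]; norm_num
  · rw [Poncelet.proportion_pencilsOfType h2 h3 hq, c4]; norm_num
  · rw [Poncelet.proportion_pencilsOfType h2 h3 hq, c5]; norm_num
  · exact_mod_cast Poncelet.tetragonDensity h2 h3 hq (fun σ => (Poncelet.fixedPairs_eq σ).1)
      (.inr rfl) (by decide)
  · exact_mod_cast Poncelet.tetragonDensity h2 h3 hq (fun σ => (Poncelet.fixedPairs_eq σ).2.1)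
      (.inl rfl) (by decide)
  · exact_mod_cast Poncelet.tetragonDensity h2 h3 hq (fun σ => (Poncelet.fixedPairs_eq σ).2.2.1)
      (.inr rfl) (by decide)
  · exact_mod_cast Poncelet.tetragonDensity h2 h3 hq
      (fun σ => (Poncelet.fixedPairs_eq σ).2.2.2.2) (.inl rfl) (by decide)
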